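/- Let $F$ be a field containing the field of rational functions $K=\mathbb{C}(u)$ (for instance $F=K$, or $F=K(\mathsf A,\mathsf B)$ with $\mathsf A,\mathsf B$ indeterminates), and let $\mathsf A,\mathsf B\in F$. For $n\ge 1$ let $\mathcal E_n$ be the unital associative $F$-algebra generated by $T_1,\dots,T_{n-1},E_1,\dots,E_{n-1}$ subject to the relations (for all indices $i,j$) $$T_iT_j=T_jT_i\ (|i-j|>1),\qquad T_iT_jT_i=T_jT_iT_j\ (|i-j|=1),\qquad T_i^2=1+(u-1)E_i(1+T_i),$$ $$E_iE_j=E_jE_i,\qquad E_i^2=E_i,\qquad E_iT_i=T_iE_i,\qquad E_iT_j=T_jE_i\ (|i-j|>1),$$ $$E_iE_jT_i=T_iE_iE_j=E_jT_iE_j,\qquad E_iT_jT_i=T_jT_iE_j\qquad(|i-j|=1),$$ so that $\mathcal E_1=F$; put also $\mathcal E_0=F$. The assignments $T_i\mapsto T_i$, $E_i\mapsto E_i$ define homomorphisms $\mathcal E_{n-1}\to\mathcal E_n$, through which elements of $\mathcal E_{n-1}$ are regarded as elements of $\mathcal E_n$. The $T_i$ are invertible. For $1\le i<j\le n$ put $E_{i,j}=T_i\cdots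 T_{j-2}E_{j-1}T_{j-2}^{-1}\cdots T_i^{-1}$ (so $E_{i,i+1}=E_i$); these elements commute. For a set partition $I$ of $\{1,\dots,n\}$ let $E_I$ be the product of the $E_{i,j}$ over all pairs $i<j$ lying in a common block of $I$. For $0\le k\le i$ let $\mathbb T_{i,0}=1$ and $\mathbb T_{i,k}=T_iT_{i-1}\cdots T_k$ if $k\ge1$. Let $\operatorname{Supp}(I)$ be the union of the blocks of $I$ with at least two elements, let $I\backslash n$ be the set partition of $\{1,\dots,n-1\}$ obtained from $I$ by removing $n$, and for $k<n$ let $\tau_{n,k}(I)$ be obtained from $I$ by merging the blocks of $k$ and $n$ and then removing $n$. Then the following holds. For every $n$ the elements $$\mathbb T_{1,k_1}\mathbb T_{2,k_2}\cdots\mathbb T_{n-1,k_{n-1}}E_I\qquad(0\le k_j\le j,\ I\text{ a set partition of }\{1,\dots,n\})$$ form a basis of $\mathcal E_n$ over $F$ (the Ryom-Hansen basis), so there are unique $F$-linear maps $\varrho_n:\mathcal E_n\to\mathcal E_{n-1}$, $n>1$, with $$\varrho_n(\mathbb T_{1,k_1}\cdots\mathbb T_{n-1,k_{n-1}}E_I)=\begin{cases}\mathbb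 T_{1,k_1}\cdots\mathbb T_{n-2,k_{n-2}}E_{I\backslash n}& k_{n-1}=0,\ n\notin\operatorname{Supp}(I),\\ \mathsf B\,\mathbb T_{1,k_1}\cdots\mathbb T_{n-2,k_{n-2}}E_{I\backslash n}& k_{n-1}=0,\ n\in\operatorname{Supp}(I),\\ \mathsf A\,\mathbb T_{1,k_1}\cdots\mathbb T_{n-2,k_{n-2}}\,(T_{n-2}T_{n-3}\cdots T_{k_{n-1}})\,E_{\tau_{n,k_{n-1}}(I)}& k_{n-1}\ne0,\end{cases}$$ where the product in parentheses is $1$ if $k_{n-1}=n-1$; let $\varrho_1:\mathcal E_1=F\to F=\mathcal E_0$ be the identity. For all $n>1$, $X,Z\in\mathcal E_{n-1}$ and $Y\in\mathcal E_n$, $$\varrho_n(XYZ)=X\varrho_n(Y)Z,$$ $$\varrho_{n-1}(\varrho_n(T_{n-1}Y))=\varrho_{n-1}(\varrho_n(YT_{n-1})),\qquad \varrho_{n-1}(\varrho_n(E_{n-1}Y))=\varrho_{n-1}(\varrho_n(YE_{n-1})).$$ -/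

import Mathlib

/-! The algebra of braids and ties and the linear maps defined on its Ryom-Hansen basis.

Strands are numbered from `0`: the strand `a : Fin n` is the strand `a + 1` of `{1, …, n}`.
The generators `T`, `E` keep their usual numbers `1, …, n - 1`. -/

noncomputable section

namespace BT

/-- The generating symbols of the bt-algebra on `n` strands.
The index `i : Fin (n - 1)` stands for the generators number `i + 1`. -/
inductive Gen (n : ℕ) : Type
  | T (i : Fin (n - 1)) : Gen n
  | E (i : Fin (n - 1)) : Gen n

/-- `|i - j| = 1` -/
def Near (i j : ℕ) : Prop := i + 1 = j ∨ j + 1 = i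

/-- `|i - j| > 1` -/
def Far (i j : ℕ) : Prop := i + 1 < j ∨ j + 1 < i

/-- The letter `T_{i+1}` of the free algebra. -/
def fT (F : Type*) [Field F] {n : ℕ} (i : Fin (n - 1)) : FreeAlgebra F (Gen n) :=
  FreeAlgebra.ι F (Gen.T i)

/-- The letter `E_{i+1}` of the free algebra. -/
def fE (F : Type*) [Field F] {n : ℕ} (i : Fin (n - 1)) : FreeAlgebra F (Gen n) :=
  FreeAlgebra.ι F (Gen.E i)

/-- The defining relations of the bt-algebra with parameter `u`. -/
inductive Rel {F : Type*} [Field F] (u : F) (n : ℕ) :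
    FreeAlgebra F (Gen n) → FreeAlgebra F (Gen n) → Prop
  | TT_far (i j : Fin (n - 1)) (h : Far i j) : Rel u n (fT F i * fT F j) (fT F j * fT F i)
  | TTT (i j : Fin (n - 1)) (h : Near i j) :
      Rel u n (fT F i * fT F j * fT F i) (fT F j * fT F i * fT F j)
  | T_sq (i : Fin (n - 1)) :
      Rel u n (fT F i ^ 2) (1 + (u - 1) • (fE F i * (1 + fT F i)))
  | EE (i j : Fin (n - 1)) : Rel u n (fE F i * fE F j) (fE F j * fE F i)
  | E_sq (i : Fin (n - 1)) : Rel u n (fE F i ^ 2) (fE F i)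
  | ET (i : Fin (n - 1)) : Rel u n (fE F i * fT F i) (fT F i * fE F i)
  | ET_far (i j : Fin (n - 1)) (h : Far i j) : Rel u n (fE F i * fT F j) (fT F j * fE F i)
  | EET (i j : Fin (n - 1)) (h : Near i j) :
      Rel u n (fE F i * fE F j * fT F i) (fT F i * fE F i * fE F j)
  | TEE (i j : Fin (n - 1)) (h : Near i j) :
      Rel u n (fT F i * fE F i * fE F j) (fE F j * fT F i * fE F j)
  | ETT (i j : Fin (n - 1)) (h : Near i j) :
      Rel u n (fE F i * fT F j * fT F i) (fT F j * fT F i * fE F j)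

end BT

/-- The bt-algebra (algebra of braids and ties) `𝓔_n(u)` over the field `F`, presented by
generators and relations. For `n = 1` there are no generators and it is `F` itself; the case
`n = 0` is by convention `F` as well. -/
def BT {F : Type*} [Field F] (u : F) (n : ℕ) : Type _ := RingQuot (BT.Rel u n)

namespace BT

instance {F : Type*} [Field F] (u : F) (n : ℕ) : Ring (BT u n) :=
  inferInstanceAs (Ring (RingQuot (Rel u n)))

instance {F : Type*} [Field F] (u : F) (n : ℕ) : Algebra F (BT u n) :=
  inferInstanceAs (Algebra F (RingQuot (Rel u n)))

variable {F : Type*} [Field F] (u : F) (n : ℕ)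

/-- The projection of the free algebra onto the bt-algebra. -/
def mk : FreeAlgebra F (Gen n) →ₐ[F] BT u n := RingQuot.mkAlgHom F (Rel u n)

/-- The generator `T_i`, `1 ≤ i ≤ n - 1` (the value `1` for other `i` is never used). -/
def T (i : ℕ) : BT u n := if h : 1 ≤ i ∧ i < n then mk u n (fT F ⟨i - 1, by omega⟩) else 1

/-- The generator `E_i`, `1 ≤ i ≤ n - 1` (the value `1` for other `i` is never used). -/
def E (i : ℕ) : BT u n := if h : 1 ≤ i ∧ i < n then mk u n (fE F ⟨i - 1, by omega⟩) else 1

theorem mk_fT (i : Fin (n - 1)) : mk u n (fT F i) = T u n (i + 1) := by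
  have h : 1 ≤ (i : ℕ) + 1 ∧ (i : ℕ) + 1 < n := by omega
  simp [T, h]

theorem mk_fE (i : Fin (n - 1)) : mk u n (fE F i) = E u n (i + 1) := by
  have h : 1 ≤ (i : ℕ) + 1 ∧ (i : ℕ) + 1 < n := by omega
  simp [E, h]

/-- The map on generating symbols behind the inclusion `𝓔_n ⊂ 𝓔_{n+1}`. -/
def genIncl : Gen n → Gen (n + 1)
  | Gen.T i => Gen.T ⟨i, by omega⟩
  | Gen.E i => Gen.E ⟨i, by omega⟩

/-- The free-algebra version of the inclusion. -/
def freeIncl (F : Type*) [Field F] (n : ℕ) :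
    FreeAlgebra F (Gen n) →ₐ[F] FreeAlgebra F (Gen (n + 1)) :=
  FreeAlgebra.lift F (fun g => FreeAlgebra.ι F (genIncl n g))

theorem freeIncl_fT (i : Fin (n - 1)) :
    freeIncl F n (fT F i) = fT F (n := n + 1) ⟨i, by omega⟩ := by
  simp [freeIncl, fT, genIncl]

theorem freeIncl_fE (i : Fin (n - 1)) :
    freeIncl F n (fE F i) = fE F (n := n + 1) ⟨i, by omega⟩ := by
  simp [freeIncl, fE, genIncl]

theorem freeIncl_rel {x y : FreeAlgebra F (Gen n)} (h : Rel u n x y) :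
    Rel u (n + 1) (freeIncl F n x) (freeIncl F n y) := by
  cases h <;> simp only [map_mul, map_add, map_pow, map_one, map_smul, freeIncl_fT, freeIncl_fE]
  case TT_far i j h => exact Rel.TT_far _ _ h
  case TTT i j h => exact Rel.TTT _ _ h
  case T_sq i => exact Rel.T_sq _
  case EE i j => exact Rel.EE _ _
  case E_sq i => exact Rel.E_sq _
  case ET i => exact Rel.ET _
  case ET_far i j h => exact Rel.ET_far _ _ h
  case EET i j h => exact Rel.EET _ _ h
  case TEE i j h => exact Rel.TEE _ _ h
  case ETT i j h => exact Rel.ETT _ _ h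

/-- The map `𝓔_n → 𝓔_{n+1}` of the tower of bt-algebras, `T_i ↦ T_i`, `E_i ↦ E_i`. -/
def incl : BT u n →ₐ[F] BT u (n + 1) :=
  RingQuot.liftAlgHom F
    ⟨(mk u (n + 1)).comp (freeIncl F n),
      fun _ _ h => RingQuot.mkAlgHom_rel F (freeIncl_rel u n h)⟩

/-- Auxiliary recursion for `E_{i,j}`, where `d = j - i - 1`: it gives `E_{i,i+1} = E_i` and
`E_{i,j} = T_i E_{i+1,j} T_i⁻¹`. -/
def tieAux : ℕ → ℕ → BT u n
  | i, 0 => E u n i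
  | i, d + 1 => T u n i * tieAux (i + 1) d * Ring.inverse (T u n i)

/-- `E_{i,j} = T_i ⋯ T_{j-2} E_{j-1} T_{j-2}⁻¹ ⋯ T_i⁻¹` for `1 ≤ i < j ≤ n`. -/
def tie (i j : ℕ) : BT u n := tieAux u n i (j - i - 1)

/-- `E_I` for a set-partition `I` of the strands: the product of the (mutually commuting)
`E_{i,j}` over all pairs `i < j` of strands in a common block of `I`. -/
def tiePart (I : Setoid (Fin n)) : BT u n :=
  open Classical in
  (((List.finRange n ×ˢ List.finRange n).filter
    (fun p => p.1 < p.2 ∧ I p.1 p.2)).map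
      (fun p => tie u n ((p.1 : ℕ) + 1) ((p.2 : ℕ) + 1))).prod

/-- The descending product `T_i T_{i-1} ⋯ T_k`, equal to `1` if `i < k`. -/
def descending : ℕ → ℕ → BT u n
  | 0, _ => 1
  | i + 1, k => if k ≤ i + 1 then T u n (i + 1) * descending i k else 1

/-- `𝕋_{i,k}`: it is `1` for `k = 0` and `T_i T_{i-1} ⋯ T_k` for `1 ≤ k ≤ i`. -/
def bigT (i k : ℕ) : BT u n := if k = 0 then 1 else descending u n i k

/-- The product `𝕋_{1,k_1} 𝕋_{2,k_2} ⋯ 𝕋_{n-1,k_{n-1}}`, where `0 ≤ k_i ≤ i`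
(the index `i = 0` is included for uniformity; `k_0 = 0` and `𝕋_{0,0} = 1`). -/
def braidWord (k : ∀ i : Fin n, Fin ((i : ℕ) + 1)) : BT u n :=
  (List.ofFn fun i : Fin n => bigT u n i (k i)).prod

/-- The elements of the Ryom-Hansen basis:
`𝕋_{1,k_1} 𝕋_{2,k_2} ⋯ 𝕋_{n-1,k_{n-1}} E_I`. -/
def basisElt (x : (∀ i : Fin n, Fin ((i : ℕ) + 1)) × Setoid (Fin n)) : BT u n :=
  braidWord u n x.1 * tiePart u n x.2

/-- The set-partition `I ∗ {a, b}`: the blocks of `a` and `b` are merged. -/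
def merge {α : Type*} (I : Setoid α) (a b : α) : Setoid α :=
  I ⊔ Relation.EqvGen.setoid (fun x y => x = a ∧ y = b)

/-- `a ∈ Supp I`: the block of `a` is not a singleton. -/
def InSupp {α : Type*} (I : Setoid α) (a : α) : Prop := ∃ b, b ≠ a ∧ I a b

/-- The set-partition of the first `n` strands obtained from a set-partition of `n + 1` strands by
removing the last strand. -/
def removeLast {n : ℕ} (I : Setoid (Fin (n + 1))) : Setoid (Fin n) := I.comap Fin.castSucc

/-- The value prescribed for the relative trace `𝓔_{n+1} → 𝓔_n` on the basis element with indices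
`k` and `I`. In the last case `k_n ≠ 0`, the factor `𝕋_{n,k_n} = T_n T_{n-1} ⋯ T_{k_n}` is replaced
by `T_{n-1} ⋯ T_{k_n}`, and `I` by `τ_{n+1,k_n}(I) = (I ∗ {k_n, n+1}) \ (n+1)`. -/
def relTraceValue (A B : F)
    (x : (∀ i : Fin (n + 1), Fin ((i : ℕ) + 1)) × Setoid (Fin (n + 1))) : BT u n :=
  open Classical in
  let w : BT u n := braidWord u n (fun i : Fin n => x.1 i.castSucc)
  let k : ℕ := x.1 (Fin.last n)
  let I : Setoid (Fin (n + 1)) := x.2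
  if h : k = 0 then
    if InSupp I (Fin.last n) then B • (w * tiePart u n (removeLast I))
    else w * tiePart u n (removeLast I)
  else
    A • (w * descending u n (n - 1) k *
      tiePart u n (removeLast (merge I ⟨k - 1, by omega⟩ (Fin.last n))))

end BT

end

/-!
The algebra of braids and ties has the Ryom-Hansen basis, and the relative traces defined on it are
bimodule maps whose successive compositions have the trace property.

*The basis.* The ties `E_{a,b}` commute, are idempotent, satisfy
`E_{a,b} E_{b,c} E_{a,c} = E_{a,b} E_{b,c}`, and are permuted by conjugation with the `T_i`
(`et_mul_T`). Therefore a product of ties depends only on the set partition that it generates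
(`tiePart_mul_et_eq`), and the algebra on `n + 1` strands is spanned by the products
`x (T_n ⋯ T_k) E_I` with `x` from `n` strands; induction gives `span_basisElt`. For the
independence, the algebra acts on functions of configurations of coloured and ranked particles
(`rep`): `T_i` acts as in a Hecke algebra on neighbours of the same colour and exchanges neighbours
of different colours, and `E_{a,b}` restricts to equal colours at `a` and `b`. On configurations with
increasing ranks the braid part of a basis element only permutes the particles, and differently for
different words, while `E_I` tests whether `I` refines the partition into colours. Triangularity
with respect to refinement gives `linearIndependent_basisElt`. All this needs only `u ≠ 0`.

*The bimodule property.* As a bimodule over the algebra on `n + 1` strands, the algebra on `n + 2`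
strands is spanned by the four elements `g = 1, E, T, E T` of its last generators
(`lastBimodule_induction`). Moving ties and descending products through the basis elements shows
that `ϱ (x g z)` is `x z`, `B x z`, `A x z`, `A x z` respectively, from which the bimodule property
`relTrace_incl_mul_mul_incl` is immediate.

*The trace property.* Let `X` be `E` or `T` with the highest index. Applying the decomposition to
`Y = x g y` and again to `x` and `y`, and pulling out everything that commutes with `X` and `g`, one
is left with the identity `ϱ (ϱ (X a g) z b) = ϱ (a z ϱ (g b X))` for last products `g` and, one
strand lower, `a`, `b`. The maps `a ↦ ϱ (X a g)` and `b ↦ ϱ (g b X)` turn out to have the same six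
coefficients (`HasValues`), computed from the relations on three consecutive strands
(`Consecutive`). The form `(a, b) ↦ ϱ (a z b)` is nearly constant on `E`, `T`, `E T`
(`exists_formValues`), again because of these coefficients, and with respect to such a form the two
maps are adjoint (`relTrace_mul_incl_mul_adjoint`).
-/

noncomputable section

namespace BT

variable {F : Type*} [Field F] {u : F}

/-! ### The defining relations and the tower of algebras -/

theorem T_eq_mk {n i : ℕ} (h1 : 1 ≤ i) (h2 : i < n) :
    T u n i = mk u n (fT F ⟨i - 1, by omega⟩) := by
  simp [T, h1, h2]

theorem E_eq_mk {n i : ℕ} (h1 : 1 ≤ i) (h2 : i < n) :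
    E u n i = mk u n (fE F ⟨i - 1, by omega⟩) := by
  simp [E, h1, h2]

theorem mk_rel {n : ℕ} {x y : FreeAlgebra F (Gen n)} (h : Rel u n x y) : mk u n x = mk u n y :=
  RingQuot.mkAlgHom_rel F h

section Relations

variable {n i j : ℕ}

theorem T_comm_of_far (hi : 1 ≤ i) (hin : i < n) (hj : 1 ≤ j) (hjn : j < n) (h : Far i j) :
    T u n i * T u n j = T u n j * T u n i := by
  rw [T_eq_mk hi hin, T_eq_mk hj hjn]
  simpa using mk_rel (Rel.TT_far (u := u) (n := n) _ _ (by simp [Far] at *; omega))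

theorem T_braid (hi : 1 ≤ i) (hin : i < n) (hj : 1 ≤ j) (hjn : j < n) (h : Near i j) :
    T u n i * T u n j * T u n i = T u n j * T u n i * T u n j := by
  rw [T_eq_mk hi hin, T_eq_mk hj hjn]
  simpa using mk_rel (Rel.TTT (u := u) (n := n) _ _ (by simp [Near] at *; omega))

theorem T_mul_self (hi : 1 ≤ i) (hin : i < n) :
    T u n i * T u n i = 1 + (u - 1) • (E u n i + E u n i * T u n i) := by
  rw [T_eq_mk hi hin, E_eq_mk hi hin]
  simpa [sq, mul_add] using mk_rel (Rel.T_sq (u := u) (n := n) ⟨i - 1, by omega⟩)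

theorem E_comm (hi : 1 ≤ i) (hin : i < n) (hj : 1 ≤ j) (hjn : j < n) :
    E u n i * E u n j = E u n j * E u n i := by
  rw [E_eq_mk hi hin, E_eq_mk hj hjn]
  simpa using mk_rel (Rel.EE (u := u) (n := n) _ _)

theorem E_mul_self (hi : 1 ≤ i) (hin : i < n) : E u n i * E u n i = E u n i := by
  rw [E_eq_mk hi hin]
  simpa [sq] using mk_rel (Rel.E_sq (u := u) (n := n) ⟨i - 1, by omega⟩)

theorem E_mul_T (hi : 1 ≤ i) (hin : i < n) : E u n i * T u n i = T u n i * E u n i := by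
  rw [T_eq_mk hi hin, E_eq_mk hi hin]
  simpa using mk_rel (Rel.ET (u := u) (n := n) ⟨i - 1, by omega⟩)

theorem E_mul_T_of_far (hi : 1 ≤ i) (hin : i < n) (hj : 1 ≤ j) (hjn : j < n) (h : Far i j) :
    E u n i * T u n j = T u n j * E u n i := by
  rw [E_eq_mk hi hin, T_eq_mk hj hjn]
  simpa using mk_rel (Rel.ET_far (u := u) (n := n) _ _ (by simp [Far] at *; omega))

theorem E_mul_E_mul_T (hi : 1 ≤ i) (hin : i < n) (hj : 1 ≤ j) (hjn : j < n) (h : Near i j) :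
    E u n i * E u n j * T u n i = T u n i * E u n i * E u n j := by
  rw [T_eq_mk hi hin, E_eq_mk hi hin, E_eq_mk hj hjn]
  simpa using mk_rel (Rel.EET (u := u) (n := n) _ _ (by simp [Near] at *; omega))

theorem T_mul_E_mul_E (hi : 1 ≤ i) (hin : i < n) (hj : 1 ≤ j) (hjn : j < n) (h : Near i j) :
    T u n i * E u n i * E u n j = E u n j * T u n i * E u n j := by
  rw [T_eq_mk hi hin, E_eq_mk hi hin, E_eq_mk hj hjn]
  simpa using mk_rel (Rel.TEE (u := u) (n := n) _ _ (by simp [Near] at *; omega))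

theorem E_mul_T_mul_T (hi : 1 ≤ i) (hin : i < n) (hj : 1 ≤ j) (hjn : j < n) (h : Near i j) :
    E u n i * T u n j * T u n i = T u n j * T u n i * E u n j := by
  rw [T_eq_mk hi hin, T_eq_mk hj hjn, E_eq_mk hi hin, E_eq_mk hj hjn]
  simpa using mk_rel (Rel.ETT (u := u) (n := n) _ _ (by simp [Near] at *; omega))

/-- The inverse of `T_i` is `T_i + (u⁻¹ - 1) E_i (1 + T_i)`. -/
theorem isUnit_T (hu : u ≠ 0) (hi : 1 ≤ i) (hin : i < n) : IsUnit (T u n i) := by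
  have key : T u n i * T u n i
      + (u⁻¹ - 1) • (E u n i * T u n i + E u n i * (T u n i * T u n i)) = 1 := by
    rw [T_mul_self hi hin]
    simp only [mul_add, mul_one, mul_smul_comm, ← mul_assoc, E_mul_self hi hin]
    match_scalars <;> field_simp <;> ring
  refine isUnit_iff_exists.mpr ⟨T u n i + (u⁻¹ - 1) • (E u n i + E u n i * T u n i), ?_, ?_⟩
  · rw [← key, mul_add, mul_smul_comm, mul_add, ← E_mul_T hi hin,
      ← mul_assoc (T u n i) (E u n i), ← E_mul_T hi hin, mul_assoc (E u n i)]
  · rw [← key]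
    simp only [add_mul, smul_mul_assoc, mul_assoc]

end Relations

/-- A subspace which contains `1` and is stable under right multiplication by the generators is
the whole algebra. -/
theorem mem_of_mul_gen_mem {n : ℕ} (S : Submodule F (BT u n)) (h1 : 1 ∈ S)
    (hT : ∀ i, 1 ≤ i → i < n → ∀ y ∈ S, y * T u n i ∈ S)
    (hE : ∀ i, 1 ≤ i → i < n → ∀ y ∈ S, y * E u n i ∈ S) (x : BT u n) : x ∈ S := by
  obtain ⟨a, rfl⟩ : ∃ a, mk u n a = x := RingQuot.mkAlgHom_surjective F (Rel u n) x
  have key : ∀ y ∈ S, y * mk u n a ∈ S := by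
    induction a using FreeAlgebra.induction with
    | grade0 r =>
      intro y hy
      rw [AlgHom.commutes, ← Algebra.commutes, ← Algebra.smul_def]
      exact S.smul_mem r hy
    | grade1 g =>
      intro y hy
      cases g with
      | T i => exact mk_fT u n i ▸ hT (i + 1) (by omega) (by omega) y hy
      | E i => exact mk_fE u n i ▸ hE (i + 1) (by omega) (by omega) y hy
    | mul a b ha hb =>
      intro y hy
      rw [map_mul, ← mul_assoc]
      exact hb _ (ha _ hy)
    | add a b ha hb =>
      intro y hy
      rw [map_add, mul_add]
      exact S.add_mem (ha _ hy) (hb _ hy)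
  simpa using key 1 h1

/-- There are no generators on at most one strand, so the algebra consists of scalars. -/
theorem exists_eq_algebraMap {n : ℕ} (hn : n ≤ 1) (x : BT u n) :
    ∃ c : F, x = algebraMap F (BT u n) c := by
  have h := mem_of_mul_gen_mem (1 : Submodule F (BT u n)) (Submodule.one_le.mp le_rfl)
    (fun i _ _ => by omega) (fun i _ _ => by omega) x
  obtain ⟨c, hc⟩ := Submodule.mem_one.mp h
  exact ⟨c, hc.symm⟩

theorem incl_mk {n : ℕ} (a : FreeAlgebra F (Gen n)) :
    incl u n (mk u n a) = mk u (n + 1) (freeIncl F n a) := by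
  simp only [incl, mk]
  exact RingQuot.liftAlgHom_mkAlgHom_apply _ _ _ _

theorem incl_T {n i : ℕ} (hi : 1 ≤ i) (hin : i < n) : incl u n (T u n i) = T u (n + 1) i := by
  rw [T_eq_mk hi hin, T_eq_mk hi (by omega), incl_mk, freeIncl_fT]

theorem incl_E {n i : ℕ} (hi : 1 ≤ i) (hin : i < n) : incl u n (E u n i) = E u (n + 1) i := by
  rw [E_eq_mk hi hin, E_eq_mk hi (by omega), incl_mk, freeIncl_fE]

theorem commute_T_incl_incl {n : ℕ} (x : BT u n) :
    Commute (T u (n + 2) (n + 1)) (incl u (n + 1) (incl u n x)) := by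
  let S : Subalgebra F (BT u n) :=
    (Subalgebra.centralizer F {T u (n + 2) (n + 1)}).comap ((incl u (n + 1)).comp (incl u n))
  have hS : ∀ y, y ∈ S ↔ Commute (T u (n + 2) (n + 1)) (incl u (n + 1) (incl u n y)) := fun y => by
    simp [S, Subalgebra.mem_centralizer_iff, Commute, SemiconjBy]
  refine (hS x).1 (mem_of_mul_gen_mem S.toSubmodule S.one_mem (fun i h1 h2 y hy => ?_)
    (fun i h1 h2 y hy => ?_) x)
  · refine S.mul_mem hy ((hS _).2 ?_)
    rw [incl_T h1 h2, incl_T h1 (by omega)]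
    exact T_comm_of_far (by omega) (by omega) h1 (by omega) (by unfold Far; omega)
  · refine S.mul_mem hy ((hS _).2 ?_)
    rw [incl_E h1 h2, incl_E h1 (by omega)]
    exact (E_mul_T_of_far h1 (by omega) (by omega) (by omega) (by unfold Far; omega)).symm

theorem commute_E_incl_incl {n : ℕ} (x : BT u n) :
    Commute (E u (n + 2) (n + 1)) (incl u (n + 1) (incl u n x)) := by
  let S : Subalgebra F (BT u n) :=
    (Subalgebra.centralizer F {E u (n + 2) (n + 1)}).comap ((incl u (n + 1)).comp (incl u n))
  have hS : ∀ y, y ∈ S ↔ Commute (E u (n + 2) (n + 1)) (incl u (n + 1) (incl u n y)) := fun y => by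
    simp [S, Subalgebra.mem_centralizer_iff, Commute, SemiconjBy]
  refine (hS x).1 (mem_of_mul_gen_mem S.toSubmodule S.one_mem (fun i h1 h2 y hy => ?_)
    (fun i h1 h2 y hy => ?_) x)
  · refine S.mul_mem hy ((hS _).2 ?_)
    rw [incl_T h1 h2, incl_T h1 (by omega)]
    exact E_mul_T_of_far (by omega) (by omega) h1 (by omega) (by unfold Far; omega)
  · refine S.mul_mem hy ((hS _).2 ?_)
    rw [incl_E h1 h2, incl_E h1 (by omega)]
    exact E_comm (by omega) (by omega) h1 (by omega)

/-! ### Conjugation of the ties by the braid generators -/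

section Conjugation

variable {M : Type*} [Monoid M] {g x y c d : M}

/-- If conjugation by `g` takes `c`, `x` to `d`, `y`, then `c` and `x` commute when `d` and `y` do. -/
theorem commute_of_conj (hg : IsUnit g) (hx : x * g = g * y) (hc : c * g = g * d)
    (h : Commute d y) : Commute c x := by
  refine hg.mul_right_cancel ?_
  rw [mul_assoc, hx, ← mul_assoc, hc, mul_assoc, h.eq, ← mul_assoc, ← hx, mul_assoc, ← hc,
    ← mul_assoc]

theorem commute_of_conj' (hg : IsUnit g) (hx : g * x = y * g) (hc : Commute c g)
    (h : Commute c y) : Commute c x := by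
  refine hg.mul_left_cancel ?_
  rw [← mul_assoc, ← hc.eq, mul_assoc, hx, ← mul_assoc, h.eq, ← mul_assoc, hx, mul_assoc,
    mul_assoc, hc.eq]

end Conjugation

variable {n : ℕ}

theorem tieAux_succ_mul_T (hu : u ≠ 0) {i d : ℕ} (hi : 1 ≤ i) (hin : i < n) :
    tieAux u n i (d + 1) * T u n i = T u n i * tieAux u n (i + 1) d := by
  rw [tieAux, mul_assoc, Ring.inverse_mul_cancel _ (isUnit_T hu hi hin), mul_one]

theorem commute_T_tieAux_of_outside (hu : u ≠ 0) {k i d : ℕ} (hi : 1 ≤ i) (hd : i + d < n)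
    (hk : 1 ≤ k) (hkn : k < n) (h : k + 1 < i ∨ i + d + 1 < k) :
    Commute (T u n k) (tieAux u n i d) := by
  induction d generalizing i with
  | zero =>
    exact (E_mul_T_of_far hi (by omega) hk hkn (by unfold Far; omega)).symm
  | succ d ih =>
    exact commute_of_conj (isUnit_T hu hi (by omega)) (tieAux_succ_mul_T hu hi (by omega))
      (T_comm_of_far hk hkn hi (by omega) (by unfold Far; omega))
      (ih (by omega) (by omega) (by omega))

/-- `E_{i,j}` can also be built up at its right end. -/
theorem T_mul_tieAux_succ (hu : u ≠ 0) {i d c : ℕ} (hi : 1 ≤ i) (hd : i + d + 1 < n)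
    (hc : c = i + d + 1) :
    T u n c * tieAux u n i (d + 1) = tieAux u n i d * T u n c := by
  induction d generalizing i with
  | zero =>
    subst hc
    refine (isUnit_T hu hi (by omega)).mul_right_cancel ?_
    rw [mul_assoc, tieAux_succ_mul_T hu hi (by omega)]
    simp only [tieAux, add_zero, ← mul_assoc]
    exact (E_mul_T_mul_T hi (by omega) (by omega) (by omega) (Or.inl rfl)).symm
  | succ d ih =>
    have hcom : Commute (T u n c) (T u n i) :=
      T_comm_of_far (by omega) (by omega) hi (by omega) (by unfold Far; omega)
    refine (isUnit_T hu hi (by omega)).mul_right_cancel ?_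
    rw [mul_assoc, tieAux_succ_mul_T hu hi (by omega), ← mul_assoc, hcom.eq, mul_assoc,
      ih (by omega) (by omega) (by omega), ← mul_assoc, ← tieAux_succ_mul_T hu hi (by omega),
      mul_assoc, mul_assoc, hcom.eq]

theorem commute_T_sq_E {i j : ℕ} (hi : 1 ≤ i) (hin : i < n) (hj : 1 ≤ j) (hjn : j < n)
    (h : Near i j) : Commute (T u n i * T u n i) (E u n j) := by
  rw [T_mul_self hi hin]
  refine (Commute.one_left _).add_left (Commute.smul_left (Commute.add_left ?_ ?_) _)
  · exact E_comm hi hin hj hjn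
  · change E u n i * T u n i * E u n j = E u n j * (E u n i * T u n i)
    rw [← mul_assoc, ← E_comm hi hin hj hjn, E_mul_E_mul_T hi hin hj hjn h, E_mul_T hi hin]

theorem commute_T_sq_tieAux_left (hu : u ≠ 0) {i d : ℕ} (hi : 1 ≤ i) (hd : i + 1 + d < n) :
    Commute (T u n i * T u n i) (tieAux u n (i + 1) d) := by
  induction d with
  | zero => exact commute_T_sq_E hi (by omega) (by omega) (by omega) (Or.inl rfl)
  | succ d ih =>
    have hcom : Commute (T u n i) (T u n (i + 1 + d + 1)) :=
      T_comm_of_far hi (by omega) (by omega) (by omega) (by unfold Far; omega)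
    exact commute_of_conj' (isUnit_T hu (by omega) (by omega))
      (T_mul_tieAux_succ hu (by omega) (by omega) rfl) (hcom.mul_left hcom) (ih (by omega))

theorem commute_T_sq_tieAux_right (hu : u ≠ 0) {i d c : ℕ} (hi : 1 ≤ i) (hd : i + d + 1 < n)
    (hc : c = i + d + 1) : Commute (T u n c * T u n c) (tieAux u n i d) := by
  induction d generalizing i with
  | zero => exact commute_T_sq_E (by omega) (by omega) hi (by omega) (by unfold Near; omega)
  | succ d ih =>
    have hcom : Commute (T u n c) (T u n i) :=
      T_comm_of_far (by omega) (by omega) hi (by omega) (by unfold Far; omega)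
    exact commute_of_conj (isUnit_T hu hi (by omega)) (tieAux_succ_mul_T hu hi (by omega))
      (hcom.mul_left hcom) (ih (by omega) (by omega) (by omega))

theorem tieAux_mul_T_left (hu : u ≠ 0) {i d : ℕ} (hi : 1 ≤ i) (hd : i + 1 + d < n) :
    tieAux u n (i + 1) d * T u n i = T u n i * tieAux u n i (d + 1) := by
  refine (isUnit_T hu hi (by omega)).mul_right_cancel ?_
  rw [mul_assoc, mul_assoc, tieAux_succ_mul_T hu hi (by omega),
    ← (commute_T_sq_tieAux_left hu hi hd).eq, mul_assoc]

theorem tieAux_succ_mul_T_right (hu : u ≠ 0) {i d c : ℕ} (hi : 1 ≤ i) (hd : i + d + 1 < n)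
    (hc : c = i + d + 1) : tieAux u n i (d + 1) * T u n c = T u n c * tieAux u n i d := by
  refine (isUnit_T hu (by omega : 1 ≤ c) (by omega)).mul_left_cancel ?_
  rw [← mul_assoc, T_mul_tieAux_succ hu hi hd hc, ← mul_assoc,
    (commute_T_sq_tieAux_right hu hi hd hc).eq, mul_assoc]

theorem commute_T_tieAux_of_inside (hu : u ≠ 0) {k i d : ℕ} (hi : 1 ≤ i) (hd : i + d < n)
    (hk : i < k) (hkd : k < i + d) : Commute (T u n k) (tieAux u n i d) := by
  induction d generalizing i with
  | zero => omega
  | succ d ih =>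
    rcases eq_or_ne k (i + 1) with rfl | hne
    · obtain ⟨d, rfl⟩ : ∃ d', d = d' + 1 := ⟨d - 1, by omega⟩
      refine commute_of_conj (g := T u n i * T u n (i + 1)) (d := T u n i)
        (y := tieAux u n (i + 2) d)
        ((isUnit_T hu hi (by omega)).mul (isUnit_T hu (by omega) (by omega))) ?_ ?_
        (commute_T_tieAux_of_outside hu (by omega) (by omega) hi (by omega) (by omega))
      · rw [← mul_assoc, tieAux_succ_mul_T hu hi (by omega), mul_assoc,
          tieAux_succ_mul_T hu (by omega) (by omega), ← mul_assoc]
      · rw [← mul_assoc]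
        exact T_braid (by omega) (by omega) hi (by omega) (Or.inr rfl)
    · exact commute_of_conj (isUnit_T hu hi (by omega)) (tieAux_succ_mul_T hu hi (by omega))
        (T_comm_of_far (by omega) (by omega) hi (by omega) (by unfold Far; omega))
        (ih (by omega) (by omega) (by omega) (by omega))

/-- The tie `E_{a,b}` between two strands of `{1, …, n}` in any order; it is `1` if `a = b`. -/
def et (u : F) (n a b : ℕ) : BT u n := if a = b then 1 else tie u n (min a b) (max a b)

@[simp] theorem et_self (a : ℕ) : et u n a a = 1 := by simp [et]

theorem et_symm (a b : ℕ) : et u n a b = et u n b a := by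
  simp [et, eq_comm, min_comm, max_comm]

theorem et_of_lt {a b : ℕ} (h : a < b) : et u n a b = tie u n a b := by
  simp [et, h.ne, h.le]

theorem et_add (a d : ℕ) : et u n a (a + d + 1) = tieAux u n a d := by
  rw [et_of_lt (by omega), tie]; congr 1; omega

theorem et_succ (a : ℕ) : et u n a (a + 1) = E u n a := et_add a 0

theorem et_mul_T (hu : u ≠ 0) {k a b : ℕ} (hk : 1 ≤ k) (hkn : k < n) (ha : 1 ≤ a) (han : a ≤ n)
    (hb : 1 ≤ b) (hbn : b ≤ n) :
    et u n a b * T u n k =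
      T u n k * et u n (Equiv.swap k (k + 1) a) (Equiv.swap k (k + 1) b) := by
  wlog hab : a < b generalizing a b
  · rcases eq_or_ne a b with rfl | hne
    · simp
    · rw [et_symm, this hb hbn ha han (by omega), et_symm]
  obtain ⟨d, rfl⟩ : ∃ d, b = a + d + 1 := ⟨b - a - 1, by omega⟩
  have hne : ∀ x, x ≠ k → x ≠ k + 1 → Equiv.swap k (k + 1) x = x := fun x h1 h2 =>
    Equiv.swap_apply_of_ne_of_ne h1 h2
  rw [et_add]
  rcases lt_trichotomy (k + 1) a with h | h | h
  · rw [hne a (by omega) (by omega), hne _ (by omega) (by omega), et_add]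
    exact (commute_T_tieAux_of_outside hu ha (by omega) hk hkn (by omega)).symm.eq
  · rw [hne (a + d + 1) (by omega) (by omega), ← h, Equiv.swap_apply_right]
    rw [show k + 1 + d + 1 = k + (d + 1) + 1 by omega, et_add, tieAux_mul_T_left hu hk (by omega)]
  rcases eq_or_lt_of_le (by omega : a ≤ k) with rfl | h
  · rcases d with _ | d
    · rw [add_zero, Equiv.swap_apply_left, Equiv.swap_apply_right, et_symm, et_succ]
      exact E_mul_T hk hkn
    · rw [hne (a + (d + 1) + 1) (by omega) (by omega), Equiv.swap_apply_left,
        show a + (d + 1) + 1 = a + 1 + d + 1 by omega, et_add]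
      exact tieAux_succ_mul_T hu hk hkn
  rw [hne a (by omega) (by omega)]
  rcases lt_trichotomy (k + 1) (a + d + 1) with h' | h' | h'
  · rw [hne _ (by omega) (by omega), et_add]
    exact (commute_T_tieAux_of_inside hu ha (by omega) (by omega) (by omega)).symm.eq
  · obtain ⟨d, rfl⟩ : ∃ d', d = d' + 1 := ⟨d - 1, by omega⟩
    rw [← h', Equiv.swap_apply_right, show k = a + d + 1 by omega, et_add]
    exact tieAux_succ_mul_T_right hu ha (by omega) rfl
  rcases eq_or_lt_of_le (by omega : a + d + 1 ≤ k) with h' | h'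
  · rw [h', Equiv.swap_apply_left, show k + 1 = a + (d + 1) + 1 by omega, et_add]
    exact (T_mul_tieAux_succ hu ha (by omega) h'.symm).symm
  · rw [hne _ (by omega) (by omega), et_add]
    exact (commute_T_tieAux_of_outside hu ha (by omega) hk hkn (by omega)).symm.eq

/-! ### The ties commute, are idempotent, and compose along a common strand -/

theorem commute_E_tieAux (hu : u ≠ 0) {c a d : ℕ} (hc : 1 ≤ c) (hcn : c < n) (ha : 1 ≤ a)
    (hd : a + d < n) : Commute (E u n c) (tieAux u n a d) := by
  induction d using Nat.strong_induction_on generalizing a c with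
  | _ d ih =>
  rcases d with _ | d
  · exact E_comm hc hcn ha (by omega)
  have hua := isUnit_T (u := u) (n := n) hu ha (by omega)
  have hX := tieAux_succ_mul_T (u := u) (n := n) (d := d) hu ha (by omega)
  have ih' : ∀ {c a : ℕ}, 1 ≤ c → c < n → 1 ≤ a → a + d < n → Commute (E u n c) (tieAux u n a d) :=
    fun h1 h2 h3 h4 => ih d (by omega) h1 h2 h3 h4
  by_cases h1 : c = a
  · subst h1
    exact commute_of_conj hua hX (E_mul_T hc hcn) (ih' hc hcn (by omega) (by omega))
  by_cases h2 : c = a + 1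
  · subst h2
    rcases d with _ | d
    · exact commute_of_conj' (isUnit_T hu hc hcn) (T_mul_tieAux_succ hu ha (by omega) rfl)
        (E_mul_T hc hcn) (ih' hc hcn (by omega) (by omega))
    · refine commute_of_conj (g := T u n a * T u n (a + 1)) (d := E u n a)
        (y := tieAux u n (a + 2) d) (hua.mul (isUnit_T hu hc hcn)) ?_ ?_
        (ih d (by omega) ha (by omega) (by omega) (by omega))
      · rw [← mul_assoc, hX, mul_assoc, tieAux_succ_mul_T hu hc hcn, ← mul_assoc]
      · rw [← mul_assoc]
        exact E_mul_T_mul_T hc hcn ha (by omega) (Or.inr rfl)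
  by_cases h3 : c + 1 = a
  · exact commute_of_conj' (isUnit_T hu (by omega) (by omega))
      (T_mul_tieAux_succ hu ha (by omega) rfl)
      (E_mul_T_of_far hc hcn (by omega) (by omega) (by unfold Far; omega))
      (ih' hc hcn (by omega) (by omega))
  · exact commute_of_conj hua hX
      (E_mul_T_of_far hc hcn (by omega) (by omega) (by unfold Far; omega))
      (ih' hc hcn (by omega) (by omega))

theorem swap_mem {k a : ℕ} (hk : 1 ≤ k) (hkn : k < n) (ha : 1 ≤ a) (han : a ≤ n) :
    1 ≤ Equiv.swap k (k + 1) a ∧ Equiv.swap k (k + 1) a ≤ n := by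
  rw [Equiv.swap_apply_def]; split_ifs <;> omega

theorem commute_et_tieAux (hu : u ≠ 0) {a b c d : ℕ} (ha : 1 ≤ a) (han : a ≤ n) (hb : 1 ≤ b)
    (hbn : b ≤ n) (hc : 1 ≤ c) (hd : c + d < n) : Commute (et u n a b) (tieAux u n c d) := by
  induction d generalizing a b c with
  | zero =>
    wlog hab : a < b generalizing a b
    · rcases eq_or_ne a b with rfl | hne
      · simp
      · rw [et_symm]; exact this hb hbn ha han (by omega)
    obtain ⟨d, rfl⟩ : ∃ d, b = a + d + 1 := ⟨b - a - 1, by omega⟩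
    rw [et_add]
    exact (commute_E_tieAux hu hc (by omega) ha (by omega)).symm
  | succ d ih =>
    have h1 := swap_mem (n := n) hc (by omega) ha han
    have h2 := swap_mem (n := n) hc (by omega) hb hbn
    exact commute_of_conj (isUnit_T hu hc (by omega)) (tieAux_succ_mul_T hu hc (by omega))
      (et_mul_T hu hc (by omega) ha han hb hbn)
      (ih h1.1 h1.2 h2.1 h2.2 (by omega) (by omega))

theorem commute_et_et (hu : u ≠ 0) {a b c d : ℕ} (ha : 1 ≤ a) (han : a ≤ n) (hb : 1 ≤ b)
    (hbn : b ≤ n) (hc : 1 ≤ c) (hcn : c ≤ n) (hd : 1 ≤ d) (hdn : d ≤ n) :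
    Commute (et u n a b) (et u n c d) := by
  wlog hcd : c < d generalizing c d
  · rcases eq_or_ne c d with rfl | hne
    · simp
    · rw [et_symm c]; exact this hd hdn hc hcn (by omega)
  obtain ⟨e, rfl⟩ : ∃ e, d = c + e + 1 := ⟨d - c - 1, by omega⟩
  rw [et_add]
  exact commute_et_tieAux hu ha han hb hbn hc (by omega)

theorem tieAux_mul_self (hu : u ≠ 0) {a d : ℕ} (ha : 1 ≤ a) (hd : a + d < n) :
    tieAux u n a d * tieAux u n a d = tieAux u n a d := by
  induction d generalizing a with
  | zero => exact E_mul_self ha (by omega)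
  | succ d ih =>
    have hX := tieAux_succ_mul_T (u := u) (n := n) (d := d) hu ha (by omega)
    refine (isUnit_T hu ha (by omega)).mul_right_cancel ?_
    rw [mul_assoc, hX, ← mul_assoc, hX, mul_assoc, ih (by omega) (by omega)]

theorem et_mul_self (hu : u ≠ 0) {a b : ℕ} (ha : 1 ≤ a) (han : a ≤ n) (hb : 1 ≤ b)
    (hbn : b ≤ n) : et u n a b * et u n a b = et u n a b := by
  wlog hab : a < b generalizing a b
  · rcases eq_or_ne a b with rfl | hne
    · simp
    · rw [et_symm]; exact this hb hbn ha han (by omega)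
  obtain ⟨d, rfl⟩ : ∃ d, b = a + d + 1 := ⟨b - a - 1, by omega⟩
  rw [et_add]
  exact tieAux_mul_self hu ha (by omega)

/-- For `a < b < c` the products of any two of the three ties coincide: this is checked on three
consecutive strands and transported by conjugation. -/
theorem et_triple_of_lt (hu : u ≠ 0) {a b c : ℕ} (ha : 1 ≤ a) (hab : a < b) (hbc : b < c)
    (hcn : c ≤ n) :
    et u n a b * et u n b c = et u n a b * et u n a c ∧
      et u n a b * et u n b c = et u n a c * et u n b c := by
  induction hm : c - a using Nat.strong_induction_on generalizing a b c with
  | _ m ih =>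
  have conj : ∀ k a' b' c', 1 ≤ k → k < n → Equiv.swap k (k + 1) a = a' →
      Equiv.swap k (k + 1) b = b' → Equiv.swap k (k + 1) c = c' →
      (et u n a' b' * et u n b' c' = et u n a' b' * et u n a' c' ∧
        et u n a' b' * et u n b' c' = et u n a' c' * et u n b' c') →
      (et u n a b * et u n b c = et u n a b * et u n a c ∧
        et u n a b * et u n b c = et u n a c * et u n b c) := by
    rintro k _ _ _ hk hkn rfl rfl rfl ⟨h1, h2⟩
    have hT := isUnit_T (u := u) hu hk hkn
    have e1 := et_mul_T (u := u) hu hk hkn (by omega : 1 ≤ a) (by omega) (by omega : 1 ≤ b)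
      (by omega)
    have e2 := et_mul_T (u := u) hu hk hkn (by omega : 1 ≤ b) (by omega) (by omega : 1 ≤ c)
      (by omega)
    have e3 := et_mul_T (u := u) hu hk hkn (by omega : 1 ≤ a) (by omega) (by omega : 1 ≤ c)
      (by omega)
    constructor <;> refine hT.mul_right_cancel ?_
    · rw [mul_assoc, e2, ← mul_assoc, e1, mul_assoc, h1, ← mul_assoc, ← e1, mul_assoc, ← e3,
        ← mul_assoc]
    · rw [mul_assoc, e2, ← mul_assoc, e1, mul_assoc, h2, ← mul_assoc, ← e3, mul_assoc, ← e2,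
        ← mul_assoc]
  by_cases h1 : b + 1 < c
  · obtain ⟨c, rfl⟩ : ∃ c', c = c' + 1 := ⟨c - 1, by omega⟩
    exact conj c a b c (by omega) (by omega)
      (Equiv.swap_apply_of_ne_of_ne (by omega) (by omega))
      (Equiv.swap_apply_of_ne_of_ne (by omega) (by omega)) (Equiv.swap_apply_right _ _)
      (ih (c - a) (by omega) ha hab (by omega) (by omega) rfl)
  by_cases h2 : a + 1 < b
  · exact conj a (a + 1) b c (by omega) (by omega) (Equiv.swap_apply_left _ _)
      (Equiv.swap_apply_of_ne_of_ne (by omega) (by omega))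
      (Equiv.swap_apply_of_ne_of_ne (by omega) (by omega))
      (ih (c - (a + 1)) (by omega) (by omega) h2 hbc hcn rfl)
  obtain rfl : b = a + 1 := by omega
  obtain rfl : c = a + 1 + 1 := by omega
  have hT := isUnit_T (u := u) (n := n) (i := a) hu ha (by omega)
  have hT' := isUnit_T (u := u) (n := n) (i := a + 1) hu (by omega) (by omega)
  have hX := tieAux_succ_mul_T (u := u) (n := n) (d := 0) hu ha (by omega)
  have hX' := T_mul_tieAux_succ (u := u) (n := n) (i := a) (d := 0) hu ha (by omega) rfl
  simp only [tieAux, add_zero] at hX hX'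
  rw [et_succ, et_succ, et_add a 1]
  simp only [tieAux]
  constructor
  · refine hT.mul_right_cancel ?_
    rw [mul_assoc (E u n a) _ (T u n a), mul_assoc (E u n a) _ (T u n a), hX, ← mul_assoc,
      ← mul_assoc, E_mul_E_mul_T ha (by omega) (by omega) (by omega) (Or.inl rfl),
      E_mul_T ha (by omega)]
  · refine hT'.mul_left_cancel ?_
    rw [← mul_assoc _ _ (E u n (a + 1)), ← mul_assoc _ _ (E u n (a + 1)), hX',
      mul_assoc (E u n a), ← E_mul_T (by omega) (by omega), ← mul_assoc,
      E_comm ha (by omega) (by omega) (by omega),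
      E_mul_E_mul_T (by omega) (by omega) ha (by omega) (Or.inr rfl), mul_assoc,
      E_comm ha (by omega) (by omega) (by omega), ← mul_assoc]

theorem et_mul_et_mul_et (hu : u ≠ 0) {a b c : ℕ} (ha : 1 ≤ a) (han : a ≤ n) (hb : 1 ≤ b)
    (hbn : b ≤ n) (hc : 1 ≤ c) (hcn : c ≤ n) :
    et u n a b * et u n b c * et u n a c = et u n a b * et u n b c := by
  rcases eq_or_ne a b with rfl | h1
  · simp [et_mul_self hu ha han hc hcn]
  rcases eq_or_ne b c with rfl | h2
  · simp [et_mul_self hu ha han hb hbn]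
  rcases eq_or_ne a c with rfl | h3
  · simp
  have sq : ∀ {x y}, 1 ≤ x → x ≤ n → 1 ≤ y → y ≤ n → et u n x y * et u n x y = et u n x y :=
    fun h1 h2 h3 h4 => et_mul_self hu h1 h2 h3 h4
  have key : ∀ {x y z}, 1 ≤ x → x < y → y < z → z ≤ n →
      (et u n x y * et u n y z = et u n x y * et u n x z ∧
      et u n x y * et u n y z = et u n x z * et u n y z) ∧
      et u n x y * et u n y z * et u n x z = et u n x y * et u n y z ∧
      et u n x y * et u n y z = et u n y z * et u n x y ∧
      et u n x y * et u n x z = et u n x z * et u n x y ∧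
      et u n x z * et u n y z = et u n y z * et u n x z ∧
      et u n x y * et u n y z * et u n y z = et u n x y * et u n y z ∧
      et u n x y * et u n y z * et u n x y = et u n x y * et u n y z := by
    intro x y z hx hxy hyz hz
    have c1 : Commute (et u n x y) (et u n y z) := commute_et_et hu (by omega) (by omega)
      (by omega) (by omega) (by omega) (by omega) (by omega) (by omega)
    have c2 : Commute (et u n x y) (et u n x z) := commute_et_et hu (by omega) (by omega)
      (by omega) (by omega) (by omega) (by omega) (by omega) (by omega)
    have c3 : Commute (et u n x z) (et u n y z) := commute_et_et hu (by omega) (by omega)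
      (by omega) (by omega) (by omega) (by omega) (by omega) (by omega)
    have h := et_triple_of_lt (u := u) hu hx hxy hyz hz
    refine ⟨h, ?_, c1.eq, c2.eq, c3.eq, ?_, ?_⟩
    · rw [h.1, mul_assoc, sq (by omega) (by omega) (by omega) (by omega)]
    · rw [mul_assoc, sq (by omega) (by omega) (by omega) (by omega)]
    · rw [c1.eq, mul_assoc, sq (by omega) (by omega) (by omega) (by omega)]
  rcases lt_or_gt_of_ne h1 with h1 | h1 <;> rcases lt_or_gt_of_ne h2 with h2 | h2 <;>
    rcases lt_or_gt_of_ne h3 with h3 | h3 <;> try omega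
  · exact (key ha h1 h2 hcn).2.1
  · -- `a < c < b`
    obtain ⟨⟨k1, k2⟩, k3, k4, k5, k6, k7, k8⟩ := key ha h3 h2 hbn
    rw [et_symm b c, ← k2, k8]
  · -- `c < a < b`
    obtain ⟨⟨k1, k2⟩, k3, k4, k5, k6, k7, k8⟩ := key hc h3 h1 hbn
    rw [et_symm b c, et_symm a c, ← k6, ← k2, k8]
  · -- `b < a < c`
    obtain ⟨⟨k1, k2⟩, k3, k4, k5, k6, k7, k8⟩ := key hb h1 h3 hcn
    rw [et_symm a b, ← k1, k7]
  · -- `b < c < a`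
    obtain ⟨⟨k1, k2⟩, k3, k4, k5, k6, k7, k8⟩ := key hb h2 h3 han
    rw [et_symm a b, et_symm a c, ← k5, ← k1, k7]
  · -- `c < b < a`
    obtain ⟨⟨k1, k2⟩, k3, k4, k5, k6, k7, k8⟩ := key hc h2 h1 han
    rw [et_symm a b, et_symm a c, et_symm b c, ← k4, k3]

/-! ### Products of ties and set partitions -/

theorem commute_et_fin (hu : u ≠ 0) (a b c d : Fin n) :
    Commute (et u n (a + 1) (b + 1)) (et u n (c + 1) (d + 1)) :=
  commute_et_et hu (by omega) (by omega) (by omega) (by omega) (by omega) (by omega) (by omega)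
    (by omega)

theorem exists_tiePart_eq_prod (I : Setoid (Fin n)) :
    ∃ l : List (Fin n × Fin n), (∀ p, p ∈ l ↔ p.1 < p.2 ∧ I p.1 p.2) ∧
      tiePart u n I = (l.map fun p => et u n (p.1 + 1) (p.2 + 1)).prod := by
  classical
  refine ⟨(List.finRange n ×ˢ List.finRange n).filter fun p => p.1 < p.2 ∧ I p.1 p.2, ?_, ?_⟩
  · simp
  · rw [tiePart]
    congr 1
    refine List.map_congr_left fun p hp => ?_
    have hp := (List.mem_filter.1 hp).2
    simp only [decide_eq_true_eq] at hp
    rw [et_of_lt (by have := hp.1; rw [Fin.lt_def] at this; omega)]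

theorem tiePart_mul_et (hu : u ≠ 0) {I : Setoid (Fin n)} {a b : Fin n} (h : I a b) :
    tiePart u n I * et u n (a + 1) (b + 1) = tiePart u n I := by
  wlog hab : a < b generalizing a b
  · rcases eq_or_ne a b with rfl | hne
    · simp
    · rw [et_symm]; exact this (I.symm h) (by omega)
  obtain ⟨l, hl, hI⟩ := exists_tiePart_eq_prod (u := u) I
  have hmem : (a, b) ∈ l := (hl (a, b)).2 ⟨hab, h⟩
  rw [hI]
  clear hI hl
  induction l with
  | nil => simp at hmem
  | cons p l ih =>
    rw [List.map_cons, List.prod_cons, mul_assoc]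
    rcases List.mem_cons.1 hmem with rfl | hmem
    · have hc : Commute (et u n (a + 1) (b + 1))
          (l.map fun p => et u n (p.1 + 1) (p.2 + 1)).prod := by
        refine Commute.list_prod_right _ _ fun x hx => ?_
        obtain ⟨q, -, rfl⟩ := List.mem_map.1 hx
        exact commute_et_fin hu _ _ _ _
      rw [← hc.eq, ← mul_assoc, et_mul_self hu (by omega) (by omega) (by omega) (by omega)]
    · rw [ih hmem]

theorem mul_tiePart_eq_self {I : Setoid (Fin n)} {x : BT u n}
    (h : ∀ a b : Fin n, I a b → x * et u n (a + 1) (b + 1) = x) : x * tiePart u n I = x := by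
  obtain ⟨l, hl, hI⟩ := exists_tiePart_eq_prod (u := u) I
  have h' : ∀ p ∈ l, x * et u n (p.1 + 1) (p.2 + 1) = x := fun p hp => h _ _ ((hl p).1 hp).2
  rw [hI]
  clear hI hl
  induction l with
  | nil => simp
  | cons p l ih =>
    rw [List.map_cons, List.prod_cons, ← mul_assoc, h' p (by simp),
      ih fun q hq => h' q (List.mem_cons_of_mem _ hq)]

theorem commute_tiePart {I : Setoid (Fin n)} {x : BT u n}
    (h : ∀ a b : Fin n, Commute x (et u n (a + 1) (b + 1))) : Commute x (tiePart u n I) := by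
  obtain ⟨l, hl, hI⟩ := exists_tiePart_eq_prod (u := u) I
  rw [hI]
  refine Commute.list_prod_right _ _ fun y hy => ?_
  obtain ⟨q, -, rfl⟩ := List.mem_map.1 hy
  exact h _ _

theorem commute_et_tiePart (hu : u ≠ 0) {a b : ℕ} (ha : 1 ≤ a) (han : a ≤ n) (hb : 1 ≤ b)
    (hbn : b ≤ n) (I : Setoid (Fin n)) : Commute (et u n a b) (tiePart u n I) :=
  commute_tiePart fun _ _ =>
    commute_et_et hu ha han hb hbn (by omega) (by omega) (by omega) (by omega)

theorem commute_tiePart_tiePart (hu : u ≠ 0) (I J : Setoid (Fin n)) :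
    Commute (tiePart u n I) (tiePart u n J) :=
  commute_tiePart fun a b =>
    (commute_et_tiePart hu (by omega) (by omega) (by omega) (by omega) I).symm

/-- The partition of the strands for which `a` and `b` are together if and only if `x` absorbs the
tie between them on the right. -/
def absorbed (hu : u ≠ 0) (x : BT u n) : Setoid (Fin n) where
  r a b := x * et u n (a + 1) (b + 1) = x
  iseqv :=
    { refl := fun a => by simp
      symm := fun {a b} h => by rwa [et_symm]
      trans := fun {a b c} h1 h2 => by
        have h := et_mul_et_mul_et (u := u) (n := n) hu (a := a + 1) (b := b + 1) (c := c + 1)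
          (by omega) (by omega) (by omega) (by omega) (by omega) (by omega)
        have h' : x * (et u n (a + 1) (b + 1) * et u n (b + 1) (c + 1)) = x := by
          rw [← mul_assoc, h1, h2]
        rw [← h', mul_assoc, h] }

theorem absorbed_iff (hu : u ≠ 0) {x : BT u n} {a b : Fin n} :
    absorbed hu x a b ↔ x * et u n (a + 1) (b + 1) = x := Iff.rfl

theorem mul_tiePart_of_le_absorbed (hu : u ≠ 0) {x : BT u n} {I : Setoid (Fin n)}
    (h : I ≤ absorbed hu x) : x * tiePart u n I = x :=
  mul_tiePart_eq_self fun _ _ hab => h hab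

theorem le_absorbed_tiePart_mul (hu : u ≠ 0) (I : Setoid (Fin n)) {x : BT u n}
    (hx : ∀ a b : Fin n, Commute x (et u n (a + 1) (b + 1))) :
    I ≤ absorbed hu (tiePart u n I * x) := fun a b h => by
  change tiePart u n I * x * _ = _
  rw [mul_assoc, (hx a b).eq, ← mul_assoc, tiePart_mul_et hu h]

theorem merge_le {α : Type*} {I J : Setoid α} {a b : α} (h : I ≤ J) (hab : J a b) :
    merge I a b ≤ J :=
  sup_le h (Setoid.eqvGen_le fun _ _ ⟨h1, h2⟩ => h1 ▸ h2 ▸ hab)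

theorem le_merge {α : Type*} (I : Setoid α) (a b : α) : I ≤ merge I a b := le_sup_left

theorem merge_rel {α : Type*} (I : Setoid α) (a b : α) : merge I a b a b :=
  (le_sup_right : _ ≤ merge I a b) (Relation.EqvGen.rel _ _ ⟨rfl, rfl⟩)

theorem tiePart_mul_et_eq (hu : u ≠ 0) (I : Setoid (Fin n)) (a b : Fin n) :
    tiePart u n I * et u n (a + 1) (b + 1) = tiePart u n (merge I a b) := by
  have h1 : tiePart u n I * et u n (a + 1) (b + 1) * tiePart u n (merge I a b) =
      tiePart u n I * et u n (a + 1) (b + 1) :=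
    mul_tiePart_of_le_absorbed hu (merge_le
      (le_absorbed_tiePart_mul hu I fun c d => commute_et_fin hu _ _ _ _) (by
        rw [absorbed_iff, mul_assoc,
          et_mul_self hu (by omega) (by omega) (by omega) (by omega)]))
  have h2 : tiePart u n (merge I a b) * tiePart u n I = tiePart u n (merge I a b) :=
    mul_tiePart_eq_self fun c d h => tiePart_mul_et hu (le_merge I a b h)
  rw [← h1, mul_assoc,
    (commute_et_tiePart hu (by omega) (by omega) (by omega) (by omega) _).eq,
    tiePart_mul_et hu (merge_rel I a b), (commute_tiePart_tiePart hu _ _).eq, h2]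

theorem tiePart_mul_tiePart (hu : u ≠ 0) (I J : Setoid (Fin n)) :
    ∃ K, tiePart u n I * tiePart u n J = tiePart u n K := by
  obtain ⟨l, -, hJ⟩ := exists_tiePart_eq_prod (u := u) J
  rw [hJ]
  clear hJ
  induction l generalizing I with
  | nil => exact ⟨I, by simp⟩
  | cons p l ih =>
    rw [List.map_cons, List.prod_cons, ← mul_assoc, tiePart_mul_et_eq hu]
    exact ih _

theorem tiePart_bot : tiePart u n ⊥ = 1 := by
  have h := mul_tiePart_eq_self (u := u) (n := n) (I := ⊥) (x := 1) fun a b h => by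
    have h : a = b := h
    simp [h]
  rwa [one_mul] at h

/-- A conjugation of the ties which permutes the strands permutes the products of ties. -/
theorem exists_tiePart_mul_eq (hu : u ≠ 0) {x : BT u n} {f : ℕ → ℕ}
    (hf : ∀ a, 1 ≤ a → a ≤ n → 1 ≤ f a ∧ f a ≤ n)
    (hx : ∀ a b, 1 ≤ a → a ≤ n → 1 ≤ b → b ≤ n → et u n a b * x = x * et u n (f a) (f b))
    (I : Setoid (Fin n)) : ∃ J, tiePart u n I * x = x * tiePart u n J := by
  obtain ⟨l, -, hI⟩ := exists_tiePart_eq_prod (u := u) I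
  rw [hI]
  clear hI
  induction l with
  | nil => exact ⟨⊥, by simp [tiePart_bot]⟩
  | cons p l ih =>
    obtain ⟨J, hJ⟩ := ih
    have h1 := hf (p.1 + 1) (by omega) (by omega)
    have h2 := hf (p.2 + 1) (by omega) (by omega)
    refine ⟨merge J ⟨f (p.1 + 1) - 1, by omega⟩ ⟨f (p.2 + 1) - 1, by omega⟩, ?_⟩
    rw [List.map_cons, List.prod_cons, mul_assoc, hJ, ← mul_assoc,
      hx _ _ (by omega) (by omega) (by omega) (by omega), mul_assoc, ← tiePart_mul_et_eq hu,
      (commute_et_tiePart hu h1.1 h1.2 h2.1 h2.2 J).eq]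
    simp only [Nat.sub_add_cancel h1.1, Nat.sub_add_cancel h2.1]

theorem exists_tiePart_mul_T (hu : u ≠ 0) {i : ℕ} (hi : 1 ≤ i) (hin : i < n)
    (I : Setoid (Fin n)) : ∃ J, tiePart u n I * T u n i = T u n i * tiePart u n J :=
  exists_tiePart_mul_eq hu (fun _ => swap_mem hi hin)
    (fun _ _ ha han hb hbn => et_mul_T hu hi hin ha han hb hbn) I

theorem exists_tiePart_mul_et (hu : u ≠ 0) {a b : ℕ} (ha : 1 ≤ a) (han : a ≤ n) (hb : 1 ≤ b)
    (hbn : b ≤ n) (I : Setoid (Fin n)) :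
    ∃ J, tiePart u n I * et u n a b = tiePart u n J := by
  have h := tiePart_mul_et_eq (u := u) hu I ⟨a - 1, by omega⟩ ⟨b - 1, by omega⟩
  simp only [Nat.sub_add_cancel ha, Nat.sub_add_cancel hb] at h
  exact ⟨_, h⟩

/-! ### Ties in the tower of algebras -/

theorem incl_tieAux (hu : u ≠ 0) {i d : ℕ} (hi : 1 ≤ i) (hd : i + d < n) :
    incl u n (tieAux u n i d) = tieAux u (n + 1) i d := by
  induction d generalizing i with
  | zero => exact incl_E hi (by omega)
  | succ d ih =>
    refine (isUnit_T (n := n + 1) hu hi (by omega)).mul_right_cancel ?_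
    rw [tieAux_succ_mul_T hu hi (by omega), ← incl_T hi (by omega), ← map_mul,
      tieAux_succ_mul_T hu hi (by omega), map_mul, ih (by omega) (by omega)]

theorem incl_et (hu : u ≠ 0) {a b : ℕ} (ha : 1 ≤ a) (han : a ≤ n) (hb : 1 ≤ b) (hbn : b ≤ n) :
    incl u n (et u n a b) = et u (n + 1) a b := by
  wlog hab : a < b generalizing a b
  · rcases eq_or_ne a b with rfl | hne
    · simp
    · rw [et_symm, this hb hbn ha han (by omega), et_symm]
  obtain ⟨d, rfl⟩ : ∃ d, b = a + d + 1 := ⟨b - a - 1, by omega⟩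
  rw [et_add, et_add, incl_tieAux hu ha (by omega)]

theorem commute_et_incl_tiePart (hu : u ≠ 0) {a b : ℕ} (ha : 1 ≤ a) (han : a ≤ n + 1)
    (hb : 1 ≤ b) (hbn : b ≤ n + 1) (I : Setoid (Fin n)) :
    Commute (et u (n + 1) a b) (incl u n (tiePart u n I)) := by
  obtain ⟨l, -, hI⟩ := exists_tiePart_eq_prod (u := u) I
  rw [hI, map_list_prod]
  refine Commute.list_prod_right _ _ fun y hy => ?_
  simp only [List.map_map, List.mem_map] at hy
  obtain ⟨q, -, rfl⟩ := hy
  rw [Function.comp_apply, incl_et hu (by omega) (by omega) (by omega) (by omega)]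
  exact commute_et_et hu ha han hb hbn (by omega) (by omega) (by omega) (by omega)

theorem incl_tiePart_mul_et (hu : u ≠ 0) {I : Setoid (Fin n)} {a b : Fin n} (h : I a b) :
    incl u n (tiePart u n I) * et u (n + 1) (a + 1) (b + 1) = incl u n (tiePart u n I) := by
  rw [← incl_et hu (by omega) (by omega) (by omega) (by omega), ← map_mul, tiePart_mul_et hu h]

theorem eq_tiePart {I : Setoid (Fin n)} {x : BT u n}
    (hc : ∀ a b : Fin n, Commute x (et u n (a + 1) (b + 1)))
    (h1 : ∀ a b : Fin n, I a b → x * et u n (a + 1) (b + 1) = x)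
    (h2 : tiePart u n I * x = tiePart u n I) : x = tiePart u n I := by
  rw [← h2, ← (commute_tiePart hc).eq, mul_tiePart_eq_self h1]

theorem tiePart_mul_incl (hu : u ≠ 0) (I : Setoid (Fin (n + 1))) :
    tiePart u (n + 1) I * incl u n (tiePart u n (removeLast I)) = tiePart u (n + 1) I := by
  obtain ⟨l, hl, hI⟩ := exists_tiePart_eq_prod (u := u) (removeLast I)
  have h' : ∀ p ∈ l, I p.1.castSucc p.2.castSucc := fun p hp => ((hl p).1 hp).2
  rw [hI, map_list_prod]
  clear hI hl
  induction l with
  | nil => simp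
  | cons p l ih =>
    have hp := tiePart_mul_et (u := u) hu (h' p (by simp))
    rw [List.map_cons, List.map_cons, List.prod_cons, ← mul_assoc,
      incl_et hu (by omega) (by omega) (by omega) (by omega)]
    simp only [Fin.val_castSucc] at hp
    rw [hp, ih fun q hq => h' q (List.mem_cons_of_mem _ hq)]

theorem tiePart_eq_of_not_inSupp (hu : u ≠ 0) {I : Setoid (Fin (n + 1))}
    (h : ¬ InSupp I (Fin.last n)) :
    tiePart u (n + 1) I = incl u n (tiePart u n (removeLast I)) := by
  refine (eq_tiePart (fun a b => ?_) (fun a b hab => ?_) (tiePart_mul_incl hu I)).symm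
  · exact (commute_et_incl_tiePart hu (by omega) (by omega) (by omega) (by omega) _).symm
  · have hlast : ∀ c, I (Fin.last n) c → c = Fin.last n := fun c hc => by
      by_contra hne
      exact h ⟨c, hne, hc⟩
    induction a using Fin.lastCases with
    | last => rw [hlast b hab]; simp
    | cast a =>
      induction b using Fin.lastCases with
      | last => rw [hlast _ (I.symm hab)]; simp
      | cast b => exact incl_tiePart_mul_et hu (I := removeLast I) hab

theorem tiePart_eq_of_rel (hu : u ≠ 0) {I : Setoid (Fin (n + 1))} {j : Fin n}
    (h : I j.castSucc (Fin.last n)) :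
    tiePart u (n + 1) I =
      incl u n (tiePart u n (removeLast I)) * et u (n + 1) (j + 1) (n + 1) := by
  have hc : ∀ a b : Fin (n + 1), Commute (et u (n + 1) (j + 1) (n + 1))
      (et u (n + 1) (a + 1) (b + 1)) := fun a b =>
    commute_et_fin hu j.castSucc (Fin.last n) a b
  have hc' : ∀ a b : Fin (n + 1), Commute (incl u n (tiePart u n (removeLast I)) *
      et u (n + 1) (j + 1) (n + 1)) (et u (n + 1) (a + 1) (b + 1)) := fun a b =>
    (commute_et_incl_tiePart hu (by omega) (by omega) (by omega) (by omega) _).symm.mul_left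
      (hc a b)
  have hcast : ∀ a b : Fin n, I a.castSucc b.castSucc →
      incl u n (tiePart u n (removeLast I)) * et u (n + 1) (j + 1) (n + 1) *
        et u (n + 1) (a + 1) (b + 1) =
      incl u n (tiePart u n (removeLast I)) * et u (n + 1) (j + 1) (n + 1) := fun a b hab => by
    have h := (hc a.castSucc b.castSucc).eq
    simp only [Fin.val_castSucc] at h
    rw [mul_assoc, h, ← mul_assoc]
    congr 1
    exact incl_tiePart_mul_et hu (I := removeLast I) hab
  have hlast : ∀ a : Fin n, I a.castSucc (Fin.last n) →
      incl u n (tiePart u n (removeLast I)) * et u (n + 1) (j + 1) (n + 1) *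
        et u (n + 1) (a + 1) (n + 1) =
      incl u n (tiePart u n (removeLast I)) * et u (n + 1) (j + 1) (n + 1) := fun a ha => by
    have h3 := et_mul_et_mul_et (u := u) (n := n + 1) hu (a := a + 1) (b := j + 1) (c := n + 1)
      (by omega) (by omega) (by omega) (by omega) (by omega) (by omega)
    have h4 := hcast a j (I.trans ha (I.symm h))
    have h5 := (hc a.castSucc j.castSucc).eq
    simp only [Fin.val_castSucc] at h5
    rw [mul_assoc, h5] at h4
    rw [← h4, mul_assoc, h3]
  refine (eq_tiePart hc' (fun a b hab => ?_) ?_).symm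
  · induction a using Fin.lastCases with
    | last =>
      induction b using Fin.lastCases with
      | last => simp
      | cast b =>
        rw [et_symm (((Fin.last n : Fin (n + 1)) : ℕ) + 1)]
        exact hlast b (I.symm hab)
    | cast a =>
      induction b using Fin.lastCases with
      | last => exact hlast a hab
      | cast b => exact hcast a b hab
  · rw [← mul_assoc, tiePart_mul_incl hu]
    exact tiePart_mul_et hu h

/-- A set partition of `n` strands, to which the last of `n + 1` strands is added as a block. -/
def addSingleton (J : Setoid (Fin n)) : Setoid (Fin (n + 1)) where
  r a b := a = b ∨ ∃ c d, a = Fin.castSucc c ∧ b = Fin.castSucc d ∧ J c d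
  iseqv :=
    { refl := fun _ => Or.inl rfl
      symm := by
        rintro a b (rfl | ⟨c, d, rfl, rfl, h⟩)
        · exact Or.inl rfl
        · exact Or.inr ⟨d, c, rfl, rfl, J.symm h⟩
      trans := by
        rintro a b e (rfl | ⟨c, d, rfl, rfl, h⟩) h2
        · exact h2
        · rcases h2 with rfl | ⟨c', d', hc, rfl, h'⟩
          · exact Or.inr ⟨c, d, rfl, rfl, h⟩
          · obtain rfl := Fin.castSucc_injective _ hc
            exact Or.inr ⟨c, d', rfl, rfl, J.trans h h'⟩ }

theorem removeLast_addSingleton (J : Setoid (Fin n)) : removeLast (addSingleton J) = J := by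
  ext a b
  constructor
  · rintro (h | ⟨c, d, hc, hd, h⟩)
    · rw [Fin.castSucc_injective _ h]
    · rwa [Fin.castSucc_injective _ hc, Fin.castSucc_injective _ hd]
  · exact fun h => Or.inr ⟨a, b, rfl, rfl, h⟩

theorem not_inSupp_addSingleton (J : Setoid (Fin n)) :
    ¬ InSupp (addSingleton J) (Fin.last n) := by
  rintro ⟨b, hb, h | ⟨c, d, hc, -, -⟩⟩
  · exact hb h.symm
  · exact (Fin.castSucc_lt_last c).ne hc.symm

/-- A set partition of `n` strands, to which the last of `n + 1` strands is added in the block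
of `j`. -/
def addToBlock (J : Setoid (Fin n)) (j : Fin n) : Setoid (Fin (n + 1)) :=
  J.comap (Fin.lastCases j id)

theorem addToBlock_castSucc {J : Setoid (Fin n)} {j a b : Fin n} :
    addToBlock J j a.castSucc b.castSucc ↔ J a b := by
  change J (Fin.lastCases j id a.castSucc) (Fin.lastCases j id b.castSucc) ↔ _
  simp

theorem addToBlock_castSucc_last {J : Setoid (Fin n)} {j a : Fin n} :
    addToBlock J j a.castSucc (Fin.last n) ↔ J a j := by
  change J (Fin.lastCases j id a.castSucc) (Fin.lastCases j id (Fin.last n)) ↔ _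
  simp

theorem removeLast_addToBlock (J : Setoid (Fin n)) (j : Fin n) :
    removeLast (addToBlock J j) = J :=
  Setoid.ext fun _ _ => addToBlock_castSucc

theorem addToBlock_rel (J : Setoid (Fin n)) (j : Fin n) :
    addToBlock J j j.castSucc (Fin.last n) :=
  addToBlock_castSucc_last.2 (J.refl j)

theorem inSupp_addToBlock (J : Setoid (Fin n)) (j : Fin n) :
    InSupp (addToBlock J j) (Fin.last n) :=
  ⟨j.castSucc, (Fin.castSucc_lt_last j).ne, Setoid.symm' _ (addToBlock_rel J j)⟩

theorem tiePart_addSingleton (hu : u ≠ 0) (J : Setoid (Fin n)) :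
    tiePart u (n + 1) (addSingleton J) = incl u n (tiePart u n J) := by
  rw [tiePart_eq_of_not_inSupp hu (not_inSupp_addSingleton J), removeLast_addSingleton]

theorem tiePart_addToBlock (hu : u ≠ 0) (J : Setoid (Fin n)) (j : Fin n) :
    tiePart u (n + 1) (addToBlock J j) =
      incl u n (tiePart u n J) * et u (n + 1) (j + 1) (n + 1) := by
  rw [tiePart_eq_of_rel hu (addToBlock_rel J j), removeLast_addToBlock]

theorem exists_tiePart_eq (hu : u ≠ 0) (I : Setoid (Fin (n + 1))) :
    ∃ J : Setoid (Fin n), tiePart u (n + 1) I = incl u n (tiePart u n J) ∨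
      ∃ j : ℕ, 1 ≤ j ∧ j ≤ n ∧
        tiePart u (n + 1) I = incl u n (tiePart u n J) * et u (n + 1) j (n + 1) := by
  refine ⟨removeLast I, ?_⟩
  by_cases h : InSupp I (Fin.last n)
  · obtain ⟨b, hb, h⟩ := h
    induction b using Fin.lastCases with
    | last => exact absurd rfl hb
    | cast b => exact Or.inr ⟨b + 1, by omega, by omega, tiePart_eq_of_rel hu (I.symm h)⟩
  · exact Or.inl (tiePart_eq_of_not_inSupp hu h)

theorem removeLast_merge_addSingleton (J : Setoid (Fin n)) (k : Fin n) :
    removeLast (merge (addSingleton J) k.castSucc (Fin.last n)) = J := by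
  apply le_antisymm
  · intro a b h
    have hle : merge (addSingleton J) k.castSucc (Fin.last n) ≤ addToBlock J k := by
      refine merge_le ?_ (addToBlock_rel J k)
      rintro a b (rfl | ⟨c, d, rfl, rfl, h⟩)
      · exact Setoid.refl' _ _
      · exact addToBlock_castSucc.2 h
    exact addToBlock_castSucc.1 (hle h)
  · exact fun a b h => le_merge (addSingleton J) _ _ (Or.inr ⟨a, b, rfl, rfl, h⟩)

theorem removeLast_merge_addToBlock (J : Setoid (Fin n)) (j k : Fin n) :
    removeLast (merge (addToBlock J j) k.castSucc (Fin.last n)) = merge J j k := by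
  apply le_antisymm
  · intro a b h
    have hle : merge (addToBlock J j) k.castSucc (Fin.last n) ≤ addToBlock (merge J j k) j :=
      merge_le (fun a b h => le_merge J j k h)
        (addToBlock_castSucc_last.2 ((merge J j k).symm (merge_rel J j k)))
    exact addToBlock_castSucc.1 (hle h)
  · refine merge_le (fun a b h => ?_) ?_
    · exact le_merge (addToBlock J j) _ _ (addToBlock_castSucc.2 h)
    · exact (merge (addToBlock J j) k.castSucc (Fin.last n)).trans
        (le_merge _ _ _ (addToBlock_rel J j))
        ((merge (addToBlock J j) k.castSucc (Fin.last n)).symm (merge_rel _ _ _))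

/-! ### Descending products and the spanning property -/

theorem descending_succ {m k : ℕ} (h : k ≤ m + 1) :
    descending u n (m + 1) k = T u n (m + 1) * descending u n m k := by
  simp [descending, h]

theorem descending_of_lt {m k : ℕ} (h : m < k) : descending u n m k = 1 := by
  cases m with
  | zero => rfl
  | succ m => simp [descending, h]

theorem descending_eq_mul_T {m k : ℕ} (hk : 1 ≤ k) (h : k ≤ m) :
    descending u n m k = descending u n m (k + 1) * T u n k := by
  induction m with
  | zero => omega
  | succ m ih =>
    rw [descending_succ h]
    rcases eq_or_lt_of_le h with rfl | h
    · rw [descending_of_lt (by omega), descending_of_lt (by omega), mul_one, one_mul]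
    · rw [descending_succ (by omega), ih (by omega), mul_assoc]

theorem commute_T_descending {m k c : ℕ} (hm : m < n) (hc : 1 ≤ c) (hcn : c < n)
    (h : c + 1 < k ∨ m + 1 < c) : Commute (T u n c) (descending u n m k) := by
  induction m with
  | zero => exact Commute.one_right _
  | succ m ih =>
    by_cases hk' : k ≤ m + 1
    · rw [descending_succ hk']
      exact Commute.mul_right (T_comm_of_far hc hcn (by omega) hm (by unfold Far; omega))
        (ih (by omega) (by omega))
    · rw [descending_of_lt (by omega)]
      exact Commute.one_right _

theorem descending_mul_T {m k j : ℕ} (hk : 1 ≤ k) (hm : m < n) (hkj : k ≤ j) (hjm : j + 1 ≤ m) :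
    descending u n m k * T u n (j + 1) = T u n j * descending u n m k := by
  induction m with
  | zero => omega
  | succ m ih =>
    rw [descending_succ (by omega)]
    rcases eq_or_lt_of_le hjm with h | h
    · obtain rfl : j = m := by omega
      obtain ⟨j, rfl⟩ : ∃ j', j = j' + 1 := ⟨j - 1, by omega⟩
      rw [descending_succ (by omega), mul_assoc, mul_assoc,
        ← (commute_T_descending (by omega) (by omega) hm (by omega)).eq, ← mul_assoc,
        ← mul_assoc, T_braid (by omega) hm (by omega) (by omega) (Or.inr rfl)]
      simp only [mul_assoc]
    · rw [mul_assoc, ih (by omega) (by omega), ← mul_assoc, ← mul_assoc,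
        T_comm_of_far (by omega) hm (by omega) (by omega) (by unfold Far; omega)]

theorem incl_descending {m k : ℕ} (hm : m < n) :
    incl u n (descending u n m k) = descending u (n + 1) m k := by
  induction m with
  | zero => simp [descending]
  | succ m ih =>
    by_cases h : k ≤ m + 1
    · rw [descending_succ h, descending_succ h, map_mul, ih (by omega), incl_T (by omega) hm]
    · rw [descending_of_lt (by omega), descending_of_lt (by omega), map_one]

theorem incl_bigT {i k : ℕ} (hi : i < n) : incl u n (bigT u n i k) = bigT u (n + 1) i k := by
  unfold bigT
  split_ifs
  · exact map_one _
  · exact incl_descending hi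

/-- The permutation of the strands by which the descending product `T_m ⋯ T_k` moves ties to its
right; it maps `m + 1` to `k`. -/
def cycle (m k a : ℕ) : ℕ :=
  if a < k ∨ m + 1 < a then a else if a = m + 1 then k else a + 1

theorem cycle_mem {m k a : ℕ} (hk : 1 ≤ k) (hkm : k ≤ m + 1) (hm : m < n) (ha : 1 ≤ a)
    (han : a ≤ n) : 1 ≤ cycle m k a ∧ cycle m k a ≤ n := by
  unfold cycle; split_ifs <;> omega

theorem cycle_last {m k : ℕ} (hkm : k ≤ m + 1) : cycle m k (m + 1) = k := by
  unfold cycle; split_ifs <;> omega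

theorem cycle_of_lt {m k a : ℕ} (h : m + 1 < a) : cycle m k a = a := by
  unfold cycle; split_ifs <;> omega

theorem cycle_swap {m k a : ℕ} (hkm : k ≤ m + 1) :
    cycle m k (Equiv.swap (m + 1) (m + 1 + 1) a) = cycle (m + 1) k a := by
  rw [Equiv.swap_apply_def]
  unfold cycle
  split_ifs <;> omega

theorem et_mul_descending (hu : u ≠ 0) {m k a b : ℕ} (hk : 1 ≤ k) (hkm : k ≤ m + 1) (hm : m < n)
    (ha : 1 ≤ a) (han : a ≤ n) (hb : 1 ≤ b) (hbn : b ≤ n) :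
    et u n a b * descending u n m k =
      descending u n m k * et u n (cycle m k a) (cycle m k b) := by
  have hid : ∀ m a, cycle m (m + 1) a = a := fun m a => by unfold cycle; split_ifs <;> omega
  rcases eq_or_lt_of_le hkm with rfl | hkm
  · rw [descending_of_lt (by omega), hid, hid, one_mul, mul_one]
  induction m generalizing a b with
  | zero => omega
  | succ m ih =>
    have h1 := swap_mem (n := n) (by omega : 1 ≤ m + 1) hm ha han
    have h2 := swap_mem (n := n) (by omega : 1 ≤ m + 1) hm hb hbn
    rw [descending_succ (by omega), ← mul_assoc, et_mul_T hu (by omega) hm ha han hb hbn, mul_assoc,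
      ← cycle_swap (by omega), ← cycle_swap (by omega), mul_assoc]
    congr 1
    rcases eq_or_lt_of_le (by omega : k ≤ m + 1) with rfl | hkm'
    · rw [descending_of_lt (by omega), hid, hid, one_mul, mul_one]
    · exact ih (by omega) (by omega) h1.1 h1.2 h2.1 h2.2 hkm'

theorem exists_tiePart_mul_descending (hu : u ≠ 0) {m k : ℕ} (hk : 1 ≤ k) (hkm : k ≤ m + 1)
    (hm : m < n) (I : Setoid (Fin n)) :
    ∃ J, tiePart u n I * descending u n m k = descending u n m k * tiePart u n J :=
  exists_tiePart_mul_eq hu (fun _ ha han => cycle_mem hk hkm hm ha han)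
    (fun _ _ ha han hb hbn => et_mul_descending hu hk hkm hm ha han hb hbn) I

/-- The algebra on `n + 1` strands is spanned by the products `x (T_n ⋯ T_k) E_I`, where `x` comes
from the algebra on `n` strands; the descending product is empty for `k = n + 1`. -/
theorem mem_span_incl_descending_tiePart (hu : u ≠ 0) (y : BT u (n + 1)) :
    y ∈ Submodule.span F {y | ∃ (x : BT u n) (k : ℕ) (I : Setoid (Fin (n + 1))),
      1 ≤ k ∧ k ≤ n + 1 ∧ y = incl u n x * descending u (n + 1) n k * tiePart u (n + 1) I} := by
  set S := Submodule.span F {y | ∃ (x : BT u n) (k : ℕ) (I : Setoid (Fin (n + 1))),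
      1 ≤ k ∧ k ≤ n + 1 ∧ y = incl u n x * descending u (n + 1) n k * tiePart u (n + 1) I}
  have mem : ∀ (x : BT u n) (k : ℕ) (I : Setoid (Fin (n + 1))), 1 ≤ k → k ≤ n + 1 →
      incl u n x * descending u (n + 1) n k * tiePart u (n + 1) I ∈ S := fun x k I h1 h2 =>
    Submodule.subset_span ⟨x, k, I, h1, h2, rfl⟩
  have step : ∀ g : BT u (n + 1), (∀ (x : BT u n) (k : ℕ) (I : Setoid (Fin (n + 1))), 1 ≤ k →
      k ≤ n + 1 → incl u n x * descending u (n + 1) n k * tiePart u (n + 1) I * g ∈ S) →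
      ∀ z ∈ S, z * g ∈ S := by
    intro g hg z hz
    induction hz using Submodule.span_induction with
    | mem z hz =>
      obtain ⟨x, k, I, h1, h2, rfl⟩ := hz
      exact hg x k I h1 h2
    | zero => rw [zero_mul]; exact S.zero_mem
    | add a b _ _ ha hb => rw [add_mul]; exact S.add_mem ha hb
    | smul c a _ ha => rw [smul_mul_assoc]; exact S.smul_mem c ha
  have stepE : ∀ i, 1 ≤ i → i < n + 1 → ∀ z ∈ S, z * E u (n + 1) i ∈ S := by
    intro i hi hin
    refine step _ fun x k I h1 h2 => ?_
    obtain ⟨J, hJ⟩ := exists_tiePart_mul_et (u := u) (n := n + 1) hu hi (by omega)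
      (by omega : 1 ≤ i + 1) (by omega) I
    rw [← et_succ, mul_assoc, hJ]
    exact mem x k J h1 h2
  refine mem_of_mul_gen_mem S ?_ (fun i hi hin => step _ fun x k I h1 h2 => ?_) stepE y
  · have h := mem 1 (n + 1) ⊥ (by omega) le_rfl
    rwa [map_one, descending_of_lt (by omega), tiePart_bot, one_mul, one_mul] at h
  obtain ⟨J, hJ⟩ := exists_tiePart_mul_T hu hi hin I
  rw [mul_assoc, hJ, ← mul_assoc, mul_assoc (incl u n x)]
  rcases lt_trichotomy i k with h | rfl | h
  · rcases eq_or_lt_of_le (by omega : i + 1 ≤ k) with rfl | h'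
    · rw [← descending_eq_mul_T hi (by omega)]
      exact mem x i J hi (by omega)
    · rw [← (commute_T_descending (by omega) hi hin (by omega)).eq, ← mul_assoc,
        ← incl_T hi (by omega), ← map_mul]
      exact mem _ k J h1 h2
  · rw [descending_eq_mul_T hi (by omega), mul_assoc (descending _ _ _ _), T_mul_self hi hin]
    have h0 := mem x (i + 1) J (by omega) (by omega)
    have hTi := mem x i J hi h2
    -- the tie `E_i` is moved to the right through `T_i` and `E_J`
    obtain ⟨K, hK⟩ := exists_tiePart_mul_et (u := u) (n := n + 1) hu hi (by omega)
      (by omega : 1 ≤ i + 1) (by omega) J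
    have hc := (commute_et_tiePart (u := u) (n := n + 1) hu hi (by omega)
      (by omega : 1 ≤ i + 1) (by omega) J).eq
    have h0' := mem x (i + 1) K (by omega) (by omega)
    have hTi' := mem x i K hi h2
    rw [et_succ] at hK hc
    rw [descending_eq_mul_T hi (by omega)] at hTi'
    rw [← hK, ← hc] at h0' hTi'
    rw [E_mul_T hi hin]
    have : incl u n x * (descending u (n + 1) n (i + 1) *
        (1 + (u - 1) • (E u (n + 1) i + T u (n + 1) i * E u (n + 1) i))) * tiePart u (n + 1) J =
        incl u n x * descending u (n + 1) n (i + 1) * tiePart u (n + 1) J + (u - 1) •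
        (incl u n x * descending u (n + 1) n (i + 1) * (E u (n + 1) i * tiePart u (n + 1) J) +
        incl u n x * (descending u (n + 1) n (i + 1) * T u (n + 1) i) *
          (E u (n + 1) i * tiePart u (n + 1) J)) := by
      simp only [mul_add, add_mul, mul_one, mul_smul_comm, smul_mul_assoc, mul_assoc]
    rw [this]
    exact S.add_mem h0 (S.smul_mem _ (S.add_mem h0' hTi'))
  · obtain ⟨j, rfl⟩ : ∃ j, i = j + 1 := ⟨i - 1, by omega⟩
    rw [descending_mul_T h1 (by omega) (by omega) (by omega), ← mul_assoc,
      ← incl_T (by omega) (by omega), ← map_mul]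
    exact mem _ k J h1 h2

/-- The indices `k_1, …, k_{n-1}` of a Ryom-Hansen basis element, and one more index `k_n`. -/
def snocIndex (k : ∀ i : Fin n, Fin ((i : ℕ) + 1)) (l : Fin (n + 1)) :
    ∀ i : Fin (n + 1), Fin ((i : ℕ) + 1) :=
  Fin.snoc (α := fun i : Fin (n + 1) => Fin ((i : ℕ) + 1)) k l

theorem braidWord_succ (k : ∀ i : Fin (n + 1), Fin ((i : ℕ) + 1)) :
    braidWord u (n + 1) k =
      incl u n (braidWord u n fun i => k i.castSucc) * bigT u (n + 1) n (k (Fin.last n)) := by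
  rw [braidWord, List.ofFn_succ', List.concat_eq_append, List.prod_append, List.prod_singleton,
    braidWord, map_list_prod, List.map_ofFn]
  congr 3
  funext i
  exact (incl_bigT i.2).symm

theorem snocIndex_castSucc (k : ∀ i : Fin n, Fin ((i : ℕ) + 1)) (l : Fin (n + 1)) (i : Fin n) :
    snocIndex k l i.castSucc = k i := Fin.snoc_castSucc (α := fun i : Fin (n + 1) => Fin (i + 1)) ..

theorem snocIndex_last (k : ∀ i : Fin n, Fin ((i : ℕ) + 1)) (l : Fin (n + 1)) :
    snocIndex k l (Fin.last n) = l := Fin.snoc_last (α := fun i : Fin (n + 1) => Fin (i + 1)) ..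

theorem braidWord_snocIndex (k : ∀ i : Fin n, Fin ((i : ℕ) + 1)) (l : Fin (n + 1)) :
    braidWord u (n + 1) (snocIndex k l) =
      incl u n (braidWord u n k) * bigT u (n + 1) n l := by
  rw [braidWord_succ, snocIndex_last]
  simp only [snocIndex_castSucc]

theorem braidWord_snocIndex_zero (k : ∀ i : Fin n, Fin ((i : ℕ) + 1)) :
    braidWord u (n + 1) (snocIndex k 0) = incl u n (braidWord u n k) := by
  rw [braidWord_snocIndex]; simp [bigT]

theorem braidWord_snocIndex_of_pos (k : ∀ i : Fin n, Fin ((i : ℕ) + 1)) {l : ℕ} (hl : 1 ≤ l)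
    (hln : l < n + 1) : braidWord u (n + 1) (snocIndex k ⟨l, hln⟩) =
      incl u n (braidWord u n k) * descending u (n + 1) n l := by
  have h0 : l ≠ 0 := by omega
  rw [braidWord_snocIndex, bigT, if_neg (by simpa using h0)]

theorem span_basisElt (hu : u ≠ 0) (n : ℕ) :
    Submodule.span F (Set.range (basisElt u n)) = ⊤ := by
  induction n with
  | zero =>
    refine eq_top_iff.2 fun y _ => ?_
    obtain ⟨c, rfl⟩ := exists_eq_algebraMap (by omega) y
    rw [Algebra.algebraMap_eq_smul_one]
    refine Submodule.smul_mem _ _ (Submodule.subset_span ⟨⟨fun i => i.elim0, ⊥⟩, ?_⟩)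
    simp [basisElt, braidWord, tiePart_bot]
  | succ n ih =>
    refine eq_top_iff.2 fun y _ => ?_
    refine Submodule.span_le.2 ?_ (mem_span_incl_descending_tiePart hu y)
    rintro _ ⟨x, k, I, hk, hkn, rfl⟩
    have hx : x ∈ Submodule.span F (Set.range (basisElt u n)) := ih ▸ Submodule.mem_top
    induction hx using Submodule.span_induction with
    | mem x hx =>
      obtain ⟨⟨w, J⟩, rfl⟩ := hx
      rw [basisElt, map_mul, mul_assoc (incl u n _), ← tiePart_addSingleton hu]
      obtain ⟨J', hJ'⟩ := exists_tiePart_mul_descending (u := u) (n := n + 1) (m := n) hu hk hkn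
        (by omega) (addSingleton J)
      obtain ⟨K, hK⟩ := tiePart_mul_tiePart hu J' I
      rw [hJ', mul_assoc, mul_assoc, hK]
      rcases eq_or_lt_of_le hkn with rfl | hkn
      · refine Submodule.subset_span ⟨⟨snocIndex w 0, K⟩, ?_⟩
        rw [basisElt, braidWord_snocIndex_zero, descending_of_lt (by omega), one_mul]
      · refine Submodule.subset_span ⟨⟨snocIndex w ⟨k, hkn⟩, K⟩, ?_⟩
        rw [basisElt, braidWord_snocIndex_of_pos w hk, mul_assoc]
    | zero => simp
    | add a b _ _ ha hb => rw [map_add, add_mul, add_mul]; exact Submodule.add_mem _ ha hb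
    | smul c a _ ha =>
      rw [map_smul, smul_mul_assoc, smul_mul_assoc]; exact Submodule.smul_mem _ _ ha

/-! ### A representation, and the linear independence -/

/-- A configuration: each place `i` carries a particle `(p, c)` of rank `p` and colour `c`.
The algebra on `n` strands only acts on the places `1, …, n`. -/
abbrev Config : Type := ℕ → ℕ × ℕ

/-- The weight with which `T_i` exchanges the particles `p` and `q` at the places `i`, `i + 1`.
Particles of the same colour are treated as in a Hecke algebra, particles of different colours are
simply exchanged. -/
def swapCoeff (u : F) (p q : ℕ × ℕ) : F :=
  if p.2 = q.2 then (if p.1 < q.1 then 1 else if p.1 = q.1 then 0 else u) else 1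

/-- The weight with which `T_i` leaves the particles `p` and `q` at the places `i`, `i + 1`. -/
def stayCoeff (u : F) (p q : ℕ × ℕ) : F :=
  if p.2 = q.2 then (if p.1 < q.1 then 0 else if p.1 = q.1 then u else u - 1) else 0

/-- The configuration with the particles at the places `i` and `i + 1` exchanged. -/
def exchange (i : ℕ) (x : Config) : Config := fun j => x (Equiv.swap i (i + 1) j)

@[simp] theorem exchange_left (i : ℕ) (x : Config) : exchange i x i = x (i + 1) := by
  simp [exchange]

@[simp] theorem exchange_right (i : ℕ) (x : Config) : exchange i x (i + 1) = x i := by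
  simp [exchange]

theorem exchange_of_ne {i j : ℕ} (x : Config) (h1 : j ≠ i) (h2 : j ≠ i + 1) :
    exchange i x j = x j := by
  simp [exchange, Equiv.swap_apply_of_ne_of_ne h1 h2]

@[simp] theorem exchange_exchange (i : ℕ) (x : Config) : exchange i (exchange i x) = x := by
  funext j; simp [exchange]

theorem exchange_comm {i j : ℕ} (h : Far i j) (x : Config) :
    exchange i (exchange j x) = exchange j (exchange i x) := by
  funext k
  unfold Far at h
  simp only [exchange, Equiv.swap_apply_def]
  congr 1
  grind

theorem exchange_braid (i : ℕ) (x : Config) :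
    exchange i (exchange (i + 1) (exchange i x)) =
      exchange (i + 1) (exchange i (exchange (i + 1) x)) := by
  funext k
  simp only [exchange, Equiv.swap_apply_def]
  congr 1
  grind

/-- The action of `T_i` on functions of configurations. -/
def opT (u : F) (i : ℕ) : Module.End F (Config → F) where
  toFun φ x := swapCoeff u (x i) (x (i + 1)) * φ (exchange i x) +
    stayCoeff u (x i) (x (i + 1)) * φ x
  map_add' φ ψ := by funext x; simp only [Pi.add_apply]; ring
  map_smul' c φ := by
    funext x; simp only [Pi.smul_apply, smul_eq_mul, RingHom.id_apply]; ring

/-- The action of `E_{a,b}` on functions of configurations: the functions are restricted to the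
configurations with equal colours at the places `a` and `b`. -/
def opTie (F : Type*) [Field F] (a b : ℕ) : Module.End F (Config → F) where
  toFun φ x := if (x a).2 = (x b).2 then φ x else 0
  map_add' φ ψ := by funext x; simp only [Pi.add_apply]; split_ifs <;> simp
  map_smul' c φ := by
    funext x; simp only [Pi.smul_apply, smul_eq_mul, RingHom.id_apply]; split_ifs <;> simp

theorem opT_apply (i : ℕ) (φ : Config → F) (x : Config) :
    opT u i φ x = swapCoeff u (x i) (x (i + 1)) * φ (exchange i x) +
      stayCoeff u (x i) (x (i + 1)) * φ x := rfl

theorem opTie_apply (a b : ℕ) (φ : Config → F) (x : Config) :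
    opTie F a b φ x = if (x a).2 = (x b).2 then φ x else 0 := rfl

theorem opT_comm {i j : ℕ} (h : Far i j) : opT u i * opT u j = opT u j * opT u i := by
  refine LinearMap.ext fun φ => funext fun x => ?_
  have h' := h
  unfold Far at h'
  simp only [Module.End.mul_apply, opT_apply, exchange_comm h]
  rw [exchange_of_ne x (by omega : j ≠ i) (by omega), exchange_of_ne x (by omega : j + 1 ≠ i)
    (by omega), exchange_of_ne x (by omega : i ≠ j) (by omega),
    exchange_of_ne x (by omega : i + 1 ≠ j) (by omega)]
  ring

theorem swapCoeff_of_ne {p q : ℕ × ℕ} (h : p.2 ≠ q.2) : swapCoeff u p q = 1 := by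
  simp [swapCoeff, h]

theorem stayCoeff_of_ne {p q : ℕ × ℕ} (h : p.2 ≠ q.2) : stayCoeff u p q = 0 := by
  simp [stayCoeff, h]

/-- For particles of the same colour the weights only depend on the comparison of the ranks. -/
theorem coeff_cases {p q : ℕ × ℕ} (h : p.2 = q.2) :
    (p.1 < q.1 ∧ swapCoeff u p q = 1 ∧ swapCoeff u q p = u ∧ stayCoeff u p q = 0 ∧
        stayCoeff u q p = u - 1) ∨
      (p.1 = q.1 ∧ swapCoeff u p q = 0 ∧ swapCoeff u q p = 0 ∧ stayCoeff u p q = u ∧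
        stayCoeff u q p = u) ∨
      (q.1 < p.1 ∧ swapCoeff u p q = u ∧ swapCoeff u q p = 1 ∧ stayCoeff u p q = u - 1 ∧
        stayCoeff u q p = 0) := by
  rcases lt_trichotomy p.1 q.1 with h1 | h1 | h1
  · exact Or.inl ⟨h1, by simp [swapCoeff, stayCoeff, h, h1, h1.not_gt, h1.ne']⟩
  · exact Or.inr (Or.inl ⟨h1, by simp [swapCoeff, stayCoeff, h, h1]⟩)
  · exact Or.inr (Or.inr ⟨h1, by simp [swapCoeff, stayCoeff, h, h1, h1.not_gt, h1.ne']⟩)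

/-- The Yang-Baxter equation for the weights, the only relation behind the braid relation. -/
theorem yang_baxter (p q r : ℕ × ℕ) :
    stayCoeff u p q * stayCoeff u q r * stayCoeff u p q +
        swapCoeff u p q * stayCoeff u p r * swapCoeff u q p =
      stayCoeff u q r * stayCoeff u p q * stayCoeff u q r +
        swapCoeff u q r * stayCoeff u p r * swapCoeff u r q ∧
    swapCoeff u p q * (stayCoeff u p r * stayCoeff u q p + stayCoeff u p q * stayCoeff u q r) =
      swapCoeff u p q * (stayCoeff u q r * stayCoeff u p r) ∧
    swapCoeff u q r * (stayCoeff u p r * stayCoeff u r q + stayCoeff u q r * stayCoeff u p q) =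
      swapCoeff u q r * (stayCoeff u p q * stayCoeff u p r) := by
  by_cases h1 : p.2 = q.2 <;> by_cases h2 : q.2 = r.2
  · rcases coeff_cases (u := u) h1 with ⟨k1, e1, e2, e3, e4⟩ | ⟨k1, e1, e2, e3, e4⟩ |
      ⟨k1, e1, e2, e3, e4⟩ <;>
    rcases coeff_cases (u := u) h2 with ⟨k2, f1, f2, f3, f4⟩ | ⟨k2, f1, f2, f3, f4⟩ |
      ⟨k2, f1, f2, f3, f4⟩ <;>
    rcases coeff_cases (u := u) (h1.trans h2) with ⟨k3, g1, g2, g3, g4⟩ | ⟨k3, g1, g2, g3, g4⟩ |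
      ⟨k3, g1, g2, g3, g4⟩ <;>
    first
    | (exfalso; omega)
    | (rw [e1, e2, e3, e4, f1, f2, f3, f4, g3]
       exact ⟨by ring, by ring, by ring⟩)
  · have h3 : p.2 ≠ r.2 := h1 ▸ h2
    simp [stayCoeff_of_ne h2, stayCoeff_of_ne h3, stayCoeff_of_ne (Ne.symm h2)]
  · have h3 : p.2 ≠ r.2 := fun h => h1 (h.trans h2.symm)
    simp [stayCoeff_of_ne h1, stayCoeff_of_ne h3, stayCoeff_of_ne (Ne.symm h1)]
  · rw [stayCoeff_of_ne h1, stayCoeff_of_ne h2, stayCoeff_of_ne (Ne.symm h1),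
      stayCoeff_of_ne (Ne.symm h2), swapCoeff_of_ne h1, swapCoeff_of_ne h2,
      swapCoeff_of_ne (Ne.symm h1), swapCoeff_of_ne (Ne.symm h2)]
    exact ⟨by ring, by ring, by ring⟩

theorem opT_braid (i : ℕ) :
    opT u i * opT u (i + 1) * opT u i = opT u (i + 1) * opT u i * opT u (i + 1) := by
  refine LinearMap.ext fun φ => funext fun x => ?_
  have e1 : ∀ y : Config, exchange i y (i + 1 + 1) = y (i + 1 + 1) := fun y =>
    exchange_of_ne y (by omega) (by omega)
  have e2 : ∀ y : Config, exchange (i + 1) y i = y i := fun y =>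
    exchange_of_ne y (by omega) (by omega)
  simp only [Module.End.mul_apply, opT_apply, exchange_left, exchange_right, e1, e2,
    exchange_exchange, exchange_braid]
  obtain ⟨h1, h2, h3⟩ := yang_baxter (u := u) (x i) (x (i + 1)) (x (i + 1 + 1))
  linear_combination φ x * h1 + φ (exchange i x) * h2 - φ (exchange (i + 1) x) * h3

theorem opT_sq (i : ℕ) :
    opT u i ^ 2 = 1 + (u - 1) • (opTie F i (i + 1) * (1 + opT u i)) := by
  refine LinearMap.ext fun φ => funext fun x => ?_
  simp only [sq, Module.End.mul_apply, opT_apply, exchange_left, exchange_right,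
    exchange_exchange, LinearMap.add_apply, LinearMap.smul_apply, Module.End.one_apply,
    opTie_apply, Pi.add_apply, Pi.smul_apply, smul_eq_mul]
  by_cases hc : (x i).2 = (x (i + 1)).2
  · simp only [if_pos hc]
    rcases coeff_cases (u := u) hc with ⟨k, e1, e2, e3, e4⟩ | ⟨k, e1, e2, e3, e4⟩ |
      ⟨k, e1, e2, e3, e4⟩ <;> rw [e1, e2, e3, e4] <;> ring
  · rw [if_neg hc, swapCoeff_of_ne hc, swapCoeff_of_ne (Ne.symm hc), stayCoeff_of_ne hc,
      stayCoeff_of_ne (Ne.symm hc)]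
    ring

theorem opTie_comm (a b c d : ℕ) : opTie F a b * opTie F c d = opTie F c d * opTie F a b := by
  refine LinearMap.ext fun φ => funext fun x => ?_
  simp only [Module.End.mul_apply, opTie_apply]
  split_ifs <;> rfl

theorem opTie_sq (a b : ℕ) : opTie F a b ^ 2 = opTie F a b := by
  refine LinearMap.ext fun φ => funext fun x => ?_
  simp only [sq, Module.End.mul_apply, opTie_apply]
  split_ifs <;> rfl

/-- `T_i` exchanges the places of the ties: if its weight for leaving two particles in place does
not vanish, their colours agree. -/
theorem opTie_mul_opT (i a b : ℕ) :
    opTie F a b * opT u i =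
      opT u i * opTie F (Equiv.swap i (i + 1) a) (Equiv.swap i (i + 1) b) := by
  refine LinearMap.ext fun φ => funext fun x => ?_
  simp only [Module.End.mul_apply, opTie_apply, opT_apply, exchange, Equiv.swap_apply_self]
  by_cases h : (x i).2 = (x (i + 1)).2
  · have key : ∀ c, (x (Equiv.swap i (i + 1) c)).2 = (x c).2 := fun c => by
      rw [Equiv.swap_apply_def]; split_ifs with h1 h2
      · rw [h1, h]
      · rw [h2, h]
      · rfl
    simp only [key]
    split_ifs <;> simp
  · have h0 : stayCoeff u (x i) (x (i + 1)) = 0 := by simp [stayCoeff, h]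
    rw [h0]
    simp

theorem opTie_symm (a b : ℕ) : opTie F a b = opTie F b a :=
  LinearMap.ext fun φ => funext fun x => by simp only [opTie_apply, eq_comm]

theorem opTie_self_mul_opT (i : ℕ) : opTie F i (i + 1) * opT u i = opT u i * opTie F i (i + 1) := by
  rw [opTie_mul_opT, Equiv.swap_apply_left, Equiv.swap_apply_right, opTie_symm]

theorem opTie_mul_opTie {a b c d a' b' c' d' : ℕ}
    (h : ∀ f : ℕ → ℕ, f a = f b ∧ f c = f d ↔ f a' = f b' ∧ f c' = f d') :
    opTie F a b * opTie F c d = opTie F a' b' * opTie F c' d' := by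
  refine LinearMap.ext fun φ => funext fun x => ?_
  simp only [Module.End.mul_apply, opTie_apply, ← ite_and]
  exact if_congr (h fun i => (x i).2) rfl rfl

/-- The operator by which a generating symbol acts. -/
def opGen (u : F) (n : ℕ) : Gen n → Module.End F (Config → F)
  | Gen.T i => opT u (i + 1)
  | Gen.E i => opTie F (i + 1) (i + 1 + 1)

theorem lift_opGen_rel {x y : FreeAlgebra F (Gen n)} (h : Rel u n x y) :
    FreeAlgebra.lift F (opGen u n) x = FreeAlgebra.lift F (opGen u n) y := by
  have hT : ∀ i : Fin (n - 1), FreeAlgebra.lift F (opGen u n) (fT F i) = opT u (i + 1) :=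
    fun i => FreeAlgebra.lift_ι_apply _ _
  have hE : ∀ i : Fin (n - 1),
      FreeAlgebra.lift F (opGen u n) (fE F i) = opTie F (i + 1) (i + 1 + 1) :=
    fun i => FreeAlgebra.lift_ι_apply _ _
  have hne : ∀ k : ℕ, k + 1 + 1 ≠ k := fun k => by omega
  cases h <;> simp only [map_mul, map_add, map_pow, map_one, map_smul, hT, hE]
  case TT_far i j h => exact opT_comm (by unfold Far at *; omega)
  case TTT i j h =>
    rcases h with h | h
    · rw [← h]; exact opT_braid _
    · rw [← h]; exact (opT_braid _).symm
  case T_sq i => exact opT_sq _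
  case EE i j => exact opTie_comm _ _ _ _
  case E_sq i => exact opTie_sq _ _
  case ET i => exact opTie_self_mul_opT _
  case ET_far i j h =>
    unfold Far at h
    rw [opTie_mul_opT, Equiv.swap_apply_of_ne_of_ne (by omega) (by omega),
      Equiv.swap_apply_of_ne_of_ne (by omega) (by omega)]
  case EET i j h =>
    rw [mul_assoc, opTie_mul_opT, ← mul_assoc, opTie_self_mul_opT, mul_assoc, mul_assoc]
    congr 1
    rcases h with h | h <;> rw [← h] <;> refine opTie_mul_opTie fun f => ?_ <;>
      simp [Equiv.swap_apply_def, hne] <;> omega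
  case TEE i j h =>
    rw [opTie_mul_opT, mul_assoc, mul_assoc]
    congr 1
    rcases h with h | h <;> rw [← h] <;> refine opTie_mul_opTie fun f => ?_ <;>
      simp [Equiv.swap_apply_def, hne] <;> omega
  case ETT i j h =>
    rw [opTie_mul_opT, mul_assoc, opTie_mul_opT, mul_assoc]
    congr 2
    rcases h with h | h <;> rw [← h]
    · simp [Equiv.swap_apply_def, hne]
    · simp [Equiv.swap_apply_def, hne]

/-- The representation of the bt-algebra on functions of configurations. -/
def rep (u : F) (n : ℕ) : BT u n →ₐ[F] Module.End F (Config → F) :=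
  RingQuot.liftAlgHom F ⟨FreeAlgebra.lift F (opGen u n), fun _ _ h => lift_opGen_rel h⟩

theorem rep_mk (a : FreeAlgebra F (Gen n)) :
    rep u n (mk u n a) = FreeAlgebra.lift F (opGen u n) a :=
  RingQuot.liftAlgHom_mkAlgHom_apply _ _ _ _

theorem rep_T {i : ℕ} (hi : 1 ≤ i) (hin : i < n) : rep u n (T u n i) = opT u i := by
  rw [T_eq_mk hi hin, rep_mk, fT, FreeAlgebra.lift_ι_apply]
  simp only [opGen, Nat.sub_add_cancel hi]

theorem rep_E {i : ℕ} (hi : 1 ≤ i) (hin : i < n) : rep u n (E u n i) = opTie F i (i + 1) := by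
  rw [E_eq_mk hi hin, rep_mk, fE, FreeAlgebra.lift_ι_apply]
  simp only [opGen, Nat.sub_add_cancel hi]

theorem rep_tieAux (hu : u ≠ 0) {i d : ℕ} (hi : 1 ≤ i) (hd : i + d < n) :
    rep u n (tieAux u n i d) = opTie F i (i + d + 1) := by
  induction d generalizing i with
  | zero => exact rep_E hi hd
  | succ d ih =>
    refine ((isUnit_T (n := n) hu hi (by omega)).map (rep u n)).mul_right_cancel ?_
    rw [← map_mul, tieAux_succ_mul_T hu hi (by omega), map_mul, ih (by omega) (by omega),
      rep_T hi (by omega), opTie_mul_opT, Equiv.swap_apply_left,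
      Equiv.swap_apply_of_ne_of_ne (by omega) (by omega)]
    congr 2
    omega

theorem rep_et (hu : u ≠ 0) {a b : ℕ} (ha : 1 ≤ a) (han : a ≤ n) (hb : 1 ≤ b) (hbn : b ≤ n) :
    rep u n (et u n a b) = opTie F a b := by
  wlog hab : a < b generalizing a b
  · rcases eq_or_ne a b with rfl | hne
    · rw [et_self, map_one]
      exact LinearMap.ext fun φ => funext fun x => by simp [opTie_apply]
    · rw [et_symm, this hb hbn ha han (by omega), opTie_symm]
  obtain ⟨d, rfl⟩ : ∃ d, b = a + d + 1 := ⟨b - a - 1, by omega⟩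
  rw [et_add, rep_tieAux hu ha (by omega)]

/-- The set partition of the strands by the colours of a configuration. -/
def colourPart (n : ℕ) (x : Config) : Setoid (Fin n) := Setoid.ker fun a => (x (a + 1)).2

open Classical in
theorem rep_tiePart (hu : u ≠ 0) (I : Setoid (Fin n)) (φ : Config → F) (x : Config) :
    rep u n (tiePart u n I) φ x = if I ≤ colourPart n x then φ x else 0 := by
  split_ifs with h
  · obtain ⟨l, hl, hI⟩ := exists_tiePart_eq_prod (u := u) I
    have h' : ∀ p ∈ l, colourPart n x p.1 p.2 := fun p hp => h ((hl p).1 hp).2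
    rw [hI]
    clear hI hl
    induction l with
    | nil => simp
    | cons p l ih =>
      have hp : (x (p.1 + 1)).2 = (x (p.2 + 1)).2 := h' p (by simp)
      rw [List.map_cons, List.prod_cons, map_mul,
        rep_et hu (by omega) (by omega) (by omega) (by omega), Module.End.mul_apply, opTie_apply,
        if_pos hp, ih fun q hq => h' q (List.mem_cons_of_mem _ hq)]
  · obtain ⟨a, b, hab, hne⟩ : ∃ a b : Fin n, I a b ∧ ¬ colourPart n x a b := by
      by_contra! hcon
      exact h fun a b hab => hcon a b hab
    have hne : (x (a + 1)).2 ≠ (x (b + 1)).2 := hne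
    rw [← tiePart_mul_et hu hab,
      ← (commute_et_tiePart hu (by omega) (by omega) (by omega) (by omega) I).eq, map_mul,
      rep_et hu (by omega) (by omega) (by omega) (by omega), Module.End.mul_apply, opTie_apply,
      if_neg hne]

theorem rep_incl (y : BT u n) : rep u (n + 1) (incl u n y) = rep u n y := by
  obtain ⟨a, rfl⟩ : ∃ a, mk u n a = y := RingQuot.mkAlgHom_surjective F (Rel u n) y
  rw [incl_mk, rep_mk, rep_mk]
  have h : (FreeAlgebra.lift F (opGen u (n + 1))).comp (freeIncl F n) =
      FreeAlgebra.lift F (opGen u n) := by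
    refine FreeAlgebra.hom_ext (funext fun g => ?_)
    cases g <;> simp [freeIncl, genIncl, opGen]
  exact DFunLike.congr_fun h a

/-- The permutation of the places by which `T_m ⋯ T_k` acts on increasing configurations. -/
def descendingPerm : ℕ → ℕ → Equiv.Perm ℕ
  | 0, _ => 1
  | m + 1, k => if k ≤ m + 1 then Equiv.swap (m + 1) (m + 2) * descendingPerm m k else 1

theorem descendingPerm_of_lt {m k j : ℕ} (h : m + 1 < j) : descendingPerm m k j = j := by
  induction m with
  | zero => rfl
  | succ m ih =>
    rw [descendingPerm]
    split_ifs
    · rw [Equiv.Perm.mul_apply, ih (by omega),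
        Equiv.swap_apply_of_ne_of_ne (by omega) (by omega)]
    · rfl

theorem descendingPerm_self {m k : ℕ} (hk : 1 ≤ k) (hkm : k ≤ m + 1) :
    descendingPerm m k k = m + 1 := by
  induction m with
  | zero => simp [descendingPerm]; omega
  | succ m ih =>
    rw [descendingPerm]
    split_ifs with h
    · rw [Equiv.Perm.mul_apply, ih h, Equiv.swap_apply_left]
    · rw [Equiv.Perm.one_apply]; omega

/-- A particle of higher rank than those before it moves to the front without correction terms,
because all the weights for staying vanish. -/
theorem rep_descending {m k : ℕ} (hm : m < n) (φ : Config → F) (x : Config)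
    (hx : ∀ j ≤ m, (x j).1 < (x (m + 1)).1) :
    rep u n (descending u n m k) φ x = φ (fun j => x (descendingPerm m k j)) := by
  induction m generalizing x with
  | zero => simp [descending, descendingPerm]
  | succ m ih =>
    by_cases hk : k ≤ m + 1
    · have hlt := hx (m + 1) le_rfl
      have h1 : swapCoeff u (x (m + 1)) (x (m + 1 + 1)) = 1 := by simp [swapCoeff, hlt]
      have h0 : stayCoeff u (x (m + 1)) (x (m + 1 + 1)) = 0 := by simp [stayCoeff, hlt]
      rw [descending_succ hk, map_mul, rep_T (by omega) hm, Module.End.mul_apply, opT_apply, h1, h0,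
        one_mul, zero_mul, add_zero, ih (by omega)]
      · simp only [descendingPerm, hk, if_true, Equiv.Perm.mul_apply, exchange]
      · intro j hj
        rw [exchange_left, exchange_of_ne x (by omega) (by omega)]
        exact hx j (by omega)
    · rw [descending_of_lt (by omega)]
      simp [descendingPerm, hk]

/-- The permutation of the places by which the braid part of a Ryom-Hansen basis element acts on
increasing configurations. -/
def wordPerm : ∀ n : ℕ, (∀ i : Fin n, Fin ((i : ℕ) + 1)) → Equiv.Perm ℕ
  | 0, _ => 1
  | n + 1, k => wordPerm n (fun i => k i.castSucc) *
      if (k (Fin.last n) : ℕ) = 0 then 1 else descendingPerm n (k (Fin.last n))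

theorem wordPerm_of_lt {k : ∀ i : Fin n, Fin ((i : ℕ) + 1)} {j : ℕ} (h : n < j) :
    wordPerm n k j = j := by
  induction n with
  | zero => rfl
  | succ n ih =>
    rw [wordPerm, Equiv.Perm.mul_apply]
    split_ifs
    · exact ih (by omega)
    · rw [descendingPerm_of_lt h, ih (by omega)]

theorem wordPerm_le {k : ∀ i : Fin n, Fin ((i : ℕ) + 1)} {j : ℕ} (h : j ≤ n) :
    wordPerm n k j ≤ n := by
  by_contra! hlt
  have := (wordPerm n k).injective (wordPerm_of_lt (k := k) hlt)
  omega

theorem rep_braidWord (k : ∀ i : Fin n, Fin ((i : ℕ) + 1)) (φ : Config → F) (x : Config)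
    (hx : ∀ j, (x j).1 = j) :
    rep u n (braidWord u n k) φ x = φ (fun j => x (wordPerm n k j)) := by
  induction n generalizing φ with
  | zero => simp [braidWord, wordPerm]
  | succ n ih =>
    rw [braidWord_succ, map_mul, Module.End.mul_apply, rep_incl, ih, bigT, wordPerm]
    split_ifs with h
    · simp
    · rw [rep_descending (by omega)]
      · rfl
      · intro j hj
        rw [hx, hx, wordPerm_of_lt (Nat.lt_succ_self n)]
        exact Nat.lt_succ_of_le (wordPerm_le hj)

theorem wordPerm_injective (n : ℕ) : Function.Injective (wordPerm n) := by
  induction n with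
  | zero => intro k l _; funext i; exact i.elim0
  | succ n ih =>
    intro k l h
    -- the place of the particle `n + 1` determines the last index
    have hplace : ∀ k : ∀ i : Fin (n + 1), Fin ((i : ℕ) + 1), wordPerm (n + 1) k
        (if (k (Fin.last n) : ℕ) = 0 then n + 1 else k (Fin.last n)) = n + 1 := by
      intro k
      have hk : (k (Fin.last n) : ℕ) < n + 1 := (k (Fin.last n)).2
      rw [wordPerm, Equiv.Perm.mul_apply]
      split_ifs with h
      · exact wordPerm_of_lt (Nat.lt_succ_self n)
      · rw [descendingPerm_self (by omega) (by omega), wordPerm_of_lt (Nat.lt_succ_self n)]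
    have hlast : k (Fin.last n) = l (Fin.last n) := by
      have h1 := hplace k
      rw [h] at h1
      have h2 := (wordPerm (n + 1) l).injective (h1.trans (hplace l).symm)
      have hk : (k (Fin.last n) : ℕ) < n + 1 := (k (Fin.last n)).2
      have hl : (l (Fin.last n) : ℕ) < n + 1 := (l (Fin.last n)).2
      apply Fin.ext
      split_ifs at h2 <;> omega
    have hinit : (fun i : Fin n => k i.castSucc) = fun i : Fin n => l i.castSucc := by
      apply ih
      rw [wordPerm, wordPerm, hlast] at h
      exact mul_right_cancel h
    funext i
    induction i using Fin.lastCases with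
    | last => exact hlast
    | cast i => exact congrFun hinit i

/-- Colours on the places `1, …, n` which agree exactly on the blocks of `J`. -/
def partColour (J : Setoid (Fin n)) (j : ℕ) : ℕ :=
  if h : 1 ≤ j ∧ j ≤ n then ((Quotient.mk J ⟨j - 1, by omega⟩).out : ℕ) else 0

theorem partColour_eq_iff (J : Setoid (Fin n)) (a b : Fin n) :
    partColour J (a + 1) = partColour J (b + 1) ↔ J a b := by
  have h : ∀ a : Fin n, 1 ≤ (a : ℕ) + 1 ∧ (a : ℕ) + 1 ≤ n := fun a => by omega
  simp only [partColour, h, and_self, dite_true, Nat.add_sub_cancel, Fin.val_inj]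
  rw [← Quotient.eq (r := J)]
  exact ⟨fun h => by simpa using congrArg (Quotient.mk J) h, fun h => by rw [h]⟩

/-- The coefficients of a vanishing combination are recovered on increasing configurations: the
braid part is seen in the positions of the particles, and the partition by Möbius inversion over
the partitions into colours. -/
theorem linearIndependent_basisElt (hu : u ≠ 0) (n : ℕ) : LinearIndependent F (basisElt u n) := by
  classical
  rw [linearIndependent_iff]
  intro l hl
  have hfin : Finite (Setoid (Fin n)) :=
    Finite.of_injective (fun I : Setoid (Fin n) => {p : Fin n × Fin n | I p.1 p.2})
      fun I J h => Setoid.ext fun a b => by simpa using Set.ext_iff.1 h (a, b)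
  ext ⟨k, J⟩
  induction J using WellFoundedLT.induction with
  | _ J ih =>
  set x : Config := fun j => (j, partColour J ((wordPerm n k).symm j)) with hx
  set y : Config := fun j => x (wordPerm n k j) with hy
  have hyJ : colourPart n y = J := by
    ext a b
    change (y (a + 1)).2 = (y (b + 1)).2 ↔ _
    simp only [hy, hx, Equiv.symm_apply_apply]
    exact partColour_eq_iff J a b
  have hval : ∀ z : (∀ i : Fin n, Fin ((i : ℕ) + 1)) × Setoid (Fin n),
      rep u n (basisElt u n z) (Pi.single y 1) x = if z.1 = k ∧ z.2 ≤ J then 1 else 0 := by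
    rintro ⟨k', I⟩
    rw [basisElt, map_mul, Module.End.mul_apply, rep_braidWord k' _ x fun j => rfl,
      rep_tiePart hu]
    by_cases hk : k' = k
    · subst hk
      simp only [true_and]
      rw [← hy, hyJ, Pi.single_eq_same]
    · have hne : (fun j => x (wordPerm n k' j)) ≠ y := fun h => hk <| wordPerm_injective n <| by
        ext j
        exact congrArg Prod.fst (congrFun h j)
      rw [Pi.single_eq_of_ne hne, ite_self, if_neg fun h => hk h.1]
  have hsum : (rep u n (Finsupp.linearCombination F (basisElt u n) l)) (Pi.single y 1) x = 0 := by
    rw [hl]; simp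
  rw [Finsupp.linearCombination_apply, Finsupp.sum, map_sum, LinearMap.sum_apply,
    Finset.sum_apply] at hsum
  simp only [map_smul, LinearMap.smul_apply, Pi.smul_apply, hval, smul_eq_mul] at hsum
  rw [Finset.sum_eq_single (k, J)] at hsum
  · simpa using hsum
  · rintro ⟨k', I⟩ - hne
    by_cases h : k' = k ∧ I ≤ J
    · obtain ⟨rfl, hIJ⟩ := h
      have hlt : I < J := lt_of_le_of_ne hIJ fun h => hne (by rw [h])
      rw [ih I hlt]
      simp
    · simp only [if_neg h, mul_zero]
  · intro h
    rw [Finsupp.notMem_support_iff.1 h, zero_mul]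

/-! ### The relative traces -/

/-- The linear map with the prescribed values on the Ryom-Hansen basis. -/
def relTrace (hu : u ≠ 0) (A B : F) (n : ℕ) : BT u (n + 1) →ₗ[F] BT u n :=
  (Module.Basis.mk (linearIndependent_basisElt hu (n + 1)) (span_basisElt hu (n + 1)).ge).constr F
    (relTraceValue u n A B)

theorem relTrace_basisElt (hu : u ≠ 0) (A B : F) (n : ℕ)
    (x : (∀ i : Fin (n + 1), Fin ((i : ℕ) + 1)) × Setoid (Fin (n + 1))) :
    relTrace hu A B n (basisElt u (n + 1) x) = relTraceValue u n A B x := by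
  have h := (Module.Basis.mk (linearIndependent_basisElt hu (n + 1))
    (span_basisElt hu (n + 1)).ge).constr_basis F (relTraceValue u n A B) x
  rwa [Module.Basis.mk_apply] at h

theorem basisElt_induction (hu : u ≠ 0) {P : BT u n → Prop}
    (hb : ∀ (k : ∀ i : Fin n, Fin ((i : ℕ) + 1)) (I : Setoid (Fin n)),
      P (braidWord u n k * tiePart u n I))
    (hadd : ∀ x y, P x → P y → P (x + y)) (hsmul : ∀ (c : F) x, P x → P (c • x))
    (x : BT u n) : P x := by
  have hx : x ∈ Submodule.span F (Set.range (basisElt u n)) :=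
    span_basisElt hu n ▸ Submodule.mem_top
  induction hx using Submodule.span_induction with
  | mem x hx => obtain ⟨z, rfl⟩ := hx; exact hb z.1 z.2
  | zero => simpa using hsmul 0 _ (hb (fun _ => 0) ⊥)
  | add x y _ _ h1 h2 => exact hadd x y h1 h2
  | smul c x _ h => exact hsmul c x h

section Values

variable (hu : u ≠ 0) (A B : F)

theorem relTrace_incl (x : BT u n) : relTrace hu A B n (incl u n x) = x := by
  induction x using basisElt_induction hu with
  | hb k I =>
    rw [map_mul, ← braidWord_snocIndex_zero, ← tiePart_addSingleton hu]
    refine (relTrace_basisElt hu A B n (snocIndex k 0, addSingleton I)).trans ?_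
    simp only [relTraceValue, snocIndex_last, snocIndex_castSucc, Fin.val_zero, dite_true,
      if_neg (not_inSupp_addSingleton I), removeLast_addSingleton]
  | hadd x y hx hy =>
    rw [map_add, map_add, hx, hy]
  | hsmul c x hx =>
    rw [map_smul, map_smul, hx]

theorem relTrace_incl_mul_et {j : ℕ} (hj : 1 ≤ j) (hjn : j ≤ n) (x : BT u n) :
    relTrace hu A B n (incl u n x * et u (n + 1) j (n + 1)) = B • x := by
  obtain ⟨j, rfl⟩ : ∃ j', j = j' + 1 := ⟨j - 1, by omega⟩
  induction x using basisElt_induction hu with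
  | hb k I =>
    rw [map_mul (incl u n), ← braidWord_snocIndex_zero, mul_assoc, ← tiePart_addToBlock hu I ⟨j, by omega⟩]
    refine (relTrace_basisElt hu A B n (snocIndex k 0, addToBlock I ⟨j, by omega⟩)).trans ?_
    simp only [relTraceValue, snocIndex_last, snocIndex_castSucc, Fin.val_zero, dite_true,
      if_pos (inSupp_addToBlock I _), removeLast_addToBlock]
  | hadd x y hx hy =>
    rw [map_add, add_mul, map_add, hx, hy, smul_add]
  | hsmul c x hx =>
    rw [map_smul, smul_mul_assoc, map_smul, hx, smul_comm]

theorem relTrace_descending {l : ℕ} (hl : 1 ≤ l) (hln : l ≤ n)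
    (k : ∀ i : Fin n, Fin ((i : ℕ) + 1)) (I : Setoid (Fin n)) :
    relTrace hu A B n (incl u n (braidWord u n k) * descending u (n + 1) n l *
      incl u n (tiePart u n I)) =
    A • (braidWord u n k * descending u n (n - 1) l * tiePart u n I) := by
  have h0 : l ≠ 0 := by omega
  have hm := removeLast_merge_addSingleton I ⟨l - 1, by omega⟩
  rw [← braidWord_snocIndex_of_pos k hl (by omega), ← tiePart_addSingleton hu]
  refine (relTrace_basisElt hu A B n (snocIndex k ⟨l, by omega⟩, addSingleton I)).trans ?_
  simp only [Fin.castSucc_mk] at hm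
  simp only [relTraceValue, snocIndex_last, snocIndex_castSucc, dif_neg h0, hm]

theorem relTrace_descending_et {l j : ℕ} (hl : 1 ≤ l) (hln : l ≤ n) (hj : 1 ≤ j) (hjn : j ≤ n)
    (k : ∀ i : Fin n, Fin ((i : ℕ) + 1)) (I : Setoid (Fin n)) :
    relTrace hu A B n (incl u n (braidWord u n k) * descending u (n + 1) n l *
      (incl u n (tiePart u n I) * et u (n + 1) j (n + 1))) =
    A • (braidWord u n k * descending u n (n - 1) l * (tiePart u n I * et u n j l)) := by
  have h0 : l ≠ 0 := by omega
  obtain ⟨j, rfl⟩ : ∃ j', j = j' + 1 := ⟨j - 1, by omega⟩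
  have hm := removeLast_merge_addToBlock I ⟨j, by omega⟩ ⟨l - 1, by omega⟩
  have ht := tiePart_mul_et_eq hu I ⟨j, by omega⟩ ⟨l - 1, by omega⟩
  simp only [Nat.sub_add_cancel hl] at ht
  rw [← braidWord_snocIndex_of_pos k hl (by omega), ← tiePart_addToBlock hu I ⟨j, by omega⟩, ht]
  refine (relTrace_basisElt hu A B n (snocIndex k ⟨l, by omega⟩, addToBlock I _)).trans ?_
  simp only [Fin.castSucc_mk] at hm
  simp only [relTraceValue, snocIndex_last, snocIndex_castSucc, dif_neg h0, hm]

end Values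

/-- A tie with the strand `n + 1` which is moved to the right through a braid word on the first `n`
strands remains a tie with the strand `n + 1`. -/
theorem exists_et_mul_braidWord (hu : u ≠ 0) (k : ∀ i : Fin n, Fin ((i : ℕ) + 1)) {a : ℕ}
    (ha : 1 ≤ a) (han : a ≤ n) : ∃ b, 1 ≤ b ∧ b ≤ n ∧
      et u (n + 1) a (n + 1) * incl u n (braidWord u n k) =
        incl u n (braidWord u n k) * et u (n + 1) b (n + 1) := by
  let Q : BT u n → Prop := fun y => ∀ a, 1 ≤ a → a ≤ n → ∃ b, 1 ≤ b ∧ b ≤ n ∧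
    et u (n + 1) a (n + 1) * incl u n y = incl u n y * et u (n + 1) b (n + 1)
  have hmul : ∀ y z, Q y → Q z → Q (y * z) := fun y z hy hz a ha han => by
    obtain ⟨b, hb, hbn, h⟩ := hy a ha han
    obtain ⟨c, hc, hcn, h'⟩ := hz b hb hbn
    exact ⟨c, hc, hcn, by rw [map_mul, ← mul_assoc, h, mul_assoc, h', mul_assoc]⟩
  have hone : Q 1 := fun a ha han => ⟨a, ha, han, by simp⟩
  have hdesc : ∀ m k, 1 ≤ k → m < n → Q (descending u n m k) := fun m k hk hm a ha han => by
    by_cases hkm : k ≤ m + 1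
    · obtain ⟨h1, h2⟩ := cycle_mem hk hkm hm ha han
      refine ⟨_, h1, h2, ?_⟩
      rw [incl_descending hm, et_mul_descending hu hk hkm (by omega) ha (by omega) (by omega)
        le_rfl, cycle_of_lt (by omega : m + 1 < n + 1)]
    · rw [descending_of_lt (by omega)]
      exact hone a ha han
  have hword : Q (braidWord u n k) := by
    refine List.prod_induction Q hmul hone fun y hy => ?_
    obtain ⟨i, rfl⟩ := List.mem_ofFn.1 hy
    unfold bigT
    split_ifs
    · exact hone
    · exact hdesc i _ (by omega) i.2
  exact hword a ha han

section Bimodule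

variable (hu : u ≠ 0) (A B : F)

theorem relTrace_incl_mul_E_mul_incl (hn : 1 ≤ n) (x y : BT u n) :
    relTrace hu A B n (incl u n x * E u (n + 1) n * incl u n y) = B • (x * y) := by
  induction y using basisElt_induction hu with
  | hb k I =>
    obtain ⟨b, hb, hbn, h⟩ := exists_et_mul_braidWord (u := u) hu k hn le_rfl
    rw [← et_succ, mul_assoc, map_mul (incl u n), ← mul_assoc (et _ _ _ _), h, mul_assoc _ (et _ _ _ _),
      (commute_et_incl_tiePart hu hb (by omega) (by omega) le_rfl I).eq, ← mul_assoc, ← mul_assoc,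
      ← map_mul, ← map_mul, relTrace_incl_mul_et hu A B hb hbn, mul_assoc]
  | hadd y z hy hz =>
    rw [map_add, mul_add, map_add, hy, hz, mul_add, smul_add]
  | hsmul c y hy =>
    rw [map_smul, mul_smul_comm, map_smul, hy, mul_smul_comm, smul_comm]

/-- Induction along the spanning products `x (T_n ⋯ T_k) E_I`, bracketed so that the factor `x`
from fewer strands splits off. -/
theorem incl_descending_induction (hu : u ≠ 0) {P : BT u (n + 1) → Prop}
    (hb : ∀ (x : BT u n) (k : ℕ) (I : Setoid (Fin (n + 1))), 1 ≤ k → k ≤ n + 1 →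
      P (incl u n x * (descending u (n + 1) n k * tiePart u (n + 1) I)))
    (hadd : ∀ x y, P x → P y → P (x + y)) (hsmul : ∀ (c : F) x, P x → P (c • x))
    (y : BT u (n + 1)) : P y := by
  induction mem_span_incl_descending_tiePart hu y using Submodule.span_induction with
  | mem y hy => obtain ⟨x, k, I, h1, h2, rfl⟩ := hy; rw [mul_assoc]; exact hb x k I h1 h2
  | zero => simpa using hsmul 0 _ (hb 0 1 ⊥ le_rfl (by omega))
  | add x y _ _ h1 h2 => exact hadd x y h1 h2
  | smul c x _ h => exact hsmul c x h

theorem relTrace_braidWord_mul_T_mul (k : ∀ i : Fin (n + 1), Fin ((i : ℕ) + 1)) {l : ℕ}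
    (hl : 1 ≤ l) (hln : l ≤ n + 1) (I J : Setoid (Fin (n + 1))) :
    relTrace hu A B (n + 1) (incl u (n + 1) (braidWord u (n + 1) k * tiePart u (n + 1) I) *
        T u (n + 2) (n + 1) *
        incl u (n + 1) (descending u (n + 1) n l * tiePart u (n + 1) J)) =
      A • (braidWord u (n + 1) k * tiePart u (n + 1) I *
        (descending u (n + 1) n l * tiePart u (n + 1) J)) := by
  have hd : T u (n + 2) (n + 1) * incl u (n + 1) (descending u (n + 1) n l) =
      descending u (n + 2) (n + 1) l := by
    rw [incl_descending (by omega), descending_succ hln]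
  have hpull : ∀ K : Setoid (Fin n), ∃ J', incl u n (tiePart u n K) *
      (descending u (n + 1) n l * tiePart u (n + 1) J) =
      descending u (n + 1) n l * tiePart u (n + 1) J' := by
    intro K
    obtain ⟨K', hK'⟩ := exists_tiePart_mul_descending (u := u) (n := n + 1) hu hl hln (by omega)
      (addSingleton K)
    obtain ⟨J', hJ'⟩ := tiePart_mul_tiePart (u := u) hu K' J
    exact ⟨J', by rw [← tiePart_addSingleton hu, ← mul_assoc, hK', mul_assoc, hJ']⟩
  obtain ⟨K, hI | ⟨j, hj, hjn, hI⟩⟩ := exists_tiePart_eq hu I <;> obtain ⟨J', hJ'⟩ := hpull K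
  · have h := relTrace_descending hu A B hl hln k J'
    rw [Nat.add_sub_cancel, mul_assoc, mul_assoc, ← hd, mul_assoc, ← map_mul, ← hJ'] at h
    rw [hI, map_mul (incl u (n + 1)) (braidWord _ _ _), mul_assoc, mul_assoc,
      ← mul_assoc (incl u (n + 1) (incl u n _)),
      ← (commute_T_incl_incl _).eq, mul_assoc (T u _ _), ← map_mul, h, mul_assoc]
  · -- `E_{j,n+1} T_{n+1} = T_{n+1} E_{j,n+2}`
    have h := relTrace_descending_et hu A B hl hln
      (cycle_mem (n := n + 1) hl hln (by omega) hj (by omega)).1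
      (cycle_mem (n := n + 1) hl hln (by omega) hj (by omega)).2 k J'
    have hT := et_mul_T (u := u) (n := n + 2) (k := n + 1) (a := j) (b := n + 1) hu (by omega)
      (by omega) hj (by omega) (by omega) (by omega)
    rw [Equiv.swap_apply_of_ne_of_ne (by omega) (by omega), Equiv.swap_apply_left] at hT
    have h1 := et_mul_descending (u := u) (n := n + 1) (m := n) (k := l) (a := j) (b := n + 1) hu hl
      hln (by omega) hj (by omega) (by omega) le_rfl
    rw [cycle_last hln] at h1
    have h2 := et_mul_descending (u := u) (n := n + 2) (m := n) (k := l) (a := j) (b := n + 2) hu hl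
      hln (by omega) hj (by omega) (by omega) le_rfl
    rw [cycle_of_lt (by omega : n + 1 < n + 2)] at h2
    have hcyc := cycle_mem (n := n + 1) (a := j) hl hln (by omega) hj (by omega)
    -- the left-hand side is brought to the form of `relTrace_descending_et`
    have e1 : incl u (n + 1) (braidWord u (n + 1) k * tiePart u (n + 1) I) * T u (n + 2) (n + 1) *
        incl u (n + 1) (descending u (n + 1) n l * tiePart u (n + 1) J) =
        incl u (n + 1) (braidWord u (n + 1) k) * descending u (n + 2) (n + 1) l *
          (incl u (n + 1) (tiePart u (n + 1) J') * et u (n + 2) (cycle n l j) (n + 2)) := by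
      calc _ = incl u (n + 1) (braidWord u (n + 1) k) *
            ((incl u (n + 1) (incl u n (tiePart u n K)) * et u (n + 2) j (n + 1)) *
              T u (n + 2) (n + 1)) *
            incl u (n + 1) (descending u (n + 1) n l * tiePart u (n + 1) J) := by
            rw [hI, map_mul, map_mul, incl_et hu hj (by omega) (by omega) le_rfl]
            simp only [mul_assoc]
        _ = incl u (n + 1) (braidWord u (n + 1) k) * (T u (n + 2) (n + 1) *
            (et u (n + 2) j (n + 2) * incl u (n + 1) (incl u n (tiePart u n K) *
              (descending u (n + 1) n l * tiePart u (n + 1) J)))) := by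
            rw [mul_assoc (incl u (n + 1) (incl u n _)), hT, ← mul_assoc (incl u (n + 1) _) (T u _ _),
              ← (commute_T_incl_incl _).eq, ← tiePart_addSingleton hu, mul_assoc (T u _ _),
              ← (commute_et_incl_tiePart hu hj (by omega) (by omega) le_rfl _).eq,
              map_mul (incl u (n + 1)) (tiePart _ _ _)]
            simp only [mul_assoc]
        _ = _ := by
            rw [hJ', map_mul, ← mul_assoc (et _ _ _ _), incl_descending (by omega), h2,
              descending_succ hln, mul_assoc _ (et u _ _ _),
              (commute_et_incl_tiePart hu hcyc.1 (by omega) (by omega) le_rfl _).eq]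
            simp only [mul_assoc]
    rw [e1, h, Nat.add_sub_cancel, hI]
    congr 1
    rw [(commute_et_incl_tiePart hu hj (by omega) (by omega) le_rfl K).symm.eq,
      mul_assoc, mul_assoc, mul_assoc, hJ', ← mul_assoc (et _ _ _ _), h1, mul_assoc _ (et _ _ _ _),
      (commute_et_tiePart hu hcyc.1 hcyc.2 hl hln _).eq]

/-- Moving the factor of `y` from the algebra on `n` strands to the other side of `T_{n+1}` leaves
`T_{n+1}` next to a descending product, which it extends to a factor of a basis element. -/
theorem relTrace_incl_mul_T_mul_incl (x y : BT u (n + 1)) :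
    relTrace hu A B (n + 1) (incl u (n + 1) x * T u (n + 2) (n + 1) * incl u (n + 1) y) =
      A • (x * y) := by
  induction y using incl_descending_induction hu with
  | hb x' l J hl hln =>
    rw [map_mul (incl u (n + 1)) (incl u n x'), mul_assoc, ← mul_assoc (T u _ _),
      (commute_T_incl_incl _).eq, mul_assoc _ (T u _ _), ← mul_assoc, ← map_mul, ← mul_assoc x,
      ← mul_assoc]
    generalize x * incl u n x' = z
    induction z using basisElt_induction hu with
    | hb k I =>
      exact relTrace_braidWord_mul_T_mul hu A B k hl hln I J
    | hadd y z hy hz =>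
      simp only [map_add, add_mul, hy, hz, smul_add]
    | hsmul c y hy =>
      rw [map_smul, smul_mul_assoc, smul_mul_assoc, map_smul, hy, smul_mul_assoc, smul_comm]
  | hadd y z hy hz =>
    simp only [map_add, mul_add, hy, hz, smul_add]
  | hsmul c y hy =>
    rw [map_smul, mul_smul_comm, map_smul, hy, mul_smul_comm, smul_comm]

theorem relTrace_incl_mul_ET_mul_incl (x y : BT u (n + 1)) :
    relTrace hu A B (n + 1)
        (incl u (n + 1) x * (E u (n + 2) (n + 1) * T u (n + 2) (n + 1)) * incl u (n + 1) y) =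
      A • (x * y) := by
  have hcom : ∀ z : BT u n, Commute (E u (n + 2) (n + 1) * T u (n + 2) (n + 1))
      (incl u (n + 1) (incl u n z)) := fun z =>
    (commute_E_incl_incl z).mul_left (commute_T_incl_incl z)
  induction y using incl_descending_induction hu with
  | hb x' l J hl hln =>
    rw [map_mul (incl u (n + 1)) (incl u n x'), mul_assoc, ← mul_assoc (E u _ _ * T u _ _),
      (hcom _).eq, mul_assoc _ (E u _ _ * T u _ _), ← mul_assoc, ← map_mul, ← mul_assoc x]
    generalize x * incl u n x' = z
    induction z using basisElt_induction hu with
    | hb k I =>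
      -- `E_{n+1} T_{n+1}` commutes with all ties of the first `n + 1` strands
      have hcom' : Commute (E u (n + 2) (n + 1) * T u (n + 2) (n + 1))
          (incl u (n + 1) (tiePart u (n + 1) I)) := by
        obtain ⟨K, hI | ⟨j, hj, hjn, hI⟩⟩ := exists_tiePart_eq hu I
        · rw [hI]; exact hcom _
        · rw [hI, map_mul, incl_et hu hj (by omega) (by omega) le_rfl]
          refine (hcom _).mul_right ?_
          have hT := et_mul_T (u := u) (n := n + 2) (k := n + 1) (a := j) (b := n + 1) hu (by omega)
            (by omega) hj (by omega) (by omega) (by omega)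
          rw [Equiv.swap_apply_of_ne_of_ne (by omega) (by omega), Equiv.swap_apply_left] at hT
          have h3 := et_mul_et_mul_et (u := u) (n := n + 2) (a := j) (b := n + 1) (c := n + 2) hu hj
            (by omega) (by omega) (by omega) (by omega) le_rfl
          have h4 := et_mul_et_mul_et (u := u) (n := n + 2) (a := j) (b := n + 2) (c := n + 1) hu hj
            (by omega) (by omega) (by omega) (by omega) (by omega)
          have c1 : Commute (et u (n + 2) j (n + 1)) (et u (n + 2) j (n + 2)) :=
            commute_et_et hu hj (by omega) (by omega) (by omega) hj (by omega) (by omega) le_rfl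
          have c2 : Commute (et u (n + 2) j (n + 1)) (et u (n + 2) (n + 1) (n + 2)) :=
            commute_et_et hu hj (by omega) (by omega) (by omega) (by omega) (by omega) (by omega)
              le_rfl
          have c3 : Commute (et u (n + 2) j (n + 2)) (et u (n + 2) (n + 1) (n + 2)) :=
            commute_et_et hu hj (by omega) (by omega) (by omega) (by omega) (by omega) (by omega)
              le_rfl
          have key : et u (n + 2) j (n + 2) * et u (n + 2) (n + 1) (n + 2) =
              et u (n + 2) j (n + 1) * et u (n + 2) (n + 1) (n + 2) := by
            rw [et_symm (n + 2) (n + 1)] at h4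
            rw [← h3, ← h4, mul_assoc, mul_assoc, c2.symm.eq, c3.symm.eq, ← mul_assoc, ← mul_assoc,
              c1.eq]
          have hE : E u (n + 2) (n + 1) = et u (n + 2) (n + 1) (n + 2) := (et_succ _).symm
          change _ * _ = _ * _
          rw [E_mul_T (by omega) (by omega), hE, mul_assoc, ← c2.eq, ← key, ← mul_assoc _ (T u _ _),
            hT, mul_assoc]
      obtain ⟨J', hJ'⟩ : ∃ J', tiePart u (n + 1) I *
          (descending u (n + 1) n l * tiePart u (n + 1) J) =
          descending u (n + 1) n l * tiePart u (n + 1) J' := by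
        obtain ⟨K', hK'⟩ := exists_tiePart_mul_descending (u := u) (n := n + 1) hu hl hln (by omega) I
        obtain ⟨J', hJ'⟩ := tiePart_mul_tiePart (u := u) hu K' J
        exact ⟨J', by rw [← mul_assoc, hK', mul_assoc, hJ']⟩
      have h2 := et_mul_descending (u := u) (n := n + 2) (m := n) (k := l) (a := n + 1) (b := n + 2)
        hu hl hln (by omega) (by omega) (by omega) (by omega) le_rfl
      rw [cycle_of_lt (by omega : n + 1 < n + 2), cycle_last hln] at h2
      have h := relTrace_descending_et hu A B hl hln hl hln k J'
      rw [et_self, mul_one, Nat.add_sub_cancel] at h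
      rw [map_mul (incl u (n + 1)) (braidWord _ _ _), mul_assoc (incl u (n + 1) (braidWord _ _ _)),
        ← mul_assoc (incl u (n + 1) (tiePart u (n + 1) I)) (E u _ _ * T u _ _), ← hcom'.eq,
        mul_assoc (E u _ _ * T u _ _), ← map_mul (incl u (n + 1)) (tiePart _ _ _), hJ',
        mul_assoc (braidWord _ _ _), hJ', ← mul_assoc (braidWord _ _ _), ← h]
      congr 1
      rw [E_mul_T (by omega) (by omega), ← et_succ, map_mul, incl_descending (by omega),
        mul_assoc (T u _ _), ← mul_assoc (et _ _ _ _), h2, descending_succ hln,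
        mul_assoc (descending _ _ _ _),
        (commute_et_incl_tiePart hu hl (by omega) (by omega) le_rfl _).eq]
      simp only [mul_assoc]
    | hadd y z hy hz =>
      simp only [map_add, add_mul, hy, hz, smul_add]
    | hsmul c y hy =>
      rw [map_smul, smul_mul_assoc, smul_mul_assoc, map_smul, hy, smul_comm]
  | hadd y z hy hz =>
    simp only [map_add, mul_add, hy, hz, smul_add]
  | hsmul c y hy =>
    rw [map_smul, mul_smul_comm, map_smul, hy, mul_smul_comm, smul_comm]

end Bimodule

/-! ### Identities on three strands -/

/-- The relations between the generators `t = T_{i+1}`, `e = E_{i+1}`, `p = T_i`, `q = E_i`, and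
a left inverse `p'` of `p`. -/
structure Consecutive {R : Type*} [Ring R] [Algebra F R] (u : F) (t e p q p' : R) : Prop where
  t_sq : t * t = 1 + (u - 1) • (e + e * t)
  e_sq : e * e = e
  e_t : e * t = t * e
  p_sq : p * p = 1 + (u - 1) • (q + q * p)
  q_p : q * p = p * q
  e_q : e * q = q * e
  braid : t * p * t = p * t * p
  e_q_t : e * q * t = t * e * q
  q_e_p : q * e * p = p * q * e
  p_q_e : p * q * e = e * p * e
  e_p_t : e * p * t = p * t * q
  q_t_p : q * t * p = t * p * e
  inv_mul : p' * p = 1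

namespace Consecutive

variable {R : Type*} [Ring R] [Algebra F R] {t e p q p' : R}

theorem e_t_t (h : Consecutive u t e p q p') : e * t * t = u • e + (u - 1) • (e * t) := by
  rw [mul_assoc, h.t_sq, mul_add, mul_smul_comm, mul_add, ← mul_assoc, h.e_sq, mul_one]
  module

theorem eqe (h : Consecutive u t e p q p') : e * q * e = q * e * 1 := by
  linear_combination (norm := noncomm_ring) h.e_q * e + q * h.e_sq

theorem epe (h : Consecutive u t e p q p') : e * p * e = p * q * e * 1 := by
  rw [mul_one, h.p_q_e]

theorem eqpe (h : Consecutive u t e p q p') : e * (q * p) * e = p * q * e * 1 := by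
  linear_combination (norm := noncomm_ring) h.e_q * p * e + h.q_e_p * e + p * q * h.e_sq

theorem eqt (h : Consecutive u t e p q p') : e * q * t = q * (e * t) * 1 := by
  linear_combination (norm := noncomm_ring) h.e_q * t

theorem ept (h : Consecutive u t e p q p') : e * p * t = p * t * q := by
  exact h.e_p_t

theorem eqpt (h : Consecutive u t e p q p') : e * (q * p) * t = q * p * t * q := by
  linear_combination (norm := noncomm_ring) h.e_q * p * t + q * h.e_p_t

theorem tqe (h : Consecutive u t e p q p') : t * q * e = q * (e * t) * 1 := by
  linear_combination (norm := noncomm_ring) -t * h.e_q - h.e_q_t + h.e_q * t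

theorem tpe (h : Consecutive u t e p q p') : t * p * e = q * t * p := by
  exact h.q_t_p.symm

theorem tqpe (h : Consecutive u t e p q p') : t * (q * p) * e = q * t * (p * q) := by
  linear_combination (norm := noncomm_ring) t * h.q_p * e - t * p * h.e_q + h.tpe * q

theorem eqet (h : Consecutive u t e p q p') : e * q * (e * t) = q * (e * t) * 1 := by
  linear_combination (norm := noncomm_ring) h.eqe * t

theorem epet (h : Consecutive u t e p q p') : e * p * (e * t) = p * q * (e * t) * 1 := by
  linear_combination (norm := noncomm_ring) h.epe * t

theorem eqpet (h : Consecutive u t e p q p') : e * (q * p) * (e * t) = p * q * (e * t) * 1 := by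
  linear_combination (norm := noncomm_ring) h.eqpe * t

theorem etqe (h : Consecutive u t e p q p') : e * t * q * e = q * (e * t) * 1 := by
  linear_combination (norm := noncomm_ring) e * h.tqe + h.e_q * e * t + q * h.e_sq * t

theorem etpe (h : Consecutive u t e p q p') : e * t * p * e = q * t * (p * q) := by
  linear_combination (norm := noncomm_ring) h.e_t * p * e - t * h.p_q_e - t * p * h.e_q + h.tpe * q

theorem etqpe (h : Consecutive u t e p q p') : e * t * (q * p) * e = q * t * (p * q) := by
  linear_combination (norm := noncomm_ring) h.e_t * (q * p) * e + t * h.eqpe - t * p * h.e_q + h.tpe * q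

theorem tq (h : Consecutive u t e p q p') : t * q = p' * e * p * t := by
  rw [mul_assoc, mul_assoc, ← mul_assoc e, h.e_p_t, ← mul_assoc, ← mul_assoc, h.inv_mul, one_mul]

theorem p'epe (h : Consecutive u t e p q p') : p' * e * p * e = q * e := by
  rw [mul_assoc, mul_assoc, ← mul_assoc e, ← h.p_q_e, ← mul_assoc, ← mul_assoc, h.inv_mul, one_mul]

theorem tqt (h : Consecutive u t e p q p') :
    t * q * t = p' * e * p + (u - 1) • (q * e * 1 + q * (e * t) * 1) := by
  rw [h.tq, mul_assoc, h.t_sq, mul_add, mul_one, mul_smul_comm, mul_add, ← mul_assoc _ e t, h.p'epe,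
    mul_one, mul_one, mul_assoc q]

theorem tpt (h : Consecutive u t e p q p') : t * p * t = p * t * p := h.braid

theorem tqpt (h : Consecutive u t e p q p') : t * (q * p) * t =
    p' * (e * t) * p + (u - 1) • (p' * q * (e * t) * p + q * (e * t) * p) := by
  have h1 : t * (q * p) * t = p' * e * (p * p) * t * p := by
    linear_combination (norm := noncomm_ring) h.tq * p * t + p' * e * p * h.braid
  have h2 : p' * e * (q * p) = q * e := by
    rw [mul_assoc, ← mul_assoc e, h.e_q, h.q_e_p, ← mul_assoc, ← mul_assoc, h.inv_mul, one_mul]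
  rw [h1, h.p_sq, mul_add, mul_smul_comm, mul_add, h2, mul_assoc p' e q, h.e_q]
  simp only [add_mul, smul_mul_assoc, mul_one, mul_assoc]

theorem tqet (h : Consecutive u t e p q p') : t * q * (e * t) =
    u • (q * e * 1) + (u - 1) • (q * (e * t) * 1) := by
  rw [← mul_assoc, h.tqe, mul_one, mul_assoc, h.e_t_t, mul_add, mul_smul_comm, mul_smul_comm,
    mul_one]

theorem etqt (h : Consecutive u t e p q p') : e * t * q * t =
    u • (q * e * 1) + (u - 1) • (q * (e * t) * 1) := by
  rw [← h.tqet]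
  linear_combination (norm := noncomm_ring) h.e_t * q * t + t * h.e_q * t

theorem etqet (h : Consecutive u t e p q p') : e * t * q * (e * t) =
    u • (q * e * 1) + (u - 1) • (q * (e * t) * 1) := by
  rw [← h.tqet]
  linear_combination (norm := noncomm_ring)
    h.e_t * q * e * t + t * h.e_q * e * t + t * q * h.e_sq * t

theorem tpet (h : Consecutive u t e p q p') : t * p * (e * t) = q * p * t * p := by
  linear_combination (norm := noncomm_ring) h.tpe * t + q * h.braid

theorem etpt (h : Consecutive u t e p q p') : e * t * p * t = p * t * (q * p) := by
  linear_combination (norm := noncomm_ring) e * h.braid + h.e_p_t * p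

theorem etpet (h : Consecutive u t e p q p') : e * t * p * (e * t) = q * p * t * (q * p) := by
  linear_combination (norm := noncomm_ring)
    e * h.tpe * t + e * q * h.braid + h.e_q * p * t * p + q * h.e_p_t * p

theorem tqpet (h : Consecutive u t e p q p') : t * (q * p) * (e * t) = p * q * t * (p * q) := by
  linear_combination (norm := noncomm_ring)
    t * h.q_p * e * t - t * p * h.tqe + h.braid * q * e - p * t * h.q_p * e + p * h.tqpe

theorem etqpt (h : Consecutive u t e p q p') : e * t * (q * p) * t = q * p * t * (q * p) := by
  linear_combination (norm := noncomm_ring)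
    (h.e_t * q - h.e_q_t + h.e_q * t) * p * t + q * e * h.braid + q * h.e_p_t * p

theorem etqpet (h : Consecutive u t e p q p') : e * t * (q * p) * (e * t) = q * p * q * t * (p * q) := by
  linear_combination (norm := noncomm_ring)
    e * t * q * p * h.e_t + h.etqpt * e + q * p * h.tqpe

end Consecutive

theorem consecutive (hu : u ≠ 0) (n : ℕ) :
    Consecutive u (T u (n + 3) (n + 2)) (E u (n + 3) (n + 2))
      (incl u (n + 2) (T u (n + 2) (n + 1))) (incl u (n + 2) (E u (n + 2) (n + 1)))
      (incl u (n + 2) (Ring.inverse (T u (n + 2) (n + 1)))) := by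
  have hT := isUnit_T (n := n + 2) (i := n + 1) hu (by omega) (by omega)
  have h1 : 1 ≤ n + 1 := by omega
  have h2 : 1 ≤ n + 2 := by omega
  have h3 : n + 1 < n + 3 := by omega
  have h4 : n + 2 < n + 3 := by omega
  have near : Near (n + 2) (n + 1) := Or.inr rfl
  have near' : Near (n + 1) (n + 2) := Or.inl rfl
  have hinv : incl u (n + 2) (Ring.inverse (T u (n + 2) (n + 1))) * T u (n + 3) (n + 1) = 1 := by
    rw [← incl_T (n := n + 2) h1 (by omega), ← map_mul, Ring.inverse_mul_cancel _ hT, map_one]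
  rw [incl_T h1 (by omega), incl_E h1 (by omega)]
  exact
    { t_sq := T_mul_self h2 h4
      e_sq := E_mul_self h2 h4
      e_t := E_mul_T h2 h4
      p_sq := T_mul_self h1 h3
      q_p := E_mul_T h1 h3
      e_q := E_comm h2 h4 h1 h3
      braid := T_braid h2 h4 h1 h3 near
      e_q_t := E_mul_E_mul_T h2 h4 h1 h3 near
      q_e_p := E_mul_E_mul_T h1 h3 h2 h4 near'
      p_q_e := T_mul_E_mul_E h1 h3 h2 h4 near'
      e_p_t := E_mul_T_mul_T h2 h4 h1 h3 near
      q_t_p := E_mul_T_mul_T h1 h3 h2 h4 near'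
      inv_mul := hinv }

/-! ### The algebra as a bimodule over the previous one -/

/-- The elements `1`, `E`, `T` and `E T` for the last generators `T`, `E` of an algebra. -/
def lastProducts (u : F) (n : ℕ) : Set (BT u (n + 2)) :=
  {1, E u (n + 2) (n + 1), T u (n + 2) (n + 1), E u (n + 2) (n + 1) * T u (n + 2) (n + 1)}

theorem commute_lastProducts_incl_incl {g : BT u (n + 2)} (hg : g ∈ lastProducts u n)
    (x : BT u n) : Commute g (incl u (n + 1) (incl u n x)) := by
  rcases hg with rfl | rfl | rfl | rfl
  · exact Commute.one_left _
  · exact commute_E_incl_incl x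
  · exact commute_T_incl_incl x
  · exact (commute_E_incl_incl x).mul_left (commute_T_incl_incl x)

/-- The bimodule over the algebra on `n + 1` strands generated by the last products. -/
def lastBimodule (u : F) (n : ℕ) : Submodule F (BT u (n + 2)) :=
  Submodule.span F {y | ∃ (x z : BT u (n + 1)), ∃ g ∈ lastProducts u n,
    y = incl u (n + 1) x * g * incl u (n + 1) z}

theorem mem_lastBimodule (x z : BT u (n + 1)) {g : BT u (n + 2)} (hg : g ∈ lastProducts u n) :
    incl u (n + 1) x * g * incl u (n + 1) z ∈ lastBimodule u n :=
  Submodule.subset_span ⟨x, z, g, hg, rfl⟩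

theorem lastBimodule_mul (x z : BT u (n + 1)) {y : BT u (n + 2)} (hy : y ∈ lastBimodule u n) :
    incl u (n + 1) x * y * incl u (n + 1) z ∈ lastBimodule u n := by
  induction hy using Submodule.span_induction with
  | mem y hy =>
    obtain ⟨x', z', g, hg, rfl⟩ := hy
    have h : incl u (n + 1) x * (incl u (n + 1) x' * g * incl u (n + 1) z') * incl u (n + 1) z =
        incl u (n + 1) (x * x') * g * incl u (n + 1) (z' * z) := by
      simp only [map_mul, mul_assoc]
    rw [h]
    exact mem_lastBimodule _ _ hg
  | zero => rw [mul_zero, zero_mul]; exact Submodule.zero_mem _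
  | add y z _ _ hy hz => rw [mul_add, add_mul]; exact Submodule.add_mem _ hy hz
  | smul c y _ hy => rw [mul_smul_comm, smul_mul_assoc]; exact Submodule.smul_mem _ c hy

theorem one_mem_lastProducts : (1 : BT u (n + 2)) ∈ lastProducts u n := Or.inl rfl

theorem E_mem_lastProducts : E u (n + 2) (n + 1) ∈ lastProducts u n := Or.inr (Or.inl rfl)

theorem T_mem_lastProducts : T u (n + 2) (n + 1) ∈ lastProducts u n :=
  Or.inr (Or.inr (Or.inl rfl))

theorem ET_mem_lastProducts : E u (n + 2) (n + 1) * T u (n + 2) (n + 1) ∈ lastProducts u n :=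
  Or.inr (Or.inr (Or.inr rfl))

theorem mem_lastBimodule_of_mem {g : BT u (n + 2)} (hg : g ∈ lastProducts u n) :
    g ∈ lastBimodule u n := by
  simpa using mem_lastBimodule 1 1 hg

theorem lastProducts_mul_E {g : BT u (n + 2)} (hg : g ∈ lastProducts u n) :
    g * E u (n + 2) (n + 1) ∈ lastProducts u n := by
  have hE := E_mul_self (u := u) (n := n + 2) (i := n + 1) (by omega) (by omega)
  have hET := E_mul_T (u := u) (n := n + 2) (i := n + 1) (by omega) (by omega)
  rcases hg with rfl | rfl | rfl | rfl
  · rw [one_mul]; exact E_mem_lastProducts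
  · rw [hE]; exact E_mem_lastProducts
  · rw [← hET]; exact ET_mem_lastProducts
  · rw [mul_assoc, ← hET, ← mul_assoc, hE]; exact ET_mem_lastProducts

theorem lastProducts_mul_T {g : BT u (n + 2)} (hg : g ∈ lastProducts u n) :
    g * T u (n + 2) (n + 1) ∈ lastBimodule u n := by
  have hE := E_mul_self (u := u) (n := n + 2) (i := n + 1) (by omega) (by omega)
  have hT := T_mul_self (u := u) (n := n + 2) (i := n + 1) (by omega) (by omega)
  have m1 := mem_lastBimodule_of_mem (one_mem_lastProducts (u := u) (n := n))
  have m2 := mem_lastBimodule_of_mem (E_mem_lastProducts (u := u) (n := n))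
  have m3 := mem_lastBimodule_of_mem (T_mem_lastProducts (u := u) (n := n))
  have m4 := mem_lastBimodule_of_mem (ET_mem_lastProducts (u := u) (n := n))
  rcases hg with rfl | rfl | rfl | rfl
  · rwa [one_mul]
  · exact m4
  · rw [hT]
    exact Submodule.add_mem _ m1 (Submodule.smul_mem _ _ (Submodule.add_mem _ m2 m4))
  · rw [mul_assoc, hT, mul_add, mul_one, mul_smul_comm, mul_add, ← mul_assoc, hE]
    exact Submodule.add_mem _ m2 (Submodule.smul_mem _ _ (Submodule.add_mem _ m2 m4))

theorem lastProducts_mul_incl_mul (hu : u ≠ 0) {g : BT u (n + 3)} {a : BT u (n + 2)}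
    (hg : g ∈ lastProducts u (n + 1)) (ha : a ∈ lastProducts u n) :
    g * incl u (n + 2) a * E u (n + 3) (n + 2) ∈ lastBimodule u (n + 1) ∧
      g * incl u (n + 2) a * T u (n + 3) (n + 2) ∈ lastBimodule u (n + 1) := by
  have h := consecutive (u := u) hu n
  have memE := fun x z => mem_lastBimodule x z (E_mem_lastProducts (u := u) (n := n + 1))
  have memT := fun x z => mem_lastBimodule x z (T_mem_lastProducts (u := u) (n := n + 1))
  have memET := fun x z => mem_lastBimodule x z (ET_mem_lastProducts (u := u) (n := n + 1))
  rcases ha with rfl | rfl | rfl | rfl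
  · rw [map_one, mul_one]
    exact ⟨mem_lastBimodule_of_mem (lastProducts_mul_E hg), lastProducts_mul_T hg⟩
  all_goals
    try rw [map_mul (incl u (n + 2))]
    rcases hg with rfl | rfl | rfl | rfl
  · constructor
    · simpa using memE (E u (n + 2) (n + 1)) 1
    · simpa using memT (E u (n + 2) (n + 1)) 1
  · rw [h.eqe, h.eqt, ← map_one (incl u (n + 2))]
    exact ⟨memE _ _, memET _ _⟩
  · rw [h.tqe, h.tqt, ← map_one (incl u (n + 2))]
    exact ⟨memET _ _, Submodule.add_mem _ (memE _ _)
      (Submodule.smul_mem _ _ (Submodule.add_mem _ (memE _ _) (memET _ _)))⟩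
  · rw [h.etqe, h.etqt, ← map_one (incl u (n + 2))]
    exact ⟨memET _ _, Submodule.add_mem _ (Submodule.smul_mem _ _ (memE _ _))
      (Submodule.smul_mem _ _ (memET _ _))⟩
  · constructor
    · simpa using memE (T u (n + 2) (n + 1)) 1
    · simpa using memT (T u (n + 2) (n + 1)) 1
  · rw [h.epe, h.ept, ← map_one (incl u (n + 2)), ← map_mul]
    exact ⟨memE _ _, memT _ _⟩
  · rw [h.tpe, h.tpt]
    exact ⟨memT _ _, memT _ _⟩
  · rw [h.etpe, h.etpt, ← map_mul, ← map_mul]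
    exact ⟨memT _ _, memT _ _⟩
  · constructor
    · simpa using memE (E u (n + 2) (n + 1) * T u (n + 2) (n + 1)) 1
    · simpa using memT (E u (n + 2) (n + 1) * T u (n + 2) (n + 1)) 1
  · rw [h.eqpe, h.eqpt, ← map_one (incl u (n + 2)), ← map_mul, ← map_mul]
    exact ⟨memE _ _, memT _ _⟩
  · rw [h.tqpe, h.tqpt, ← map_mul, ← map_mul]
    exact ⟨memT _ _, Submodule.add_mem _ (memET _ _)
      (Submodule.smul_mem _ _ (Submodule.add_mem _ (memET _ _) (memET _ _)))⟩
  · rw [h.etqpe, h.etqpt, ← map_mul, ← map_mul]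
    exact ⟨memT _ _, memT _ _⟩

/-- Every element is a combination of products `x g z` with `x`, `z` from the previous algebra and
`g` a last product. -/
theorem lastBimodule_eq_top (hu : u ≠ 0) (n : ℕ) (y : BT u (n + 2)) : y ∈ lastBimodule u n := by
  induction n with
  | zero =>
    have key : ∀ w : BT u 2, (∀ g ∈ lastProducts u 0, g * w ∈ lastBimodule u 0) →
        ∀ y ∈ lastBimodule u 0, y * w ∈ lastBimodule u 0 := by
      intro w hw y hy
      induction hy using Submodule.span_induction with
      | mem y hy =>
        obtain ⟨x, z, g, hg, rfl⟩ := hy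
        obtain ⟨c, rfl⟩ := exists_eq_algebraMap (by omega) z
        have h := Submodule.smul_mem _ c (lastBimodule_mul x 1 (hw g hg))
        rw [map_one, mul_one] at h
        rwa [AlgHom.commutes, ← Algebra.commutes, ← Algebra.smul_def, smul_mul_assoc, mul_assoc]
      | zero => rw [zero_mul]; exact Submodule.zero_mem _
      | add y z _ _ hy hz => rw [add_mul]; exact Submodule.add_mem _ hy hz
      | smul c y _ hy => rw [smul_mul_assoc]; exact Submodule.smul_mem _ c hy
    refine mem_of_mul_gen_mem _ (mem_lastBimodule_of_mem one_mem_lastProducts) (fun i hi hin => ?_)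
      (fun i hi hin => ?_) y
    · obtain rfl : i = 1 := by omega
      exact key _ fun g hg => lastProducts_mul_T hg
    · obtain rfl : i = 1 := by omega
      exact key _ fun g hg => mem_lastBimodule_of_mem (lastProducts_mul_E hg)
  | succ n ih =>
    have key : ∀ w : BT u (n + 3),
        (∀ x : BT u (n + 1), Commute w (incl u (n + 2) (incl u (n + 1) x))) →
        (∀ g ∈ lastProducts u (n + 1), ∀ a ∈ lastProducts u n,
          g * incl u (n + 2) a * w ∈ lastBimodule u (n + 1)) →
        ∀ y ∈ lastBimodule u (n + 1), y * w ∈ lastBimodule u (n + 1) := by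
      intro w hcom hw y hy
      induction hy using Submodule.span_induction with
      | mem y hy =>
        obtain ⟨x, z, g, hg, rfl⟩ := hy
        induction ih z using Submodule.span_induction with
        | mem z hz =>
          obtain ⟨z₁, z₂, a, ha, rfl⟩ := hz
          have h := lastBimodule_mul (x * incl u (n + 1) z₁) (incl u (n + 1) z₂) (hw g hg a ha)
          convert h using 1
          simp only [map_mul]
          have hg' := (commute_lastProducts_incl_incl hg z₁).eq
          calc _ = incl u (n + 2) x * (g * incl u (n + 2) (incl u (n + 1) z₁)) * incl u (n + 2) a *
                (incl u (n + 2) (incl u (n + 1) z₂) * w) := by simp only [mul_assoc]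
            _ = _ := by rw [hg', ← (hcom z₂).eq]; simp only [mul_assoc]
        | zero => simp
        | add y z _ _ hy hz =>
          rw [map_add, mul_add, add_mul]; exact Submodule.add_mem _ hy hz
        | smul c y _ hy =>
          rw [map_smul, mul_smul_comm, smul_mul_assoc]; exact Submodule.smul_mem _ c hy
      | zero => rw [zero_mul]; exact Submodule.zero_mem _
      | add y z _ _ hy hz => rw [add_mul]; exact Submodule.add_mem _ hy hz
      | smul c y _ hy => rw [smul_mul_assoc]; exact Submodule.smul_mem _ c hy
    refine mem_of_mul_gen_mem _ (mem_lastBimodule_of_mem one_mem_lastProducts) (fun i hi hin => ?_)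
      (fun i hi hin => ?_) y
    · rcases eq_or_lt_of_le (by omega : i ≤ n + 2) with rfl | hi'
      · exact key _ (fun x => commute_T_incl_incl x) fun g hg a ha =>
          (lastProducts_mul_incl_mul hu hg ha).2
      · intro y hy
        have h := lastBimodule_mul 1 (T u (n + 2) i) hy
        rwa [map_one, one_mul, incl_T hi hi'] at h
    · rcases eq_or_lt_of_le (by omega : i ≤ n + 2) with rfl | hi'
      · exact key _ (fun x => commute_E_incl_incl x) fun g hg a ha =>
          (lastProducts_mul_incl_mul hu hg ha).1
      · intro y hy
        have h := lastBimodule_mul 1 (E u (n + 2) i) hy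
        rwa [map_one, one_mul, incl_E hi hi'] at h

theorem lastBimodule_induction (hu : u ≠ 0) {P : BT u (n + 2) → Prop}
    (hmem : ∀ (x z : BT u (n + 1)), ∀ g ∈ lastProducts u n,
      P (incl u (n + 1) x * g * incl u (n + 1) z))
    (hadd : ∀ x y, P x → P y → P (x + y)) (hsmul : ∀ (c : F) x, P x → P (c • x))
    (y : BT u (n + 2)) : P y := by
  induction lastBimodule_eq_top hu n y using Submodule.span_induction with
  | mem y hy => obtain ⟨x, z, g, hg, rfl⟩ := hy; exact hmem x z g hg
  | zero => simpa using hsmul 0 _ (hmem 0 0 1 one_mem_lastProducts)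
  | add x y _ _ h1 h2 => exact hadd x y h1 h2
  | smul c x _ h => exact hsmul c x h

/-- The relative trace is a homomorphism of bimodules. -/
theorem relTrace_incl_mul_mul_incl (hu : u ≠ 0) (A B : F) (n : ℕ) (x z : BT u n)
    (y : BT u (n + 1)) :
    relTrace hu A B n (incl u n x * y * incl u n z) = x * relTrace hu A B n y * z := by
  rcases n with _ | n
  · obtain ⟨c, rfl⟩ := exists_eq_algebraMap (by omega) y
    rw [← AlgHom.commutes (incl u 0) c, ← map_mul, ← map_mul, relTrace_incl, relTrace_incl]
  have h1 := relTrace_incl (n := n + 1) hu A B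
  have hE := relTrace_incl_mul_E_mul_incl (n := n + 1) hu A B (by omega)
  have hT := relTrace_incl_mul_T_mul_incl (n := n) hu A B
  have hET := relTrace_incl_mul_ET_mul_incl (n := n) hu A B
  induction y using lastBimodule_induction hu with
  | hmem x' z' g hg =>
    have e : incl u (n + 1) x * (incl u (n + 1) x' * g * incl u (n + 1) z') * incl u (n + 1) z =
        incl u (n + 1) (x * x') * g * incl u (n + 1) (z' * z) := by
      simp only [map_mul, mul_assoc]
    rw [e]
    rcases hg with rfl | rfl | rfl | rfl
    · rw [mul_one, mul_one, ← map_mul, ← map_mul, h1, h1]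
      simp only [mul_assoc]
    · rw [hE, hE]
      simp only [mul_smul_comm, smul_mul_assoc, mul_assoc]
    · rw [hT, hT]
      simp only [mul_smul_comm, smul_mul_assoc, mul_assoc]
    · rw [hET, hET]
      simp only [mul_smul_comm, smul_mul_assoc, mul_assoc]
  | hadd y y' hy hy' => simp only [mul_add, add_mul, map_add, hy, hy']
  | hsmul c y hy => simp only [mul_smul_comm, smul_mul_assoc, map_smul, hy]

/-! ### The trace property of two successive relative traces -/

/-- The values of `L` on the last products `1`, `q = E`, `p = T` and `q p` are given by six
coefficients:
`L 1 = α`, `L q = β + γ q` and `L p = L (q p) = δ + ε q + ζ q p`. -/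
structure HasValues (α β γ δ ε ζ : F) (L : BT u (n + 2) → BT u (n + 2)) : Prop where
  one : L 1 = α • 1
  tie : L (E u (n + 2) (n + 1)) = β • 1 + γ • E u (n + 2) (n + 1)
  braid : L (T u (n + 2) (n + 1)) = δ • 1 + ε • E u (n + 2) (n + 1) +
    ζ • (E u (n + 2) (n + 1) * T u (n + 2) (n + 1))
  tie_braid : L (E u (n + 2) (n + 1) * T u (n + 2) (n + 1)) = δ • 1 + ε • E u (n + 2) (n + 1) +
    ζ • (E u (n + 2) (n + 1) * T u (n + 2) (n + 1))

section Values

set_option linter.unusedSimpArgs false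

variable (hu : u ≠ 0) (A B : F)

theorem relTrace_values (n : ℕ) :
    (∀ x, relTrace hu A B n (incl u n x) = x) ∧
    (∀ x z, relTrace hu A B (n + 1) (incl u (n + 1) x * E u (n + 2) (n + 1) * incl u (n + 1) z) =
      B • (x * z)) ∧
    (∀ x, relTrace hu A B (n + 1) (incl u (n + 1) x * E u (n + 2) (n + 1) * 1) = B • x) ∧
    (∀ x z, relTrace hu A B (n + 1) (incl u (n + 1) x * T u (n + 2) (n + 1) * incl u (n + 1) z) =
      A • (x * z)) ∧
    (∀ x z, relTrace hu A B (n + 1) (incl u (n + 1) x *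
      (E u (n + 2) (n + 1) * T u (n + 2) (n + 1)) * incl u (n + 1) z) = A • (x * z)) ∧
    (∀ x, relTrace hu A B (n + 1) (incl u (n + 1) x *
      (E u (n + 2) (n + 1) * T u (n + 2) (n + 1)) * 1) = A • x) ∧
    relTrace hu A B (n + 1) 1 = 1 ∧
    relTrace hu A B (n + 1) (E u (n + 2) (n + 1)) = B • 1 ∧
    relTrace hu A B (n + 1) (T u (n + 2) (n + 1)) = A • 1 ∧
    relTrace hu A B (n + 1) (E u (n + 2) (n + 1) * T u (n + 2) (n + 1)) = A • 1 := by
  have h1 := relTrace_incl (n := n + 1) hu A B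
  have hE := relTrace_incl_mul_E_mul_incl (n := n + 1) hu A B (by omega)
  have hT := relTrace_incl_mul_T_mul_incl (n := n) hu A B
  have hET := relTrace_incl_mul_ET_mul_incl (n := n) hu A B
  refine ⟨relTrace_incl hu A B, hE, fun x => ?_, hT, hET, fun x => ?_, ?_, ?_, ?_, ?_⟩
  · simpa using hE x 1
  · simpa using hET x 1
  · simpa using h1 1
  · simpa using hE 1 1
  · simpa using hT 1 1
  · simpa using hET 1 1

theorem T_mul_T_eq (n : ℕ) : T u (n + 2) (n + 1) * T u (n + 2) (n + 1) =
    1 + (u - 1) • (E u (n + 2) (n + 1) + E u (n + 2) (n + 1) * T u (n + 2) (n + 1)) :=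
  T_mul_self (by omega) (by omega)

theorem E_mul_T_mul_T_eq (n : ℕ) :
    E u (n + 2) (n + 1) * T u (n + 2) (n + 1) * T u (n + 2) (n + 1) =
      u • E u (n + 2) (n + 1) + (u - 1) • (E u (n + 2) (n + 1) * T u (n + 2) (n + 1)) := by
  rw [mul_assoc, T_mul_T_eq, mul_add, mul_smul_comm, mul_add, ← mul_assoc,
    E_mul_self (by omega) (by omega), mul_one]
  module

/-- Rewriting rules for words in the last generators, used to compare the values of traces. -/
theorem word_rules (hu : u ≠ 0) (n : ℕ) :
    let p := T u (n + 2) (n + 1)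
    let q := E u (n + 2) (n + 1)
    let p' := Ring.inverse (T u (n + 2) (n + 1))
    p * q = q * p ∧ (∀ x, p * (q * x) = q * (p * x)) ∧ q * q = q ∧ (∀ x, q * (q * x) = q * x) ∧
      p * p = 1 + (u - 1) • (q + q * p) ∧ p' * p = 1 ∧ p' * (q * p) = q := by
  intro p q p'
  have hqp : q * p = p * q := E_mul_T (by omega) (by omega)
  have hqq : q * q = q := E_mul_self (by omega) (by omega)
  have hinv : p' * p = 1 := Ring.inverse_mul_cancel _ (isUnit_T hu (by omega) (by omega))
  refine ⟨hqp.symm, fun x => ?_, hqq, fun x => ?_, T_mul_T_eq n, hinv, ?_⟩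
  · rw [← mul_assoc, ← hqp, mul_assoc]
  · rw [← mul_assoc, hqq]
  · rw [hqp, ← mul_assoc, hinv, one_mul]

/-! For last products `a`, the relative traces of `X a g` are computed, where `X` and `g` are the
products `E`, `T` and `E T` one strand further. -/

theorem hasValues_e_e : HasValues B 0 B 0 0 B
    (fun a => relTrace hu A B (n + 2)
      (E u (n + 3) (n + 2) * incl u (n + 2) a *
        E u (n + 3) (n + 2))) := by
  have h := consecutive (u := u) hu n
  obtain ⟨r1, r2, r3, r4, r5, r6, r7, r8, r9, r10⟩ := relTrace_values hu A B (n + 1)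
  obtain ⟨w1, w2, w3, w4, w5, w6, w7⟩ := word_rules (u := u) hu n
  constructor
  · simp only [map_one, mul_one]
    rw [E_mul_self (by omega) (by omega), r8]
  all_goals
    simp only [map_mul (incl u (n + 2)), h.eqe, h.epe, h.eqpe]
    simp only [← map_mul (incl u (n + 2)), map_add, map_smul, r2, r3, r4, r5, r6]
    try simp only [mul_assoc, w1, w2, w3, w4, w5, w6, w7, mul_add, mul_smul_comm, mul_one]
    module

theorem hasValues_e_t : HasValues A 0 A 0 0 A
    (fun a => relTrace hu A B (n + 2)
      (E u (n + 3) (n + 2) * incl u (n + 2) a *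
        T u (n + 3) (n + 2))) := by
  have h := consecutive (u := u) hu n
  obtain ⟨r1, r2, r3, r4, r5, r6, r7, r8, r9, r10⟩ := relTrace_values hu A B (n + 1)
  obtain ⟨w1, w2, w3, w4, w5, w6, w7⟩ := word_rules (u := u) hu n
  constructor
  · simp only [map_one, mul_one]
    rw [r10]
  all_goals
    simp only [map_mul (incl u (n + 2)), h.eqt, h.ept, h.eqpt]
    simp only [← map_mul (incl u (n + 2)), map_add, map_smul, r2, r3, r4, r5, r6]
    try simp only [mul_assoc, w1, w2, w3, w4, w5, w6, w7, mul_add, mul_smul_comm, mul_one]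
    module

theorem hasValues_t_e : HasValues A 0 A 0 0 A
    (fun a => relTrace hu A B (n + 2)
      (T u (n + 3) (n + 2) * incl u (n + 2) a *
        E u (n + 3) (n + 2))) := by
  have h := consecutive (u := u) hu n
  obtain ⟨r1, r2, r3, r4, r5, r6, r7, r8, r9, r10⟩ := relTrace_values hu A B (n + 1)
  obtain ⟨w1, w2, w3, w4, w5, w6, w7⟩ := word_rules (u := u) hu n
  constructor
  · simp only [map_one, mul_one]
    rw [← E_mul_T (by omega) (by omega), r10]
  all_goals
    simp only [map_mul (incl u (n + 2)), h.tqe, h.tpe, h.tqpe]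
    simp only [← map_mul (incl u (n + 2)), map_add, map_smul, r2, r3, r4, r5, r6]
    try simp only [mul_assoc, w1, w2, w3, w4, w5, w6, w7, mul_add, mul_smul_comm, mul_one]
    module

/-! For last products `a`, the relative traces of `X a g` are computed, where `X` and `g` are the
products `E`, `T` and `E T` one strand further. -/

theorem hasValues_e_et : HasValues A 0 A 0 0 A
    (fun a => relTrace hu A B (n + 2)
      (E u (n + 3) (n + 2) * incl u (n + 2) a *
        (E u (n + 3) (n + 2) * T u (n + 3) (n + 2)))) := by
  have h := consecutive (u := u) hu n
  obtain ⟨r1, r2, r3, r4, r5, r6, r7, r8, r9, r10⟩ := relTrace_values hu A B (n + 1)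
  obtain ⟨w1, w2, w3, w4, w5, w6, w7⟩ := word_rules (u := u) hu n
  constructor
  · simp only [map_one, mul_one]
    rw [← mul_assoc, E_mul_self (by omega) (by omega), r10]
  all_goals
    simp only [map_mul (incl u (n + 2)), h.eqet, h.epet, h.eqpet]
    simp only [← map_mul (incl u (n + 2)), map_add, map_smul, r2, r3, r4, r5, r6]
    try simp only [mul_assoc, w1, w2, w3, w4, w5, w6, w7, mul_add, mul_smul_comm, mul_one]
    module

theorem hasValues_et_e : HasValues A 0 A 0 0 A
    (fun a => relTrace hu A B (n + 2)
      ((E u (n + 3) (n + 2) * T u (n + 3) (n + 2)) * incl u (n + 2) a *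
        E u (n + 3) (n + 2))) := by
  have h := consecutive (u := u) hu n
  obtain ⟨r1, r2, r3, r4, r5, r6, r7, r8, r9, r10⟩ := relTrace_values hu A B (n + 1)
  obtain ⟨w1, w2, w3, w4, w5, w6, w7⟩ := word_rules (u := u) hu n
  constructor
  · simp only [map_one, mul_one]
    rw [mul_assoc, ← E_mul_T (by omega) (by omega), ← mul_assoc,
      E_mul_self (by omega) (by omega), r10]
  all_goals
    simp only [map_mul (incl u (n + 2)), h.etqe, h.etpe, h.etqpe]
    simp only [← map_mul (incl u (n + 2)), map_add, map_smul, r2, r3, r4, r5, r6]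
    try simp only [mul_assoc, w1, w2, w3, w4, w5, w6, w7, mul_add, mul_smul_comm, mul_one]
    module

theorem hasValues_t_t : HasValues (1 + (u - 1) * (A + B)) B ((u - 1) * (A + B)) A (A * (u - 1))
    (A * (u - 1))
    (fun a => relTrace hu A B (n + 2)
      (T u (n + 3) (n + 2) * incl u (n + 2) a *
        T u (n + 3) (n + 2))) := by
  have h := consecutive (u := u) hu n
  obtain ⟨r1, r2, r3, r4, r5, r6, r7, r8, r9, r10⟩ := relTrace_values hu A B (n + 1)
  obtain ⟨w1, w2, w3, w4, w5, w6, w7⟩ := word_rules (u := u) hu n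
  constructor
  · simp only [map_one, mul_one]
    rw [T_mul_T_eq (n + 1), map_add, map_smul, map_add, r7, r8, r10]; module
  all_goals
    simp only [map_mul (incl u (n + 2)), h.tqt, h.tpt, h.tqpt]
    simp only [← map_mul (incl u (n + 2)), map_add, map_smul, r2, r3, r4, r5, r6]
    try simp only [mul_assoc, w1, w2, w3, w4, w5, w6, w7, mul_add, mul_smul_comm, mul_one]
    module

theorem hasValues_t_et : HasValues (u * B + (u - 1) * A) 0 (u * B + (u - 1) * A) 0 (A * u)
    (A * (u - 1))
    (fun a => relTrace hu A B (n + 2)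
      (T u (n + 3) (n + 2) * incl u (n + 2) a *
        (E u (n + 3) (n + 2) * T u (n + 3) (n + 2)))) := by
  have h := consecutive (u := u) hu n
  obtain ⟨r1, r2, r3, r4, r5, r6, r7, r8, r9, r10⟩ := relTrace_values hu A B (n + 1)
  obtain ⟨w1, w2, w3, w4, w5, w6, w7⟩ := word_rules (u := u) hu n
  constructor
  · simp only [map_one, mul_one]
    rw [← mul_assoc, ← E_mul_T (by omega) (by omega), E_mul_T_mul_T_eq (n + 1), map_add, map_smul,
      map_smul, r8, r10]; module
  all_goals
    simp only [map_mul (incl u (n + 2)), h.tqet, h.tpet, h.tqpet]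
    simp only [← map_mul (incl u (n + 2)), map_add, map_smul, r2, r3, r4, r5, r6]
    try simp only [mul_assoc, w1, w2, w3, w4, w5, w6, w7, mul_add, mul_smul_comm, mul_one]
    module

theorem hasValues_et_t : HasValues (u * B + (u - 1) * A) 0 (u * B + (u - 1) * A) 0 (A * u)
    (A * (u - 1))
    (fun a => relTrace hu A B (n + 2)
      ((E u (n + 3) (n + 2) * T u (n + 3) (n + 2)) * incl u (n + 2) a *
        T u (n + 3) (n + 2))) := by
  have h := consecutive (u := u) hu n
  obtain ⟨r1, r2, r3, r4, r5, r6, r7, r8, r9, r10⟩ := relTrace_values hu A B (n + 1)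
  obtain ⟨w1, w2, w3, w4, w5, w6, w7⟩ := word_rules (u := u) hu n
  constructor
  · simp only [map_one, mul_one]
    rw [E_mul_T_mul_T_eq (n + 1), map_add, map_smul, map_smul, r8, r10]; module
  all_goals
    simp only [map_mul (incl u (n + 2)), h.etqt, h.etpt, h.etqpt]
    simp only [← map_mul (incl u (n + 2)), map_add, map_smul, r2, r3, r4, r5, r6]
    try simp only [mul_assoc, w1, w2, w3, w4, w5, w6, w7, mul_add, mul_smul_comm, mul_one]
    module

theorem hasValues_et_et : HasValues (u * B + (u - 1) * A) 0 (u * B + (u - 1) * A) 0 (A * u)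
    (A * (u - 1))
    (fun a => relTrace hu A B (n + 2)
      ((E u (n + 3) (n + 2) * T u (n + 3) (n + 2)) * incl u (n + 2) a *
        (E u (n + 3) (n + 2) * T u (n + 3) (n + 2)))) := by
  have h := consecutive (u := u) hu n
  obtain ⟨r1, r2, r3, r4, r5, r6, r7, r8, r9, r10⟩ := relTrace_values hu A B (n + 1)
  obtain ⟨w1, w2, w3, w4, w5, w6, w7⟩ := word_rules (u := u) hu n
  constructor
  · simp only [map_one, mul_one]
    have e : E u (n + 3) (n + 2) * T u (n + 3) (n + 2) *
        (E u (n + 3) (n + 2) * T u (n + 3) (n + 2)) =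
        E u (n + 3) (n + 2) * T u (n + 3) (n + 2) * T u (n + 3) (n + 2) := by
      linear_combination (norm := noncomm_ring)
        -(E u (n + 3) (n + 2) * h.e_t * T u (n + 3) (n + 2)) +
        h.e_sq * T u (n + 3) (n + 2) * T u (n + 3) (n + 2)
    rw [e, E_mul_T_mul_T_eq (n + 1), map_add, map_smul, map_smul, r8, r10]; module
  all_goals
    simp only [map_mul (incl u (n + 2)), h.etqet, h.etpet, h.etqpet]
    simp only [← map_mul (incl u (n + 2)), map_add, map_smul, r2, r3, r4, r5, r6]
    try simp only [mul_assoc, w1, w2, w3, w4, w5, w6, w7, mul_add, mul_smul_comm, mul_one]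
    module

end Values

section Forms

variable (hu : u ≠ 0) (A B : F)

theorem relTrace_mul_incl_incl_mul {a b : BT u (n + 3)} (ha : a ∈ lastProducts u (n + 1))
    (hb : b ∈ lastProducts u (n + 1)) (x z : BT u (n + 1)) (g : BT u (n + 2)) :
    relTrace hu A B (n + 2) (a * incl u (n + 2) (incl u (n + 1) x * g * incl u (n + 1) z) * b) =
      incl u (n + 1) x * relTrace hu A B (n + 2) (a * incl u (n + 2) g * b) *
        incl u (n + 1) z := by
  rw [← relTrace_incl_mul_mul_incl]
  congr 1
  have hx := (commute_lastProducts_incl_incl ha x).eq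
  have hz := (commute_lastProducts_incl_incl hb z).eq
  simp only [map_mul]
  calc _ = a * incl u (n + 2) (incl u (n + 1) x) * incl u (n + 2) g *
        (incl u (n + 2) (incl u (n + 1) z) * b) := by simp only [mul_assoc]
    _ = _ := by rw [hx, ← hz]; simp only [mul_assoc]

/-- The values of `f a b` at `a, b` among `q = E`, `p = T` and `q p` are expressed by two elements
`h`, `m`; the value `f p p` is left free. -/
structure FormValues (f : BT u (n + 2) → BT u (n + 2) → BT u (n + 1)) (h m : BT u (n + 1)) :
    Prop where
  e_e : f (E u (n + 2) (n + 1)) (E u (n + 2) (n + 1)) = B • h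
  e_t : f (E u (n + 2) (n + 1)) (T u (n + 2) (n + 1)) = A • h
  t_e : f (T u (n + 2) (n + 1)) (E u (n + 2) (n + 1)) = A • h
  e_et : f (E u (n + 2) (n + 1)) (E u (n + 2) (n + 1) * T u (n + 2) (n + 1)) = A • h
  et_e : f (E u (n + 2) (n + 1) * T u (n + 2) (n + 1)) (E u (n + 2) (n + 1)) = A • h
  t_et : f (T u (n + 2) (n + 1)) (E u (n + 2) (n + 1) * T u (n + 2) (n + 1)) = m
  et_t : f (E u (n + 2) (n + 1) * T u (n + 2) (n + 1)) (T u (n + 2) (n + 1)) = m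
  et_et : f (E u (n + 2) (n + 1) * T u (n + 2) (n + 1))
    (E u (n + 2) (n + 1) * T u (n + 2) (n + 1)) = m

/-- The form `(a, b) ↦ ϱ (a z b)` on the last products: for `z` in the bimodule decomposition over
the previous algebra the values are those of the maps `a ↦ ϱ (X a g)`. -/
theorem exists_formValues (n : ℕ) (z : BT u (n + 1)) :
    ∃ h m, FormValues A B (fun a b => relTrace hu A B (n + 1) (a * incl u (n + 1) z * b)) h m := by
  rcases n with _ | n
  · obtain ⟨c, rfl⟩ := exists_eq_algebraMap (by omega) z
    obtain ⟨-, -, -, -, -, -, -, r8, r9, r10⟩ := relTrace_values hu A B 0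
    have hE := E_mul_self (u := u) (n := 2) (i := 1) (by omega) (by omega)
    have hET := E_mul_T (u := u) (n := 2) (i := 1) (by omega) (by omega)
    have hETT := E_mul_T_mul_T_eq (u := u) 0
    have e1 : ∀ a b : BT u 2, a * incl u 1 (algebraMap F _ c) * b = c • (a * b) := by
      intro a b
      rw [AlgHom.commutes, ← Algebra.commutes, ← Algebra.smul_def, smul_mul_assoc]
    have hTET : T u 2 1 * (E u 2 1 * T u 2 1) = E u 2 1 * T u 2 1 * T u 2 1 := by
      rw [← mul_assoc, hET]
    have hETET : E u 2 1 * T u 2 1 * (E u 2 1 * T u 2 1) = E u 2 1 * T u 2 1 * T u 2 1 := by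
      rw [mul_assoc, hTET, ← mul_assoc, ← mul_assoc, hE]
    refine ⟨c • 1, c • (u * B + (u - 1) * A) • 1, ?_⟩
    constructor <;> simp only [e1, Nat.reduceAdd, zero_add, map_smul] at *
    · rw [hE, r8, smul_comm]
    · rw [r10, smul_comm]
    · rw [← hET, r10, smul_comm]
    · rw [← mul_assoc, hE, r10, smul_comm]
    · rw [mul_assoc, ← hET, ← mul_assoc, hE, r10, smul_comm]
    · rw [hTET, hETT, map_add, map_smul, map_smul, r8, r10]; module
    · rw [hETT, map_add, map_smul, map_smul, r8, r10]; module
    · rw [hETET, hETT, map_add, map_smul, map_smul, r8, r10]; module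
  · induction z using lastBimodule_induction hu with
    | hmem x z g hg =>
      have ee := hasValues_e_e (n := n) hu A B
      have et := hasValues_e_t (n := n) hu A B
      have te := hasValues_t_e (n := n) hu A B
      have e_et := hasValues_e_et (n := n) hu A B
      have et_e := hasValues_et_e (n := n) hu A B
      have t_et := hasValues_t_et (n := n) hu A B
      have et_t := hasValues_et_t (n := n) hu A B
      have et_et := hasValues_et_et (n := n) hu A B
      have key : ∀ h m : BT u (n + 2),
          FormValues A B (fun a b => relTrace hu A B (n + 2) (a * incl u (n + 2) g * b)) h m →
          FormValues A B (fun a b => relTrace hu A B (n + 2)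
            (a * incl u (n + 2) (incl u (n + 1) x * g * incl u (n + 1) z) * b))
            (incl u (n + 1) x * h * incl u (n + 1) z)
            (incl u (n + 1) x * m * incl u (n + 1) z) := by
        intro h m H
        have hE := E_mem_lastProducts (u := u) (n := n + 1)
        have hT := T_mem_lastProducts (u := u) (n := n + 1)
        have hET := ET_mem_lastProducts (u := u) (n := n + 1)
        have c1 := fun {a b} ha hb => relTrace_mul_incl_incl_mul hu A B (a := a) (b := b) ha hb x z g
        constructor
        · rw [c1 hE hE, H.e_e, mul_smul_comm, smul_mul_assoc]
        · rw [c1 hE hT, H.e_t, mul_smul_comm, smul_mul_assoc]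
        · rw [c1 hT hE, H.t_e, mul_smul_comm, smul_mul_assoc]
        · rw [c1 hE hET, H.e_et, mul_smul_comm, smul_mul_assoc]
        · rw [c1 hET hE, H.et_e, mul_smul_comm, smul_mul_assoc]
        · rw [c1 hT hET, H.t_et]
        · rw [c1 hET hT, H.et_t]
        · rw [c1 hET hET, H.et_et]
      suffices h : ∃ h m, FormValues A B
          (fun a b => relTrace hu A B (n + 2) (a * incl u (n + 2) g * b)) h m by
        obtain ⟨h, m, H⟩ := h
        exact ⟨_, _, key h m H⟩
      rcases hg with rfl | rfl | rfl | rfl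
      · exact ⟨1, _, ee.one, et.one, te.one, e_et.one, et_e.one, t_et.one, et_t.one, et_et.one⟩
      · refine ⟨E u (n + 2) (n + 1), _, ?_, ?_, ?_, ?_, ?_, t_et.tie, et_t.tie, et_et.tie⟩
        · simpa using ee.tie
        · simpa using et.tie
        · simpa using te.tie
        · simpa using e_et.tie
        · simpa using et_e.tie
      · refine ⟨E u (n + 2) (n + 1) * T u (n + 2) (n + 1), _, ?_, ?_, ?_, ?_, ?_,
          t_et.braid, et_t.braid, et_et.braid⟩
        · simpa using ee.braid
        · simpa using et.braid
        · simpa using te.braid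
        · simpa using e_et.braid
        · simpa using et_e.braid
      · refine ⟨E u (n + 2) (n + 1) * T u (n + 2) (n + 1), _, ?_, ?_, ?_, ?_, ?_,
          t_et.tie_braid, et_t.tie_braid, et_et.tie_braid⟩
        · simpa using ee.tie_braid
        · simpa using et.tie_braid
        · simpa using te.tie_braid
        · simpa using e_et.tie_braid
        · simpa using et_e.tie_braid
    | hadd x y hx hy =>
      obtain ⟨h, m, H⟩ := hx
      obtain ⟨h', m', H'⟩ := hy
      refine ⟨h + h', m + m', ?_⟩
      constructor <;> simp only [map_add, mul_add, add_mul, smul_add]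
      · exact congrArg₂ _ H.e_e H'.e_e
      · exact congrArg₂ _ H.e_t H'.e_t
      · exact congrArg₂ _ H.t_e H'.t_e
      · exact congrArg₂ _ H.e_et H'.e_et
      · exact congrArg₂ _ H.et_e H'.et_e
      · exact congrArg₂ _ H.t_et H'.t_et
      · exact congrArg₂ _ H.et_t H'.et_t
      · exact congrArg₂ _ H.et_et H'.et_et
    | hsmul c x hx =>
      obtain ⟨h, m, H⟩ := hx
      refine ⟨c • h, c • m, ?_⟩
      constructor <;>
        simp only [map_smul, mul_smul_comm, smul_mul_assoc, smul_comm A c, smul_comm B c]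
      · exact congrArg _ H.e_e
      · exact congrArg _ H.e_t
      · exact congrArg _ H.t_e
      · exact congrArg _ H.e_et
      · exact congrArg _ H.et_e
      · exact congrArg _ H.t_et
      · exact congrArg _ H.et_t
      · exact congrArg _ H.et_et

end Forms

section Adjoint

variable (hu : u ≠ 0) (A B : F)

theorem relTrace_one_left_right (n : ℕ) (z : BT u (n + 1)) :
    relTrace hu A B (n + 1) (1 * incl u (n + 1) z * 1) = z ∧
    relTrace hu A B (n + 1) (1 * incl u (n + 1) z * E u (n + 2) (n + 1)) = B • z ∧
    relTrace hu A B (n + 1) (E u (n + 2) (n + 1) * incl u (n + 1) z * 1) = B • z ∧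
    relTrace hu A B (n + 1) (1 * incl u (n + 1) z * T u (n + 2) (n + 1)) = A • z ∧
    relTrace hu A B (n + 1) (T u (n + 2) (n + 1) * incl u (n + 1) z * 1) = A • z ∧
    relTrace hu A B (n + 1)
      (1 * incl u (n + 1) z * (E u (n + 2) (n + 1) * T u (n + 2) (n + 1))) = A • z ∧
    relTrace hu A B (n + 1)
      (E u (n + 2) (n + 1) * T u (n + 2) (n + 1) * incl u (n + 1) z * 1) = A • z := by
  obtain ⟨r1, r2, r3, r4, r5, r6, r7, r8, r9, r10⟩ := relTrace_values hu A B n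
  refine ⟨?_, ?_, ?_, ?_, ?_, ?_, ?_⟩ <;> simp only [one_mul, mul_one]
  · exact relTrace_incl hu A B z
  · simpa using r2 z 1
  · simpa using r2 1 z
  · simpa using r4 z 1
  · simpa using r4 1 z
  · simpa using r5 z 1
  · simpa using r5 1 z

/-- Two linear maps with the same values on the last products are adjoint to each other for the
pairing `(a, b) ↦ ϱ (a z b)`, provided the values satisfy the four equations that express this
adjointness on `1`, `E` and `T`. -/
theorem relTrace_mul_incl_mul_adjoint {α β γ δ ε ζ : F} {L R : BT u (n + 2) → BT u (n + 2)}
    (hL : HasValues α β γ δ ε ζ L) (hR : HasValues α β γ δ ε ζ R) (h1 : α * B = β + γ * B)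
    (h2 : α * A = δ + ε * B + ζ * A) (h3 : β * A = δ * B) (h4 : γ * A = ε * B + ζ * A)
    (z : BT u (n + 1)) {a b : BT u (n + 2)} (ha : a ∈ lastProducts u n)
    (hb : b ∈ lastProducts u n) :
    relTrace hu A B (n + 1) (L a * incl u (n + 1) z * b) =
      relTrace hu A B (n + 1) (a * incl u (n + 1) z * R b) := by
  obtain ⟨h, m, H⟩ := exists_formValues hu A B n z
  obtain ⟨s1, s2, s3, s4, s5, s6, s7⟩ := relTrace_one_left_right hu A B n z
  obtain ⟨t1, t2, t3, t4, t5, t6, t7, t8⟩ := H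
  rcases ha with rfl | rfl | rfl | rfl <;> rcases hb with rfl | rfl | rfl | rfl <;>
    simp only [hL.one, hL.tie, hL.braid, hL.tie_braid, hR.one, hR.tie, hR.braid, hR.tie_braid,
      add_mul, mul_add, smul_mul_assoc, mul_smul_comm, map_add, map_smul, s1, s2, s3, s4, s5, s6,
      s7, t1, t2, t3, t4, t5, t6, t7, t8]
  · linear_combination (norm := module) h1 • z
  · linear_combination (norm := module) h2 • z
  · linear_combination (norm := module) h2 • z
  · linear_combination (norm := module) -h1 • z
  · linear_combination (norm := module) h3 • z + h4 • h
  · linear_combination (norm := module) h3 • z + h4 • h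
  · linear_combination (norm := module) -h2 • z
  · linear_combination (norm := module) -h3 • z - h4 • h
  · linear_combination (norm := module) -h2 • z
  · linear_combination (norm := module) -h3 • z - h4 • h

end Adjoint

section Trace

variable (hu : u ≠ 0) (A B : F)

/-- The trace property for `Y = a' g b'` with `a'`, `b'` built from last products, in the form in
which the factors from fewer strands are collected in `z`. -/
theorem relTrace_relTrace_mul_incl_mul {X g : BT u (n + 3)}
    (hX : X = E u (n + 3) (n + 2) ∨ X = T u (n + 3) (n + 2)) (hg : g ∈ lastProducts u (n + 1))
    (z : BT u (n + 1)) {a b : BT u (n + 2)} (ha : a ∈ lastProducts u n)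
    (hb : b ∈ lastProducts u n) :
    relTrace hu A B (n + 1)
        (relTrace hu A B (n + 2) (X * incl u (n + 2) a * g) * incl u (n + 1) z * b) =
      relTrace hu A B (n + 1)
        (a * incl u (n + 1) z * relTrace hu A B (n + 2) (g * incl u (n + 2) b * X)) := by
  obtain ⟨-, -, -, -, -, -, -, r8, r9, -⟩ := relTrace_values hu A B (n + 1)
  have unit : ∀ c : F, relTrace hu A B (n + 2) X = c • 1 →
      relTrace hu A B (n + 1)
        (relTrace hu A B (n + 2) (X * incl u (n + 2) a * 1) * incl u (n + 1) z * b) =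
      relTrace hu A B (n + 1)
        (a * incl u (n + 1) z * relTrace hu A B (n + 2) (1 * incl u (n + 2) b * X)) := by
    intro c hc
    have h1 := relTrace_incl_mul_mul_incl hu A B (n + 2) 1 a X
    have h2 := relTrace_incl_mul_mul_incl hu A B (n + 2) b 1 X
    rw [map_one, one_mul, one_mul, hc] at h1
    rw [map_one, mul_one, mul_one, hc] at h2
    rw [mul_one, one_mul, h1, h2]
    simp only [smul_mul_assoc, mul_smul_comm, one_mul, mul_one]
  rcases hX with rfl | rfl <;> rcases hg with rfl | rfl | rfl | rfl
  · exact unit B r8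
  · exact relTrace_mul_incl_mul_adjoint hu A B (hasValues_e_e hu A B) (hasValues_e_e hu A B)
      (by ring) (by ring) (by ring) (by ring) z ha hb
  · exact relTrace_mul_incl_mul_adjoint hu A B (hasValues_e_t hu A B) (hasValues_t_e hu A B)
      (by ring) (by ring) (by ring) (by ring) z ha hb
  · exact relTrace_mul_incl_mul_adjoint hu A B (hasValues_e_et hu A B) (hasValues_et_e hu A B)
      (by ring) (by ring) (by ring) (by ring) z ha hb
  · exact unit A r9
  · exact relTrace_mul_incl_mul_adjoint hu A B (hasValues_t_e hu A B) (hasValues_e_t hu A B)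
      (by ring) (by ring) (by ring) (by ring) z ha hb
  · exact relTrace_mul_incl_mul_adjoint hu A B (hasValues_t_t hu A B) (hasValues_t_t hu A B)
      (by ring) (by ring) (by ring) (by ring) z ha hb
  · exact relTrace_mul_incl_mul_adjoint hu A B (hasValues_t_et hu A B) (hasValues_et_t hu A B)
      (by ring) (by ring) (by ring) (by ring) z ha hb

/-- Writing `Y = x g y` and decomposing `x` and `y` once more, all factors that commute with `X` or
`g` are pulled out or collected in the middle. -/
theorem relTrace_relTrace_mul_comm {X : BT u (n + 2)}
    (hX : X = E u (n + 2) (n + 1) ∨ X = T u (n + 2) (n + 1)) (Y : BT u (n + 2)) :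
    relTrace hu A B n (relTrace hu A B (n + 1) (X * Y)) =
      relTrace hu A B n (relTrace hu A B (n + 1) (Y * X)) := by
  have hXl : X ∈ lastProducts u n := by
    rcases hX with rfl | rfl
    · exact E_mem_lastProducts
    · exact T_mem_lastProducts
  induction Y using lastBimodule_induction hu with
  | hadd x y hx hy => simp only [mul_add, add_mul, map_add, hx, hy]
  | hsmul c x hx => simp only [mul_smul_comm, smul_mul_assoc, map_smul, hx]
  | hmem x y g hg =>
    rcases n with _ | n
    · obtain ⟨c, rfl⟩ := exists_eq_algebraMap (by omega) x
      obtain ⟨d, rfl⟩ := exists_eq_algebraMap (by omega) y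
      have hE := E_mul_T (u := u) (n := 2) (i := 1) (by omega) (by omega)
      have hc : Commute X g := by
        rcases hX with rfl | rfl <;> rcases hg with rfl | rfl | rfl | rfl
        · exact Commute.one_right _
        · exact Commute.refl _
        · exact hE
        · exact (Commute.refl _).mul_right hE
        · exact Commute.one_right _
        · exact hE.symm
        · exact Commute.refl _
        · exact Commute.mul_right hE.symm (Commute.refl _)
      rw [AlgHom.commutes, AlgHom.commutes]
      have hc' : Commute X (algebraMap F _ c * g * algebraMap F _ d) :=
        ((Algebra.commute_algebraMap_right c X).mul_right hc).mul_right
          (Algebra.commute_algebraMap_right d X)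
      rw [hc'.eq]
    · induction x using lastBimodule_induction hu with
      | hadd x x' hx hx' => simp only [map_add, mul_add, add_mul, hx, hx']
      | hsmul c x hx => simp only [map_smul, mul_smul_comm, smul_mul_assoc, hx]
      | hmem x₁ x₂ a ha =>
        induction y using lastBimodule_induction hu with
        | hadd y y' hy hy' => simp only [map_add, mul_add, add_mul, hy, hy']
        | hsmul c y hy => simp only [map_smul, mul_smul_comm, smul_mul_assoc, hy]
        | hmem y₁ y₂ b hb =>
          have hX1 := (commute_lastProducts_incl_incl hXl x₁).eq
          have hX2 := (commute_lastProducts_incl_incl hXl y₂).eq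
          have hg1 := (commute_lastProducts_incl_incl hg x₂).eq
          have hg2 := (commute_lastProducts_incl_incl hg y₁).eq
          have eL : X * (incl u (n + 2) (incl u (n + 1) x₁ * a * incl u (n + 1) x₂) * g *
              incl u (n + 2) (incl u (n + 1) y₁ * b * incl u (n + 1) y₂)) =
              incl u (n + 2) (incl u (n + 1) x₁) * (X * incl u (n + 2) a * g) *
                incl u (n + 2) (incl u (n + 1) (x₂ * y₁) * b * incl u (n + 1) y₂) := by
            simp only [map_mul]
            calc _ = X * incl u (n + 2) (incl u (n + 1) x₁) * incl u (n + 2) a *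
                  (incl u (n + 2) (incl u (n + 1) x₂) * g) *
                  incl u (n + 2) (incl u (n + 1) y₁) * incl u (n + 2) b *
                  incl u (n + 2) (incl u (n + 1) y₂) := by simp only [mul_assoc]
              _ = _ := by rw [hX1, ← hg1]; simp only [mul_assoc]
          have eR : incl u (n + 2) (incl u (n + 1) x₁ * a * incl u (n + 1) x₂) * g *
              incl u (n + 2) (incl u (n + 1) y₁ * b * incl u (n + 1) y₂) * X =
              incl u (n + 2) (incl u (n + 1) x₁ * a * incl u (n + 1) (x₂ * y₁)) *
                (g * incl u (n + 2) b * X) * incl u (n + 2) (incl u (n + 1) y₂) := by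
            simp only [map_mul]
            calc _ = incl u (n + 2) (incl u (n + 1) x₁) * incl u (n + 2) a *
                  incl u (n + 2) (incl u (n + 1) x₂) *
                  (g * incl u (n + 2) (incl u (n + 1) y₁)) * incl u (n + 2) b *
                  (incl u (n + 2) (incl u (n + 1) y₂) * X) := by simp only [mul_assoc]
              _ = _ := by rw [← hX2, hg2]; simp only [mul_assoc]
          have key := relTrace_relTrace_mul_incl_mul hu A B hX hg (x₂ * y₁) ha hb
          rw [eL, eR, relTrace_incl_mul_mul_incl, relTrace_incl_mul_mul_incl]
          have e1 : ∀ w v : BT u (n + 2), incl u (n + 1) x₁ * w *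
              (incl u (n + 1) (x₂ * y₁) * v * incl u (n + 1) y₂) =
              incl u (n + 1) x₁ * (w * incl u (n + 1) (x₂ * y₁) * v) * incl u (n + 1) y₂ := by
            intro w v; simp only [mul_assoc]
          have e2 : ∀ w v : BT u (n + 2), incl u (n + 1) x₁ * w * incl u (n + 1) (x₂ * y₁) * v *
              incl u (n + 1) y₂ =
              incl u (n + 1) x₁ * (w * incl u (n + 1) (x₂ * y₁) * v) * incl u (n + 1) y₂ := by
            intro w v; simp only [mul_assoc]
          rw [e1, e2, relTrace_incl_mul_mul_incl, relTrace_incl_mul_mul_incl, key]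

end Trace

end BT

end

theorem theorem4p3 (F : Type*) [Field F] [Algebra (RatFunc ℂ) F] (A B u : F)
    (hu : u = algebraMap (RatFunc ℂ) F RatFunc.X) :
    -- the elements on which the maps are prescribed form a linear basis of each algebra
    (∀ n : ℕ, LinearIndependent F (BT.basisElt u n) ∧
      Submodule.span F (Set.range (BT.basisElt u n)) = ⊤) ∧
    -- `ϱ n` is the map from the algebra on `n + 1` strands to the algebra on `n` strands
    ∃ ϱ : ∀ n : ℕ, BT u (n + 1) →ₗ[F] BT u n,
      (∀ n x, ϱ n (BT.basisElt u (n + 1) x) = BT.relTraceValue u n A B x) ∧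
      (∀ (n : ℕ) (X Z : BT u n) (Y : BT u (n + 1)),
        ϱ n (BT.incl u n X * Y * BT.incl u n Z) = X * ϱ n Y * Z) ∧
      (∀ (n : ℕ) (Y : BT u (n + 2)),
        ϱ n (ϱ (n + 1) (BT.T u (n + 2) (n + 1) * Y)) =
          ϱ n (ϱ (n + 1) (Y * BT.T u (n + 2) (n + 1)))) ∧
      (∀ (n : ℕ) (Y : BT u (n + 2)),
        ϱ n (ϱ (n + 1) (BT.E u (n + 2) (n + 1) * Y)) =
          ϱ n (ϱ (n + 1) (Y * BT.E u (n + 2) (n + 1)))) := by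
  have hu0 : u ≠ 0 := by
    rw [hu]
    exact (map_ne_zero_iff _ (algebraMap (RatFunc ℂ) F).injective).mpr RatFunc.X_ne_zero
  exact ⟨fun n => ⟨BT.linearIndependent_basisElt hu0 n, BT.span_basisElt hu0 n⟩,
    fun n => BT.relTrace hu0 A B n, BT.relTrace_basisElt hu0 A B,
    fun n X Z Y => BT.relTrace_incl_mul_mul_incl hu0 A B n X Z Y,
    fun _ Y => BT.relTrace_relTrace_mul_comm hu0 A B (Or.inr rfl) Y,
    fun _ Y => BT.relTrace_relTrace_mul_comm hu0 A B (Or.inl rfl) Y⟩
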